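/- Let $H$ be a separable Hilbert space and $A:D(A)\subset H\to H$ a self-adjoint positive unbounded operator with a complete orthonormal system of eigenvectors $\{v_k\}_{k\ge1}$, $Av_k=\lambda_kv_k$, $0<\lambda_1\le\lambda_2\le\dots\to+\infty$. Write $h_k=(h,v_k)$; for $\tau>0$ put $D(A^\tau)=\{h\in H:\ \|h\|_\tau^2:=\sum_k\lambda_k^{2\tau}|h_k|^2<\infty\}$. Let $T>0$, $\gamma>0$, $\rho\in(0,1)$, and let $D_t^\rho h(t)=\frac1{\Gamma(1-\rho)}\int_0^t(t-\xi)^{-\rho}h'(\xi)\,d\xi$ be the Caputo derivative. For $\lambda>0$, $t\ge0$ let $$A_\rho(\lambda,t)=\frac\gamma\pi\int_0^\infty \frac{e^{-rt}\,\lambda^2r^{\rho-1}\sin\rho\pi}{(-r+\lambda\gamma r^\rho\cos\rho\pi+\lambda)^2+(\lambda\gamma r^\rho\sin\rho\pi)^2}\,dr,$$ $$B_\rho(\lambda,t)=\frac\gamma\pi\int_0^\infty \frac{e^{-rt}\,\lambda r^{\rho}\sin\rho\pi}{(-r+\lambda\gamma r^\rho\cos\rho\pi+\lambda)^2+(\lambda\gamma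 r^\rho\sin\rho\pi)^2}\,dr.$$ A function $u\in C([0,T];H)$ is called a solution of the equation $$u'(t)+A(1+\gamma D_t^\rho)u(t)=f(t),\qquad 0<t\le T,\tag{1}$$ if $u'$, $Au$ and $AD_t^\rho u$ exist and belong to $C((0,T];H)$ and (1) holds (the derivative at $T$ is one-sided). Theorem. There are a constant $C>0$ depending only on $\rho,\gamma,T,\lambda_1$ and, for every $\varepsilon\in(0,1)$, a constant $C_\varepsilon>0$ depending only on $\rho,\gamma,T,\lambda_1,\varepsilon$ such that for all $f\in C([0,T];D(A^\varepsilon))$ and $\varphi\in D(A)$ the following holds. The non-local problem consisting of (1) and $u(T)=u(0)+\varphi$ has a unique solution $u$. It equals $V+W$, where $V$ solves (1) with $V(0)=0$, and $W$ solves (1) with $f$ replaced by $0$ and satisfies $W(T)=W(0)+\varphi-V(T)$. It is given for $0\le t\le T$ by the series, convergent in $H$, $$u(t)=\sum_{k=1}^\infty\left[\frac{A_\rho(\lambda_k,t)}{A_\rho(\lambda_k,T)-1}\,(\varphi_k-V_k(T))+V_k(t)\right]v_k,\qquad V_k(t)=\int_0^tB_\rho(\lambda_k,t-\tau)f_k(\tau)\,d\tau,\quad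 f_k(\tau)=(f(\tau),v_k).$$ Moreover, for $0<t<T$, $$\|u'(t)\|^2+\|Au(t)\|^2+\|AD_t^\rho u(t)\|^2\le C\,t^{2(\rho-1)}\|\varphi\|^2+C\,\|\varphi\|_1^2+C_\varepsilon\max_{s\in[0,T]}\|f(s)\|_\varepsilon^2 .$$ -/

import Mathlib

open Set Filter Topology MeasureTheory

noncomputable section

namespace RayleighStokes

section Scalar

/-- The function `A_ρ(λ, t)`, given by its Laplace-type integral representation. -/
def Afun (ρ γ lam t : ℝ) : ℝ :=
  γ / Real.pi * ∫ r in Ioi (0 : ℝ), Real.exp (-r * t) *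
    (lam ^ 2 * r ^ (ρ - 1) * Real.sin (ρ * Real.pi) /
      ((-r + lam * γ * r ^ ρ * Real.cos (ρ * Real.pi) + lam) ^ 2
        + (lam * γ * r ^ ρ * Real.sin (ρ * Real.pi)) ^ 2))

/-- The function `B_ρ(λ, t)`, given by its Laplace-type integral representation. -/
def Bfun (ρ γ lam t : ℝ) : ℝ :=
  γ / Real.pi * ∫ r in Ioi (0 : ℝ), Real.exp (-r * t) *
    (lam * r ^ ρ * Real.sin (ρ * Real.pi) /
      ((-r + lam * γ * r ^ ρ * Real.cos (ρ * Real.pi) + lam) ^ 2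
        + (lam * γ * r ^ ρ * Real.sin (ρ * Real.pi)) ^ 2))

end Scalar

section Caputo

variable {H : Type*} [NormedAddCommGroup H] [NormedSpace ℝ H]

/-- The integral (over `0 < ξ < t`) that defines the Caputo derivative at `t` exists
as a Bochner integral. -/
def CaputoExists (ρ : ℝ) (h : ℝ → H) (t : ℝ) : Prop :=
  IntervalIntegrable (fun ξ : ℝ => (t - ξ) ^ (-ρ) • deriv h ξ) volume 0 t

/-- The Caputo derivative
`D^ρ h(t) = Γ(1-ρ)⁻¹ ∫₀ᵗ (t-ξ)^(-ρ) h'(ξ) dξ` (meaningful if `CaputoExists ρ h t`). -/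
def caputo (ρ : ℝ) (h : ℝ → H) (t : ℝ) : H :=
  (Real.Gamma (1 - ρ))⁻¹ • ∫ ξ in (0 : ℝ)..t, (t - ξ) ^ (-ρ) • deriv h ξ

end Caputo

section Operator

variable {𝕜 : Type*} [RCLike 𝕜] {H : Type*} [NormedAddCommGroup H] [InnerProductSpace 𝕜 H]

/-- `A` is a self-adjoint operator (with its domain), the complete orthonormal system `v`
consists of eigenvectors of `A`, and the corresponding eigenvalues `lam k` are positive,
non-decreasing and tend to infinity. -/
structure IsSpectral [CompleteSpace H] (A : H →ₗ.[𝕜] H) (v : HilbertBasis ℕ 𝕜 H)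
    (lam : ℕ → ℝ) : Prop where
  selfAdjoint : IsSelfAdjoint A
  eigen : ∀ k, ∃ hk : v k ∈ A.domain, A ⟨v k, hk⟩ = (lam k : 𝕜) • v k
  pos : ∀ k, 0 < lam k
  mono : Monotone lam
  tendsto : Tendsto lam atTop atTop

open Classical in
/-- The value `A x` of an operator at a vector of its domain (and `0` off the domain). -/
def opVal (A : H →ₗ.[𝕜] H) (x : H) : H :=
  if hx : x ∈ A.domain then A ⟨x, hx⟩ else 0

/-- The domain `D(A^τ) = {h : ∑ λ_k^(2τ) |h_k|² < ∞}` of the power `A^τ`. -/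
def powDomain (v : HilbertBasis ℕ 𝕜 H) (lam : ℕ → ℝ) (τ : ℝ) : Set H :=
  {h | Summable fun k => lam k ^ (2 * τ) * ‖inner 𝕜 (v k) h‖ ^ 2}

/-- The norm `‖h‖_τ = (∑ λ_k^(2τ) |h_k|²)^(1/2)` of `D(A^τ)`. -/
def powNorm (v : HilbertBasis ℕ 𝕜 H) (lam : ℕ → ℝ) (τ : ℝ) (h : H) : ℝ :=
  √(∑' k, lam k ^ (2 * τ) * ‖inner 𝕜 (v k) h‖ ^ 2)

/-- `f ∈ C([0,T]; D(A^τ))`: the values on `[0,T]` lie in `D(A^τ)`, and `f` is continuous on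
`[0,T]` for the norm of `D(A^τ)`. -/
def ContinuousInPow (v : HilbertBasis ℕ 𝕜 H) (lam : ℕ → ℝ) (τ T : ℝ) (f : ℝ → H) : Prop :=
  (∀ t ∈ Icc 0 T, f t ∈ powDomain v lam τ) ∧
  ∀ t ∈ Icc 0 T, Tendsto (fun s => powNorm v lam τ (f s - f t)) (𝓝[Icc 0 T] t) (𝓝 0)

variable [NormedSpace ℝ H]

/-- `u` satisfies `u' + A(1 + γ D^ρ)u = f` on `(0,T]`, with the required regularity:
`u ∈ C([0,T]; H)` and `u'`, `Au`, `A D^ρ u ∈ C((0,T]; H)`. Only the restriction of `u` to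
`[0,T]` matters; in particular the derivative at `T` is the left one. -/
structure SolvesEquation (A : H →ₗ.[𝕜] H) (ρ γ T : ℝ) (f u : ℝ → H) : Prop where
  continuousOn : ContinuousOn u (Icc 0 T)
  differentiable : ∀ t ∈ Ioc 0 T, DifferentiableWithinAt ℝ u (Icc 0 T) t
  deriv_continuousOn : ContinuousOn (derivWithin u (Icc 0 T)) (Ioc 0 T)
  mem_domain : ∀ t ∈ Ioc 0 T, u t ∈ A.domain
  op_continuousOn : ContinuousOn (fun t => opVal A (u t)) (Ioc 0 T)
  caputo_exists : ∀ t ∈ Ioc 0 T, CaputoExists ρ u t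
  caputo_mem_domain : ∀ t ∈ Ioc 0 T, caputo ρ u t ∈ A.domain
  op_caputo_continuousOn : ContinuousOn (fun t => opVal A (caputo ρ u t)) (Ioc 0 T)
  equation : ∀ t ∈ Ioc 0 T,
    derivWithin u (Icc 0 T) t + opVal A (u t + γ • caputo ρ u t) = f t

/-- `u` is a solution of the forward problem with initial value `u(0) = φ`. -/
def IsForwardSolution (A : H →ₗ.[𝕜] H) (ρ γ T : ℝ) (f : ℝ → H) (φ : H) (u : ℝ → H) : Prop :=
  SolvesEquation A ρ γ T f u ∧ u 0 = φ

/-- `u` is a solution of the non-local problem with condition `u(T) = u(0) + φ`. -/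
def IsNonlocalSolution (A : H →ₗ.[𝕜] H) (ρ γ T : ℝ) (f : ℝ → H) (φ : H) (u : ℝ → H) : Prop :=
  SolvesEquation A ρ γ T f u ∧ u T = u 0 + φ

end Operator

section Coefficients

variable {𝕜 : Type*} [RCLike 𝕜] {H : Type*} [NormedAddCommGroup H] [InnerProductSpace 𝕜 H]

/-- `V_k(t) = ∫₀ᵗ B_ρ(λ_k, t-τ) f_k(τ) dτ`. -/
def Vcoeff (v : HilbertBasis ℕ 𝕜 H) (lam : ℕ → ℝ) (ρ γ : ℝ) (f : ℝ → H) (k : ℕ) (t : ℝ) : 𝕜 :=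
  ∫ τ in (0 : ℝ)..t, (Bfun ρ γ (lam k) (t - τ) : 𝕜) * inner 𝕜 (v k) (f τ)

/-- `A_ρ(λ_k,t) / (A_ρ(λ_k,T) - 1) * (φ_k - V_k(T)) + V_k(t)`. -/
def solCoeff (v : HilbertBasis ℕ 𝕜 H) (lam : ℕ → ℝ) (ρ γ T : ℝ) (f : ℝ → H) (φ : H)
    (k : ℕ) (t : ℝ) : 𝕜 :=
  ((Afun ρ γ (lam k) t / (Afun ρ γ (lam k) T - 1) : ℝ) : 𝕜)
      * (inner 𝕜 (v k) φ - Vcoeff v lam ρ γ f k T)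
    + Vcoeff v lam ρ γ f k t

end Coefficients

end RayleighStokes

end

/-! Expansion in eigenvectors reduces (1) to the scalar problems y' + λ(1 + γ D^ρ)y = f, y(0) = c.
For g = y' this is the Volterra equation g + κ * g = f - λc with κ(t) = λ + λγ t^(-ρ)/Γ(1-ρ). It is
solved by a resolvent B with B + κ * B = 1 (`resolvent_equation`): y = cA + B * f, where A = 1 -
λ∫B.

That the Laplace integral `Bfun` is this resolvent is seen on transforms. Its density is, up to the
factor -1/π, the imaginary part of F(z) = 1/(z + λ + λγ z^ρ) on the upper edge of the cut along the
negative axis. Cauchy's theorem then represents F as the Stieltjes transform of the density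
(`stieltjes`), so B has Laplace transform F and B + κ * B has transform 1/s. A nonnegative function
with that transform is 1 almost everywhere (`ae_eq_one_of_laplace`).

The density is positive, so B decreases from B(0) = 1. Together with the resolvent equation this
gives bounds with explicit dependence on λ: λB(t) ≤ C t^(ρ-1) (`lam_mul_Bfun_le`), |B'(t)| ≤ C λ^ε
t^(ε(1-ρ)-1) (`abs_Bfun_deriv_le_rpow`), and 1 - A(T) bounded below for λ ≥ λ₁ (`one_sub_Afun_ge`).
The first two majorants are integrable at 0, so the modes assemble into convolutions with operator
kernels; the factor λ^ε is paid for by f ∈ D(A^ε). The third makes the non-local condition solvable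
for the initial value, c_k = (φ_k - V_k(T))/(A(λ_k,T) - 1), and keeps c in D(A).

The solution is therefore the forward solution started at some c ∈ D(A) (`exists_forward`). For such
data u', Au and A D^ρ u stay bounded down to t = 0, so the estimate holds even without the term
t^(2(ρ-1))‖φ‖². Uniqueness holds because the coefficients of every solution obey the resolvent
formula (`SolvesEquation.inner_eq`), and the non-local condition then fixes the initial value. -/

noncomputable section

namespace RayleighStokes

/-! ### The contour integrand in the logarithmic strip 0 ≤ Im ζ ≤ π. -/

section Contour

variable {ρ γ lam : ℝ}

/-- The symbol `z + λ + λ γ z ^ ρ` at `z = exp ζ`. -/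
def symb (ρ γ lam : ℝ) (ζ : ℂ) : ℂ :=
  Complex.exp ζ + lam + lam * γ * Complex.exp (ρ * ζ)

lemma symb_re (ζ : ℂ) : (symb ρ γ lam ζ).re =
    Real.exp ζ.re * Real.cos ζ.im + lam + lam * γ * (Real.exp (ρ * ζ.re) * Real.cos (ρ * ζ.im)) := by
  simp [symb, Complex.exp_re, Complex.exp_im, Complex.mul_re, Complex.mul_im]

lemma symb_im (ζ : ℂ) : (symb ρ γ lam ζ).im =
    Real.exp ζ.re * Real.sin ζ.im + lam * γ * (Real.exp (ρ * ζ.re) * Real.sin (ρ * ζ.im)) := by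
  simp [symb, Complex.exp_re, Complex.exp_im, Complex.mul_re, Complex.mul_im]

/-- On the real axis all three terms are positive. For 0 < Im ζ ≤ π the imaginary part is positive,
because 0 < ρ Im ζ < π. -/
lemma symb_ne_zero (hρ : ρ ∈ Ioo (0 : ℝ) 1) (hγ : 0 < γ) (hlam : 0 < lam) {ζ : ℂ}
    (h0 : 0 ≤ ζ.im) (h1 : ζ.im ≤ Real.pi) : symb ρ γ lam ζ ≠ 0 := by
  intro h
  rcases h0.eq_or_lt with h0 | h0
  · have := congrArg Complex.re h
    rw [symb_re, ← h0] at this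
    simp only [mul_zero, Real.cos_zero, mul_one, Complex.zero_re] at this
    have : 0 < Real.exp ζ.re + lam + lam * γ * Real.exp (ρ * ζ.re) := by positivity
    linarith
  · have := congrArg Complex.im h
    rw [symb_im] at this
    simp only [Complex.zero_im] at this
    have hs : 0 ≤ Real.sin ζ.im := Real.sin_nonneg_of_nonneg_of_le_pi h0.le h1
    have hs' : 0 < Real.sin (ρ * ζ.im) := by
      apply Real.sin_pos_of_pos_of_lt_pi (mul_pos hρ.1 h0)
      nlinarith [hρ.2]
    have : 0 < Real.exp ζ.re * Real.sin ζ.im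
      + lam * γ * (Real.exp (ρ * ζ.re) * Real.sin (ρ * ζ.im)) := by positivity
    linarith

lemma differentiable_symb : Differentiable ℂ (symb ρ γ lam) := by
  unfold symb; fun_prop

/-- Limits along `comap Complex.re` are uniform in the imaginary part, which is what the integrals
over vertical edges require. -/
lemma tendsto_exp_mul_comap_re_atTop {a : ℝ} (ha : a < 0) :
    Tendsto (fun ζ : ℂ => Complex.exp (a * ζ)) (comap Complex.re atTop) (𝓝 0) := by
  rw [tendsto_zero_iff_norm_tendsto_zero]
  simp only [Complex.norm_exp, Complex.re_ofReal_mul]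
  exact Real.tendsto_exp_atBot.comp (tendsto_comap.const_mul_atTop_of_neg ha)

lemma tendsto_exp_mul_comap_re_atBot {a : ℝ} (ha : 0 < a) :
    Tendsto (fun ζ : ℂ => Complex.exp (a * ζ)) (comap Complex.re atBot) (𝓝 0) := by
  rw [tendsto_zero_iff_norm_tendsto_zero]
  simp only [Complex.norm_exp, Complex.re_ofReal_mul]
  exact Real.tendsto_exp_atBot.comp (tendsto_comap.const_mul_atBot ha)

lemma tendsto_symb_inv_atTop (hρ : ρ ∈ Ioo (0 : ℝ) 1) :
    Tendsto (fun ζ => (symb ρ γ lam ζ)⁻¹) (comap Complex.re atTop) (𝓝 0) := by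
  have h1 := tendsto_exp_mul_comap_re_atTop (a := -1) (by norm_num)
  have h2 := tendsto_exp_mul_comap_re_atTop (a := ρ - 1) (by linarith [hρ.2])
  have h : Tendsto (fun ζ : ℂ => Complex.exp ((-1 : ℝ) * ζ) *
      (1 + lam * Complex.exp ((-1 : ℝ) * ζ) + lam * γ * Complex.exp ((ρ - 1 : ℝ) * ζ))⁻¹)
      (comap Complex.re atTop) (𝓝 (0 * (1 + (lam : ℂ) * 0 + (lam : ℂ) * γ * 0)⁻¹)) :=
    h1.mul ((((h1.const_mul (lam : ℂ)).const_add 1).add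
      (h2.const_mul ((lam : ℂ) * γ))).inv₀ (by simp))
  rw [zero_mul] at h
  refine h.congr fun ζ => ?_
  have : symb ρ γ lam ζ = Complex.exp ζ *
      (1 + lam * Complex.exp ((-1 : ℝ) * ζ) + lam * γ * Complex.exp ((ρ - 1 : ℝ) * ζ)) := by
    have e1 : Complex.exp ζ * Complex.exp ((-1 : ℝ) * ζ) = 1 := by
      rw [← Complex.exp_add]; simp
    have e2 : Complex.exp ζ * Complex.exp ((ρ - 1 : ℝ) * ζ) = Complex.exp (ρ * ζ) := by
      rw [← Complex.exp_add]; congr 1; push_cast; ring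
    rw [symb]
    linear_combination (-(lam : ℂ)) * e1 - (lam : ℂ) * γ * e2
  rw [this, mul_inv, ← Complex.exp_neg]
  congr 2
  push_cast; ring

lemma tendsto_symb_inv_atBot (hρ : ρ ∈ Ioo (0 : ℝ) 1) (hlam : 0 < lam) :
    Tendsto (fun ζ => (symb ρ γ lam ζ)⁻¹) (comap Complex.re atBot) (𝓝 (lam : ℂ)⁻¹) := by
  have h1 := tendsto_exp_mul_comap_re_atBot (a := 1) one_pos
  have h2 := tendsto_exp_mul_comap_re_atBot hρ.1
  have := ((h1.add_const (lam : ℂ)).add (h2.const_mul ((lam : ℂ) * γ))).inv₀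
    (by simp [hlam.ne'])
  simpa [symb] using this

/-- The integrand of the contour integral: `z (F z - F s) / (z - s)` at `z = exp ζ`, where
`F = 1 / (z + λ + λ γ z ^ ρ)` and `s = exp σ`. -/
def contourFun (ρ γ lam σ : ℝ) (ζ : ℂ) : ℂ :=
  Complex.exp ζ * dslope (fun z => (symb ρ γ lam z)⁻¹) (σ : ℂ) ζ / dslope Complex.exp (σ : ℂ) ζ

lemma contourFun_of_ne {σ : ℝ} {ζ : ℂ} (h : ζ ≠ σ) :
    contourFun ρ γ lam σ ζ = Complex.exp ζ * ((symb ρ γ lam ζ)⁻¹ - (symb ρ γ lam σ)⁻¹) /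
      (Complex.exp ζ - Complex.exp σ) := by
  rw [contourFun, dslope_of_ne _ h, dslope_of_ne _ h, slope_def_field, slope_def_field]
  have : ζ - σ ≠ 0 := sub_ne_zero.2 h
  field_simp

/-- Preimages of exp σ differ by multiples of 2πi, and a strip of height π above the real axis
contains only σ itself. -/
lemma dslope_exp_ne_zero {σ : ℝ} {ζ : ℂ} (h0 : 0 ≤ ζ.im) (h1 : ζ.im ≤ Real.pi) :
    dslope Complex.exp (σ : ℂ) ζ ≠ 0 := by
  by_cases h : ζ = σ
  · rw [h, dslope_same]; simp [Complex.exp_ne_zero]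
  · rw [dslope_of_ne _ h, slope_def_field]
    refine div_ne_zero (fun h' => h ?_) (sub_ne_zero.2 h)
    obtain ⟨n, hn⟩ := Complex.exp_eq_exp_iff_exists_int.1 (sub_eq_zero.1 h')
    have him := congrArg Complex.im hn
    simp at him
    have hn0 : n = 0 := by
      by_contra hne
      rcases lt_or_gt_of_ne hne with hlt | hgt
      · have : (n : ℝ) ≤ -1 := by exact_mod_cast Int.le_sub_one_of_lt hlt
        nlinarith [Real.pi_pos]
      · have : (1 : ℝ) ≤ n := by exact_mod_cast hgt
        nlinarith [Real.pi_pos]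
    simpa [hn0] using hn

/-- Subtracting F(s) cancels the simple zero of z - s at ζ = σ. In terms of `dslope` the quotient is
holomorphic through σ, so the contour needs no indentation and leaves no residue. -/
lemma differentiableOn_contourFun (hρ : ρ ∈ Ioo (0 : ℝ) 1) (hγ : 0 < γ) (hlam : 0 < lam) (σ : ℝ) :
    DifferentiableOn ℂ (contourFun ρ γ lam σ) {ζ | 0 ≤ ζ.im ∧ ζ.im ≤ Real.pi} := by
  have hopen : IsOpen {ζ | symb ρ γ lam ζ ≠ 0} :=
    isOpen_ne_fun differentiable_symb.continuous continuous_const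
  have hσ : symb ρ γ lam σ ≠ 0 := symb_ne_zero hρ hγ hlam (by simp) (by simp [Real.pi_pos.le])
  have h1 : DifferentiableOn ℂ (dslope (fun z => (symb ρ γ lam z)⁻¹) (σ : ℂ))
      {ζ | symb ρ γ lam ζ ≠ 0} :=
    (Complex.differentiableOn_dslope (hopen.mem_nhds hσ)).2 fun z hz =>
      ((differentiable_symb z).inv hz).differentiableWithinAt
  have h2 : DifferentiableOn ℂ (dslope Complex.exp (σ : ℂ)) univ :=
    (Complex.differentiableOn_dslope univ_mem).2 Complex.differentiable_exp.differentiableOn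
  exact (Complex.differentiable_exp.differentiableOn.mul
    (h1.mono fun ζ hζ => symb_ne_zero hρ hγ hlam hζ.1 hζ.2)).div (h2.mono (subset_univ _))
    fun ζ hζ => dslope_exp_ne_zero hζ.1 hζ.2

/-- F vanishes at infinity and z/(z - s) tends to 1, so only -F(s) survives. The right-hand edge is
what produces the value of the Stieltjes transform. -/
lemma tendsto_contourFun_atTop (hρ : ρ ∈ Ioo (0 : ℝ) 1) (σ : ℝ) :
    Tendsto (contourFun ρ γ lam σ) (comap Complex.re atTop) (𝓝 (-(symb ρ γ lam σ)⁻¹)) := by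
  have h1 := tendsto_exp_mul_comap_re_atTop (a := -1) (by norm_num)
  have h : Tendsto (fun ζ : ℂ => ((symb ρ γ lam ζ)⁻¹ - (symb ρ γ lam σ)⁻¹) *
      (1 - Complex.exp σ * Complex.exp ((-1 : ℝ) * ζ))⁻¹) (comap Complex.re atTop)
      (𝓝 ((0 - (symb ρ γ lam σ)⁻¹) * (1 - Complex.exp σ * 0)⁻¹)) :=
    ((tendsto_symb_inv_atTop hρ).sub_const _).mul
      (((h1.const_mul _).const_sub _).inv₀ (by simp))
  simp only [zero_sub, mul_zero, sub_zero, inv_one, mul_one] at h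
  refine h.congr' ?_
  filter_upwards [tendsto_comap.eventually (eventually_gt_atTop σ)] with ζ hζ
  have hne : ζ ≠ σ := fun h => by simp [h] at hζ
  rw [contourFun_of_ne hne]
  have e1 : Complex.exp ζ - Complex.exp σ =
      Complex.exp ζ * (1 - Complex.exp σ * Complex.exp ((-1 : ℝ) * ζ)) := by
    have e1 : Complex.exp ζ * Complex.exp ((-1 : ℝ) * ζ) = 1 := by
      rw [← Complex.exp_add]; simp
    linear_combination Complex.exp σ * e1
  rw [e1, mul_div_mul_left _ _ (Complex.exp_ne_zero _), div_eq_mul_inv]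

lemma tendsto_contourFun_atBot (hρ : ρ ∈ Ioo (0 : ℝ) 1) (hlam : 0 < lam) (σ : ℝ) :
    Tendsto (contourFun ρ γ lam σ) (comap Complex.re atBot) (𝓝 0) := by
  have h1 := tendsto_exp_mul_comap_re_atBot (a := 1) one_pos
  have h := (h1.mul ((tendsto_symb_inv_atBot (γ := γ) hρ hlam).sub_const
    (symb ρ γ lam σ)⁻¹)).div (h1.sub_const (Complex.exp σ)) (by simp [Complex.exp_ne_zero])
  simp only [Complex.ofReal_one, one_mul, zero_mul, zero_div] at h
  refine h.congr' ?_
  filter_upwards [tendsto_comap.eventually (eventually_lt_atBot σ)] with ζ hζ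
  have hne : ζ ≠ σ := fun h => by simp [h] at hζ
  rw [contourFun_of_ne hne]
  rfl

lemma tendsto_integral_vertical {Φ : ℂ → ℂ} {c : ℂ} {l : Filter ℝ} {x : ℝ → ℝ} {b : ℝ}
    {l' : Filter ℝ}
    (hb : 0 ≤ b) (hΦ : ContinuousOn Φ {ζ | 0 ≤ ζ.im ∧ ζ.im ≤ b})
    (h : Tendsto Φ (comap Complex.re l) (𝓝 c)) (hx : Tendsto x l' l) [l'.IsCountablyGenerated] :
    Tendsto (fun R : ℝ => ∫ y in (0 : ℝ)..b, Φ (x R + y * Complex.I)) l' (𝓝 (b * c)) := by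
  have hc : (b : ℂ) * c = ∫ _ in (0 : ℝ)..b, c := by simp
  rw [hc]
  have hev : ∀ᶠ ζ in comap Complex.re l, ‖Φ ζ‖ ≤ ‖c‖ + 1 :=
    h.norm.eventually (eventually_le_nhds (by linarith))
  refine intervalIntegral.tendsto_integral_filter_of_dominated_convergence (fun _ => ‖c‖ + 1)
    (Eventually.of_forall fun R => ?_) ?_ (by simp) (Eventually.of_forall fun y _ => ?_)
  · rw [uIoc_of_le hb]
    refine (ContinuousOn.mono ?_ Ioc_subset_Icc_self).aestronglyMeasurable measurableSet_Ioc
    refine hΦ.comp (Continuous.continuousOn (by fun_prop)) fun y hy => ?_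
    simpa using hy
  · have := hx.eventually (eventually_comap.1 hev)
    filter_upwards [this] with R hR
    exact Eventually.of_forall fun y _ => hR _ (by simp)
  · exact h.comp (tendsto_comap_iff.2 (by simpa [Function.comp_def] using hx))

end Contour

/-! ### Stieltjes representation of F by the spectral density. -/

section Stieltjes

variable {ρ γ lam : ℝ}

/-- The spectral density of `B_ρ(λ, ·)`. -/
def dens (ρ γ lam r : ℝ) : ℝ :=
  γ / Real.pi * (lam * r ^ ρ * Real.sin (ρ * Real.pi) /
      ((-r + lam * γ * r ^ ρ * Real.cos (ρ * Real.pi) + lam) ^ 2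
        + (lam * γ * r ^ ρ * Real.sin (ρ * Real.pi)) ^ 2))

lemma sin_rho_pi_pos (hρ : ρ ∈ Ioo (0 : ℝ) 1) : 0 < Real.sin (ρ * Real.pi) :=
  Real.sin_pos_of_pos_of_lt_pi (mul_pos hρ.1 Real.pi_pos) (by nlinarith [hρ.2, Real.pi_pos])

lemma dens_pos (hρ : ρ ∈ Ioo (0 : ℝ) 1) (hγ : 0 < γ) (hlam : 0 < lam) {r : ℝ} (hr : 0 < r) :
    0 < dens ρ γ lam r := by
  have := sin_rho_pi_pos hρ
  have h2 : 0 < r ^ ρ := Real.rpow_pos_of_pos hr _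
  unfold dens
  have := Real.pi_pos
  positivity

lemma measurable_dens : Measurable (dens ρ γ lam) := by
  unfold dens; fun_prop

lemma continuousOn_dens (hρ : ρ ∈ Ioo (0 : ℝ) 1) (hγ : 0 < γ) (hlam : 0 < lam) :
    ContinuousOn (dens ρ γ lam) (Ioi 0) := by
  have h : ContinuousOn (fun r : ℝ => r ^ ρ) (Ioi 0) :=
    continuousOn_id.rpow_const fun r hr => Or.inl (ne_of_gt hr)
  unfold dens
  refine ContinuousOn.mul continuousOn_const (ContinuousOn.div (by fun_prop) (by fun_prop) ?_)
  intro r hr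
  have := sin_rho_pi_pos hρ
  have h2 : 0 < r ^ ρ := Real.rpow_pos_of_pos hr _
  positivity

/-- The line Im ζ = π is the upper edge of the cut: there z = -r and z^ρ = r^ρ exp(iρπ) with r = exp
x. -/
lemma symb_inv_im_pi (x : ℝ) :
    ((symb ρ γ lam (x + Real.pi * Complex.I))⁻¹).im = -Real.pi * dens ρ γ lam (Real.exp x) := by
  have hp := Real.pi_pos.ne'
  have hre : ((x : ℂ) + Real.pi * Complex.I).re = x := by simp
  have him : ((x : ℂ) + Real.pi * Complex.I).im = Real.pi := by simp
  have hmul : ∀ X : ℝ, -Real.pi * (γ / Real.pi * X) = -(γ * X) := fun X => by field_simp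
  rw [Complex.inv_im, Complex.normSq_apply, symb_re, symb_im, hre, him, dens, hmul,
    ← Real.exp_mul, mul_comm x ρ, Real.cos_pi, Real.sin_pi, mul_div_assoc', ← neg_div]
  congr 1 <;> ring

lemma contourFun_pi (σ x : ℝ) :
    (contourFun ρ γ lam σ (x + Real.pi * Complex.I)).im =
      -Real.pi * (Real.exp x * (dens ρ γ lam (Real.exp x) / (Real.exp x + Real.exp σ))) := by
  have hne : (x : ℂ) + Real.pi * Complex.I ≠ σ := fun h => by
    have := congrArg Complex.im h
    simp [Real.pi_ne_zero] at this
  have hσ : ((symb ρ γ lam σ)⁻¹).im = 0 := by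
    rw [Complex.inv_im, symb_im]; simp
  have he : Complex.exp ((x : ℂ) + Real.pi * Complex.I) = -((Real.exp x : ℝ) : ℂ) := by
    rw [Complex.exp_add, Complex.exp_pi_mul_I]; simp
  rw [contourFun_of_ne hne, he]
  have : -((Real.exp x : ℝ) : ℂ) * ((symb ρ γ lam (x + Real.pi * Complex.I))⁻¹ -
      (symb ρ γ lam σ)⁻¹) / (-((Real.exp x : ℝ) : ℂ) - Complex.exp σ)
      = ((Real.exp x / (Real.exp x + Real.exp σ) : ℝ) : ℂ) *
      ((symb ρ γ lam (x + Real.pi * Complex.I))⁻¹ - (symb ρ γ lam σ)⁻¹) := by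
    rw [← Complex.ofReal_exp σ, mul_comm (-((Real.exp x : ℝ) : ℂ)), mul_div_assoc, mul_comm]
    congr 1
    push_cast
    rw [← neg_add', neg_div_neg_eq]
  rw [this, Complex.im_ofReal_mul, Complex.sub_im, hσ, symb_inv_im_pi]
  ring

lemma contourFun_real (σ x : ℝ) (hx : x ≠ σ) : (contourFun ρ γ lam σ x).im = 0 := by
  have hs : ∀ y : ℝ, symb ρ γ lam y =
      ((Real.exp y + lam + lam * γ * Real.exp (ρ * y) : ℝ) : ℂ) := by
    intro y; simp [symb]
  rw [contourFun_of_ne (by exact_mod_cast hx), hs, hs]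
  norm_cast

lemma integral_contour (hρ : ρ ∈ Ioo (0 : ℝ) 1) (hγ : 0 < γ) (hlam : 0 < lam) (σ R : ℝ) :
    Real.pi * ∫ x in -R..R, Real.exp x * (dens ρ γ lam (Real.exp x) / (Real.exp x + Real.exp σ)) =
      (∫ y in (0 : ℝ)..Real.pi, contourFun ρ γ lam σ ((-R : ℝ) + y * Complex.I)).re -
      (∫ y in (0 : ℝ)..Real.pi, contourFun ρ γ lam σ (R + y * Complex.I)).re := by
  have hd := differentiableOn_contourFun hρ hγ hlam σ
  have hrect : (uIcc (-R) R ×ℂ uIcc 0 Real.pi) ⊆ {ζ : ℂ | 0 ≤ ζ.im ∧ ζ.im ≤ Real.pi} := by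
    intro ζ hζ
    have := (Complex.mem_reProdIm.1 hζ).2
    rwa [uIcc_of_le Real.pi_pos.le] at this
  have hrect' : (Ioo (min (-R) R) (max (-R) R) ×ℂ Ioo (min 0 Real.pi) (max 0 Real.pi)) ⊆
      {ζ : ℂ | 0 ≤ ζ.im ∧ ζ.im ≤ Real.pi} := by
    intro ζ hζ
    have := (Complex.mem_reProdIm.1 hζ).2
    rw [min_eq_left Real.pi_pos.le, max_eq_right Real.pi_pos.le] at this
    exact ⟨this.1.le, this.2.le⟩
  have h := Complex.integral_boundary_rect_eq_zero_of_continuousOn_of_differentiableOn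
    (contourFun ρ γ lam σ) (-R : ℝ) (R + Real.pi * Complex.I)
    (by simpa using hd.continuousOn.mono hrect) (by simpa using hd.mono hrect')
  -- In imaginary parts the bottom edge drops out, since the integrand is real there, and the top
  -- edge carries the density. The vertical edges enter through their real parts because dζ = i dy.
  have h := congrArg Complex.im h
  simp only [Complex.ofReal_re, Complex.ofReal_im, Complex.add_re, Complex.add_im, Complex.mul_re,
    Complex.mul_im, Complex.I_re, Complex.I_im, mul_zero, mul_one, zero_mul, sub_zero, add_zero,
    zero_add, Complex.sub_im, smul_eq_mul, one_mul, Complex.zero_im, Complex.ofReal_zero] at h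
  have hcont : ∀ c : ℝ, 0 ≤ c → c ≤ Real.pi →
      IntervalIntegrable (fun x : ℝ => contourFun ρ γ lam σ (x + c * Complex.I)) volume (-R) R := by
    intro c h0 h1
    refine ContinuousOn.intervalIntegrable ?_
    refine hd.continuousOn.comp (Continuous.continuousOn (by fun_prop)) fun y hy => ?_
    simp [h0, h1]
  have e1 : (∫ x in -R..R, contourFun ρ γ lam σ x).im = 0 := by
    have hi := hcont 0 le_rfl Real.pi_pos.le
    simp only [Complex.ofReal_zero, zero_mul, add_zero] at hi
    have := Complex.imCLM.intervalIntegral_comp_comm hi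
    simp only [Complex.imCLM_apply] at this
    rw [← this]
    rw [intervalIntegral.integral_congr_ae (g := fun _ => 0), intervalIntegral.integral_zero]
    have hne : ∀ᵐ x : ℝ, x ≠ σ := by simp [ae_iff]
    filter_upwards [hne] with x hx _ using contourFun_real σ x hx
  have e2 : (∫ x in -R..R, contourFun ρ γ lam σ (x + Real.pi * Complex.I)).im =
      -Real.pi * ∫ x in -R..R, Real.exp x *
        (dens ρ γ lam (Real.exp x) / (Real.exp x + Real.exp σ)) := by
    have := Complex.imCLM.intervalIntegral_comp_comm (hcont Real.pi Real.pi_pos.le le_rfl)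
    simp only [Complex.imCLM_apply] at this
    rw [← this, ← intervalIntegral.integral_const_mul]
    exact intervalIntegral.integral_congr fun x _ => contourFun_pi σ x
  rw [e1, e2] at h
  linarith

/-- The Laplace transform of `B_ρ(λ, ·)`. -/
def resolv (ρ γ lam s : ℝ) : ℝ := (s + lam + lam * γ * s ^ ρ)⁻¹

/-- With r = exp x and s = exp σ, let R tend to infinity in `integral_contour`: the left edge tends
to 0 and the right one to -πF(s). Positivity of the integrand turns convergence of the truncated
integrals into integrability. -/
theorem stieltjes (hρ : ρ ∈ Ioo (0 : ℝ) 1) (hγ : 0 < γ) (hlam : 0 < lam) {s : ℝ} (hs : 0 < s) :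
    IntegrableOn (fun r => dens ρ γ lam r / (r + s)) (Ioi 0) ∧
      ∫ r in Ioi (0 : ℝ), dens ρ γ lam r / (r + s) = resolv ρ γ lam s := by
  obtain ⟨σ, rfl⟩ : ∃ σ, Real.exp σ = s := ⟨Real.log s, Real.exp_log hs⟩
  set g : ℝ → ℝ := fun x => Real.exp x * (dens ρ γ lam (Real.exp x) / (Real.exp x + Real.exp σ))
    with hg
  have hcont := (differentiableOn_contourFun hρ hγ hlam σ).continuousOn
  have hlim : Tendsto (fun R : ℝ => ∫ x in -R..R, g x) atTop (𝓝 (resolv ρ γ lam (Real.exp σ))) := by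
    have hr := tendsto_integral_vertical Real.pi_pos.le hcont
      (tendsto_contourFun_atTop hρ σ) (tendsto_id (α := ℝ))
    have hl := tendsto_integral_vertical Real.pi_pos.le hcont
      (tendsto_contourFun_atBot hρ hlam σ) (tendsto_neg_atTop_atBot (G := ℝ))
    have := (((Complex.continuous_re.tendsto _).comp hl).sub
      ((Complex.continuous_re.tendsto _).comp hr)).const_mul Real.pi⁻¹
    have hval : Real.pi⁻¹ * (((Real.pi : ℂ) * 0).re - ((Real.pi : ℂ) * -(symb ρ γ lam σ)⁻¹).re) =
        resolv ρ γ lam (Real.exp σ) := by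
      have : symb ρ γ lam σ =
          ((Real.exp σ + lam + lam * γ * Real.exp σ ^ ρ : ℝ) : ℂ) := by
        rw [← Real.exp_mul, mul_comm σ]; simp [symb]
      rw [this, resolv, ← Complex.ofReal_inv, ← Complex.ofReal_neg, ← Complex.ofReal_mul,
        Complex.ofReal_re]
      simp [Real.pi_ne_zero]
    rw [hval] at this
    refine this.congr fun R => ?_
    simp only [Function.comp_apply, id]
    rw [← integral_contour hρ hγ hlam σ R, ← mul_assoc, inv_mul_cancel₀ Real.pi_ne_zero, one_mul]
  have hgpos : ∀ x, 0 ≤ g x := fun x => by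
    have := dens_pos hρ hγ hlam (Real.exp_pos x)
    simp only [hg]; positivity
  have hgc : Continuous g := by
    have : Continuous fun x => dens ρ γ lam (Real.exp x) :=
      (continuousOn_dens hρ hγ hlam).comp_continuous Real.continuous_exp fun x => Real.exp_pos x
    simp only [hg]
    exact Real.continuous_exp.mul (this.div (by fun_prop) fun x => by positivity)
  have hgi : Integrable g := by
    refine integrable_of_intervalIntegral_norm_tendsto (l := atTop) (a := fun R : ℝ => -R)
      (b := id) (resolv ρ γ lam (Real.exp σ)) (fun R => ?_) tendsto_neg_atTop_atBot tendsto_id ?_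
    · exact (hgc.integrableOn_Icc).mono_set Ioc_subset_Icc_self
    · simpa [abs_of_nonneg (hgpos _)] using hlim
  have hint := tendsto_nhds_unique
    (intervalIntegral_tendsto_integral hgi tendsto_neg_atTop_atBot tendsto_id) hlim
  have himg : Real.exp '' univ = Ioi 0 := by rw [image_univ, Real.range_exp]
  have hder : ∀ x ∈ (univ : Set ℝ), HasDerivWithinAt Real.exp (Real.exp x) univ x :=
    fun x _ => (Real.hasDerivAt_exp x).hasDerivWithinAt
  constructor
  · rw [← himg, integrableOn_image_iff_integrableOn_abs_deriv_smul MeasurableSet.univ hder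
      Real.exp_injective.injOn]
    simpa [hg] using hgi
  · rw [← himg, integral_image_eq_integral_abs_deriv_smul MeasurableSet.univ hder
      Real.exp_injective.injOn, ← hint]
    simp [hg]

end Stieltjes

/-! ### Total masses of the densities of B and A, from the behaviour of F at infinity and at 0. -/

section MonotoneLimit

variable {ρ γ lam : ℝ}

/-- Monotone convergence in which the finite limit of the integrals supplies integrability of the
limit function. -/
lemma integrable_and_integral_of_monotone_limit {α : Type*} [MeasurableSpace α] {μ : Measure α}
    {h : ℕ → α → ℝ} {g : α → ℝ} {c : ℝ} (hint : ∀ n, Integrable (h n) μ)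
    (hpos : ∀ n, 0 ≤ᵐ[μ] h n) (hmono : ∀ᵐ x ∂μ, Monotone fun n => h n x)
    (hlim : ∀ᵐ x ∂μ, Tendsto (fun n => h n x) atTop (𝓝 (g x)))
    (hc : Tendsto (fun n => ∫ x, h n x ∂μ) atTop (𝓝 c)) :
    Integrable g μ ∧ ∫ x, g x ∂μ = c := by
  have hg : Integrable g μ := by
    have hmeas : AEStronglyMeasurable g μ :=
      aestronglyMeasurable_of_tendsto_ae atTop (fun n => (hint n).1) hlim
    have hg0 : 0 ≤ᵐ[μ] g := by
      filter_upwards [ae_all_iff.2 hpos, hlim] with x h1 h2 using ge_of_tendsto' h2 h1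
    have h1 := lintegral_tendsto_of_tendsto_of_monotone
      (fun n => (hint n).1.aemeasurable.ennreal_ofReal)
      (hmono.mono fun x hx n m hnm => ENNReal.ofReal_le_ofReal (hx hnm))
      (hlim.mono fun x hx => (ENNReal.continuous_ofReal.tendsto _).comp hx)
    have h2 : Tendsto (fun n => ∫⁻ x, ENNReal.ofReal (h n x) ∂μ) atTop (𝓝 (ENNReal.ofReal c)) :=
      ((ENNReal.continuous_ofReal.tendsto _).comp hc).congr fun n =>
        ofReal_integral_eq_lintegral_ofReal (hint n) (hpos n)
    refine ⟨hmeas, ?_⟩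
    rw [hasFiniteIntegral_iff_ofReal hg0, tendsto_nhds_unique h1 h2]
    exact ENNReal.ofReal_lt_top
  exact ⟨hg, tendsto_nhds_unique (integral_tendsto_of_tendsto_of_monotone hint hg hmono hlim) hc⟩

lemma tendsto_mul_resolv_atTop (hρ : ρ ∈ Ioo (0 : ℝ) 1) :
    Tendsto (fun s => s * resolv ρ γ lam s) atTop (𝓝 1) := by
  have h1 : Tendsto (fun s : ℝ => s ^ (ρ - 1)) atTop (𝓝 0) := by
    simpa using tendsto_rpow_neg_atTop (y := 1 - ρ) (by linarith [hρ.2])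
  have h := (((tendsto_inv_atTop_zero (𝕜 := ℝ)).const_mul lam).const_add 1 |>.add
    (h1.const_mul (lam * γ))).inv₀ (by simp)
  simp only [mul_zero, add_zero, inv_one] at h
  refine h.congr' ?_
  filter_upwards [eventually_gt_atTop 0] with s hs
  rw [Real.rpow_sub_one hs.ne', resolv]
  have : s + lam + lam * γ * s ^ ρ = s * (1 + lam * s⁻¹ + lam * γ * (s ^ ρ / s)) := by
    field_simp
  rw [this, mul_inv, ← mul_assoc, mul_inv_cancel₀ hs.ne', one_mul]

lemma tendsto_resolv_zero (hρ : ρ ∈ Ioo (0 : ℝ) 1) (hlam : 0 < lam) :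
    Tendsto (fun s => resolv ρ γ lam s) (𝓝 0) (𝓝 lam⁻¹) := by
  have h1 : Tendsto (fun s : ℝ => s ^ ρ) (𝓝 0) (𝓝 0) := by
    have := (Real.continuous_rpow_const hρ.1.le).tendsto 0
    rwa [Real.zero_rpow hρ.1.ne'] at this
  have h := ((tendsto_id.add_const lam).add (h1.const_mul (lam * γ))).inv₀ (by simp [hlam.ne'])
  simpa [resolv] using h

/-- The density of `B_ρ(λ, ·)` is integrable with integral `B_ρ(λ, 0) = 1`. -/
theorem integral_dens (hρ : ρ ∈ Ioo (0 : ℝ) 1) (hγ : 0 < γ) (hlam : 0 < lam) :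
    IntegrableOn (dens ρ γ lam) (Ioi 0) ∧ ∫ r in Ioi (0 : ℝ), dens ρ γ lam r = 1 := by
  have hnat : Tendsto (fun n : ℕ => (n : ℝ) + 1) atTop atTop :=
    tendsto_atTop_add_const_right _ _ tendsto_natCast_atTop_atTop
  -- As s → ∞ the factor s/(r + s) increases to 1, while sF(s) → 1.
  refine integrable_and_integral_of_monotone_limit
    (h := fun n r => ((n : ℝ) + 1) * (dens ρ γ lam r / (r + ((n : ℝ) + 1))))
    (fun n => ((stieltjes hρ hγ hlam (by positivity)).1).const_mul _) (fun n => ?_) ?_ ?_ ?_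
  · filter_upwards [ae_restrict_mem measurableSet_Ioi] with r hr
    have := dens_pos hρ hγ hlam hr
    have hr' : 0 < r := hr
    simp only [Pi.zero_apply]; positivity
  · filter_upwards [ae_restrict_mem measurableSet_Ioi] with r hr
    have := dens_pos hρ hγ hlam hr
    have hr' : 0 < r := hr
    refine monotone_nat_of_le_succ fun n => ?_
    push_cast
    rw [mul_div_assoc', mul_div_assoc', div_le_div_iff₀ (by positivity) (by positivity)]
    nlinarith [mul_pos this hr']
  · filter_upwards [ae_restrict_mem measurableSet_Ioi] with r hr
    have hr' : 0 < r := hr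
    have h := (((tendsto_inv_atTop_zero.comp hnat).const_mul r).const_add 1).inv₀ (by simp)
    have h := h.const_mul (dens ρ γ lam r)
    simp only [mul_zero, add_zero, inv_one, mul_one] at h
    refine h.congr fun n => ?_
    simp only [Function.comp_apply]
    have : (n : ℝ) + 1 ≠ 0 := by positivity
    have : r + ((n : ℝ) + 1) ≠ 0 := by positivity
    have : 1 + r * ((n : ℝ) + 1)⁻¹ ≠ 0 := by positivity
    field_simp
    ring
  · refine ((tendsto_mul_resolv_atTop (γ := γ) (lam := lam) hρ).comp hnat).congr fun n => ?_
    rw [Function.comp_apply, integral_const_mul, (stieltjes hρ hγ hlam (by positivity)).2]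

/-- The density of `A_ρ(λ, ·)` is integrable with integral `A_ρ(λ, 0) = 1`. -/
theorem integral_dens_div (hρ : ρ ∈ Ioo (0 : ℝ) 1) (hγ : 0 < γ) (hlam : 0 < lam) :
    IntegrableOn (fun r => dens ρ γ lam r / r) (Ioi 0) ∧
      ∫ r in Ioi (0 : ℝ), dens ρ γ lam r / r = lam⁻¹ := by
  have hnat := tendsto_one_div_add_atTop_nhds_zero_nat (𝕜 := ℝ)
  -- As s decreases to 0 the factor 1/(r + s) increases to 1/r, while F(s) → 1/λ.
  refine integrable_and_integral_of_monotone_limit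
    (h := fun n r => dens ρ γ lam r / (r + 1 / ((n : ℝ) + 1)))
    (fun n => (stieltjes hρ hγ hlam (by positivity)).1) (fun n => ?_) ?_ ?_ ?_
  · filter_upwards [ae_restrict_mem measurableSet_Ioi] with r hr
    have := dens_pos hρ hγ hlam hr
    have hr' : 0 < r := hr
    simp only [Pi.zero_apply]; positivity
  · filter_upwards [ae_restrict_mem measurableSet_Ioi] with r hr
    have := (dens_pos hρ hγ hlam hr).le
    have hr' : 0 < r := hr
    intro n m hnm
    have : (n : ℝ) ≤ m := by exact_mod_cast hnm
    dsimp only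
    gcongr
  · filter_upwards [ae_restrict_mem measurableSet_Ioi] with r hr
    have hr' : 0 < r := hr
    have h := (tendsto_const_nhds (x := dens ρ γ lam r)).div (hnat.const_add r) (by simp [hr'.ne'])
    rw [add_zero] at h
    exact h
  · refine ((tendsto_resolv_zero (γ := γ) hρ hlam).comp hnat).congr fun n => ?_
    rw [Function.comp_apply, (stieltjes hρ hγ hlam (by positivity)).2]

end MonotoneLimit

/-! ### Laplace transform of B and the relation between A and B. -/

section Basic

variable {ρ γ lam : ℝ}

lemma Bfun_eq (t : ℝ) :
    Bfun ρ γ lam t = ∫ r in Ioi (0 : ℝ), Real.exp (-r * t) * dens ρ γ lam r := by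
  rw [Bfun, ← integral_const_mul]
  refine integral_congr_ae (Eventually.of_forall fun r => ?_)
  simp only [dens]; ring

lemma Afun_eq (t : ℝ) :
    Afun ρ γ lam t = ∫ r in Ioi (0 : ℝ), Real.exp (-r * t) * (lam * (dens ρ γ lam r / r)) := by
  rw [Afun, ← integral_const_mul]
  refine setIntegral_congr_fun measurableSet_Ioi fun r hr => ?_
  simp only [dens]
  rw [Real.rpow_sub_one (ne_of_gt hr)]
  ring

lemma integrable_exp_mul_dens (hρ : ρ ∈ Ioo (0 : ℝ) 1) (hγ : 0 < γ) (hlam : 0 < lam) {w : ℝ → ℝ}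
    {S : Set ℝ} (hS : MeasurableSet S) (hS0 : S ⊆ Ici 0) (hw : IntegrableOn w S) :
    Integrable (Function.uncurry fun t r => w t * (Real.exp (-r * t) * dens ρ γ lam r))
      ((volume.restrict S).prod (volume.restrict (Ioi 0))) := by
  have h1 := hw.mul_prod (integral_dens hρ hγ hlam).1
  have hm : AEStronglyMeasurable (fun p : ℝ × ℝ => Real.exp (-p.2 * p.1))
      ((volume.restrict S).prod (volume.restrict (Ioi 0))) :=
    (Continuous.aestronglyMeasurable (by fun_prop))
  refine (h1.bdd_mul (c := 1) hm ?_).congr (Eventually.of_forall fun p => ?_)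
  · rw [Measure.prod_restrict]
    filter_upwards [ae_restrict_mem (hS.prod measurableSet_Ioi)] with p hp
    rw [Real.norm_of_nonneg (Real.exp_pos _).le, Real.exp_le_one_iff]
    have h1 : (0 : ℝ) ≤ p.1 := hS0 hp.1
    have h2 : (0 : ℝ) < p.2 := hp.2
    nlinarith
  · simp only [Function.uncurry]; ring

/-- Fubini with a general weight, to serve both for the Laplace transform, w(t) = exp(-st), and for
the primitive of B, w = 1 on (0,t]. -/
lemma integral_mul_Bfun (hρ : ρ ∈ Ioo (0 : ℝ) 1) (hγ : 0 < γ) (hlam : 0 < lam) {w : ℝ → ℝ}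
    {S : Set ℝ} (hS : MeasurableSet S) (hS0 : S ⊆ Ici 0) (hw : IntegrableOn w S) :
    IntegrableOn (fun t => w t * Bfun ρ γ lam t) S ∧
    ∫ t in S, w t * Bfun ρ γ lam t =
      ∫ r in Ioi (0 : ℝ), (∫ t in S, w t * Real.exp (-r * t)) * dens ρ γ lam r := by
  have h := integrable_exp_mul_dens hρ hγ hlam hS hS0 hw
  have e : ∀ t, w t * Bfun ρ γ lam t =
      ∫ r in Ioi (0 : ℝ), w t * (Real.exp (-r * t) * dens ρ γ lam r) := fun t => by
    rw [Bfun_eq, integral_const_mul]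
  simp only [e]
  refine ⟨h.integral_prod_left, ?_⟩
  rw [integral_integral_swap h]
  refine integral_congr_ae (Eventually.of_forall fun r => ?_)
  simp only
  rw [← integral_mul_const]
  simp only [mul_assoc]

lemma integral_exp_neg_Ioi {a : ℝ} (ha : 0 < a) :
    IntegrableOn (fun t => Real.exp (-a * t)) (Ioi 0) ∧
      ∫ t in Ioi (0 : ℝ), Real.exp (-a * t) = a⁻¹ := by
  refine ⟨integrableOn_exp_mul_Ioi (by linarith) 0, ?_⟩
  rw [integral_exp_mul_Ioi (by linarith)]
  simp [div_eq_inv_mul]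

theorem laplace_Bfun (hρ : ρ ∈ Ioo (0 : ℝ) 1) (hγ : 0 < γ) (hlam : 0 < lam) {s : ℝ} (hs : 0 < s) :
    IntegrableOn (fun t => Real.exp (-s * t) * Bfun ρ γ lam t) (Ioi 0) ∧
      ∫ t in Ioi (0 : ℝ), Real.exp (-s * t) * Bfun ρ γ lam t = resolv ρ γ lam s := by
  have h := integral_mul_Bfun hρ hγ hlam measurableSet_Ioi Ioi_subset_Ici_self
    (integral_exp_neg_Ioi hs).1
  refine ⟨h.1, h.2.trans ?_⟩
  rw [← (stieltjes hρ hγ hlam hs).2]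
  refine setIntegral_congr_fun measurableSet_Ioi fun r hr => ?_
  have hr' : (0 : ℝ) < r := hr
  have e : ∀ t : ℝ, Real.exp (-s * t) * Real.exp (-r * t) = Real.exp (-(r + s) * t) := fun t => by
    rw [← Real.exp_add]; congr 1; ring
  simp only [e]
  rw [(integral_exp_neg_Ioi (by positivity)).2, div_eq_inv_mul]

/-- `A_ρ(λ, t) = 1 - λ ∫₀ᵗ B_ρ(λ, τ) dτ`. -/
theorem Afun_eq_one_sub (hρ : ρ ∈ Ioo (0 : ℝ) 1) (hγ : 0 < γ) (hlam : 0 < lam) {t : ℝ}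
    (ht : 0 ≤ t) : Afun ρ γ lam t = 1 - lam * ∫ τ in (0 : ℝ)..t, Bfun ρ γ lam τ := by
  have h := integral_mul_Bfun hρ hγ hlam (w := fun _ => 1) (S := Ioc 0 t) measurableSet_Ioc
    (fun x hx => hx.1.le) (by simp)
  simp only [one_mul] at h
  rw [intervalIntegral.integral_of_le ht, h.2]
  have hd := integral_dens_div hρ hγ hlam
  -- The inner integral is (1 - exp(-rt))/r. Against the density its two terms give 1/λ and
  -- A(λ,t)/λ.
  have e : ∀ r ∈ Ioi (0 : ℝ), (∫ τ in Ioc 0 t, Real.exp (-r * τ)) * dens ρ γ lam r =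
      dens ρ γ lam r / r - lam⁻¹ * (Real.exp (-r * t) * (lam * (dens ρ γ lam r / r))) := by
    intro r hr
    have hr' : (0 : ℝ) < r := hr
    rw [← intervalIntegral.integral_of_le ht,
      intervalIntegral.integral_comp_mul_left (fun x => Real.exp x) (neg_ne_zero.2 hr'.ne')]
    simp
    field_simp
    ring
  have hexp : IntegrableOn (fun r => Real.exp (-r * t) * (lam * (dens ρ γ lam r / r))) (Ioi 0) := by
    refine (hd.1.const_mul lam).bdd_mul (c := 1) (Continuous.aestronglyMeasurable (by fun_prop)) ?_
    filter_upwards [ae_restrict_mem measurableSet_Ioi] with r hr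
    rw [Real.norm_of_nonneg (Real.exp_pos _).le, Real.exp_le_one_iff]
    have h2 : (0 : ℝ) < r := hr
    nlinarith
  rw [setIntegral_congr_fun measurableSet_Ioi e, integral_sub hd.1 (hexp.const_mul _), hd.2,
    integral_const_mul, ← Afun_eq]
  field_simp
  ring

end Basic

/-! ### Monotonicity, regularity and derivative of B. -/

section Monotone

variable {ρ γ lam : ℝ}

lemma integrableOn_exp_mul_dens (hρ : ρ ∈ Ioo (0 : ℝ) 1) (hγ : 0 < γ) (hlam : 0 < lam) {t : ℝ}
    (ht : 0 ≤ t) : IntegrableOn (fun r => Real.exp (-r * t) * dens ρ γ lam r) (Ioi 0) := by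
  refine (integral_dens hρ hγ hlam).1.bdd_mul (c := 1)
    (Continuous.aestronglyMeasurable (by fun_prop)) ?_
  filter_upwards [ae_restrict_mem measurableSet_Ioi] with r hr
  rw [Real.norm_of_nonneg (Real.exp_pos _).le, Real.exp_le_one_iff]
  have h2 : (0 : ℝ) < r := hr
  nlinarith

lemma Bfun_zero (hρ : ρ ∈ Ioo (0 : ℝ) 1) (hγ : 0 < γ) (hlam : 0 < lam) : Bfun ρ γ lam 0 = 1 := by
  rw [Bfun_eq]; simpa using (integral_dens hρ hγ hlam).2

lemma Bfun_nonneg (hρ : ρ ∈ Ioo (0 : ℝ) 1) (hγ : 0 < γ) (hlam : 0 < lam) (t : ℝ) :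
    0 ≤ Bfun ρ γ lam t := by
  rw [Bfun_eq]
  exact setIntegral_nonneg measurableSet_Ioi fun r hr =>
    mul_nonneg (Real.exp_pos _).le (dens_pos hρ hγ hlam hr).le

lemma Bfun_antitoneOn (hρ : ρ ∈ Ioo (0 : ℝ) 1) (hγ : 0 < γ) (hlam : 0 < lam) :
    AntitoneOn (Bfun ρ γ lam) (Ici 0) := by
  intro s hs t ht hst
  rw [Bfun_eq, Bfun_eq]
  refine setIntegral_mono_on (integrableOn_exp_mul_dens hρ hγ hlam ht)
    (integrableOn_exp_mul_dens hρ hγ hlam hs) measurableSet_Ioi fun r hr => ?_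
  have h2 : (0 : ℝ) < r := hr
  refine mul_le_mul_of_nonneg_right (Real.exp_le_exp.2 ?_) (dens_pos hρ hγ hlam hr).le
  nlinarith

lemma Bfun_le_one (hρ : ρ ∈ Ioo (0 : ℝ) 1) (hγ : 0 < γ) (hlam : 0 < lam) {t : ℝ} (ht : 0 ≤ t) :
    Bfun ρ γ lam t ≤ 1 := by
  have := Bfun_antitoneOn hρ hγ hlam (mem_Ici.2 le_rfl) (mem_Ici.2 ht) ht
  rwa [Bfun_zero hρ hγ hlam] at this

lemma Bfun_continuousOn (hρ : ρ ∈ Ioo (0 : ℝ) 1) (hγ : 0 < γ) (hlam : 0 < lam) :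
    ContinuousOn (Bfun ρ γ lam) (Ici 0) := by
  rw [show Bfun ρ γ lam = _ from funext Bfun_eq]
  refine continuousOn_of_dominated (bound := dens ρ γ lam)
    (fun t ht => (integrableOn_exp_mul_dens hρ hγ hlam ht).1) (fun t ht => ?_)
    (integral_dens hρ hγ hlam).1 (Eventually.of_forall fun r => by fun_prop)
  filter_upwards [ae_restrict_mem measurableSet_Ioi] with r hr
  have h2 : (0 : ℝ) < r := hr
  have h3 : (0 : ℝ) ≤ t := ht
  have := dens_pos hρ hγ hlam hr
  rw [Real.norm_of_nonneg (by positivity)]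
  refine mul_le_of_le_one_left this.le (Real.exp_le_one_iff.2 ?_)
  nlinarith

/-- The measure whose Laplace transform is `B_ρ(λ, ·)`. -/
def specMeasure (ρ γ lam : ℝ) : Measure ℝ :=
  (volume.restrict (Ioi 0)).withDensity fun r => ENNReal.ofReal (dens ρ γ lam r)

lemma integral_specMeasure (hρ : ρ ∈ Ioo (0 : ℝ) 1) (hγ : 0 < γ) (hlam : 0 < lam) (g : ℝ → ℝ) :
    ∫ r, g r ∂specMeasure ρ γ lam = ∫ r in Ioi (0 : ℝ), g r * dens ρ γ lam r := by
  rw [specMeasure, integral_withDensity_eq_integral_toReal_smul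
    measurable_dens.ennreal_ofReal (Eventually.of_forall fun _ => ENNReal.ofReal_lt_top)]
  refine setIntegral_congr_fun measurableSet_Ioi fun r hr => ?_
  rw [ENNReal.toReal_ofReal (dens_pos hρ hγ hlam hr).le, smul_eq_mul, mul_comm]

lemma integrable_specMeasure (hρ : ρ ∈ Ioo (0 : ℝ) 1) (hγ : 0 < γ) (hlam : 0 < lam) (g : ℝ → ℝ) :
    Integrable g (specMeasure ρ γ lam) ↔
      IntegrableOn (fun r => g r * dens ρ γ lam r) (Ioi 0) := by
  rw [specMeasure, integrable_withDensity_iff measurable_dens.ennreal_ofReal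
    (Eventually.of_forall fun _ => ENNReal.ofReal_lt_top)]
  refine integrableOn_congr_fun (fun r hr => ?_) measurableSet_Ioi
  rw [ENNReal.toReal_ofReal (dens_pos hρ hγ hlam hr).le]

lemma Iio_subset_integrableExpSet (hρ : ρ ∈ Ioo (0 : ℝ) 1) (hγ : 0 < γ) (hlam : 0 < lam) :
    Iio 0 ⊆ interior (ProbabilityTheory.integrableExpSet id (specMeasure ρ γ lam)) := by
  refine interior_maximal (fun t ht => ?_) isOpen_Iio
  have ht' : t < 0 := ht
  rw [ProbabilityTheory.integrableExpSet, mem_ofPred_eq, integrable_specMeasure hρ hγ hlam]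
  refine (integrableOn_exp_mul_dens hρ hγ hlam (t := -t) (by linarith)).congr_fun (fun r _ => ?_)
    measurableSet_Ioi
  simp [mul_comm]

/-- As a moment generating function evaluated at -t, B inherits analyticity and differentiation
under the integral sign for t > 0. -/
lemma Bfun_eq_mgf (hρ : ρ ∈ Ioo (0 : ℝ) 1) (hγ : 0 < γ) (hlam : 0 < lam) :
    Bfun ρ γ lam = fun t => ProbabilityTheory.mgf id (specMeasure ρ γ lam) (-t) := by
  ext t
  rw [ProbabilityTheory.mgf, integral_specMeasure hρ hγ hlam, Bfun_eq]
  refine integral_congr_ae (Eventually.of_forall fun r => ?_)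
  simp [mul_comm]

lemma Bfun_analyticOnNhd (hρ : ρ ∈ Ioo (0 : ℝ) 1) (hγ : 0 < γ) (hlam : 0 < lam) :
    AnalyticOnNhd ℝ (Bfun ρ γ lam) (Ioi 0) := by
  rw [Bfun_eq_mgf hρ hγ hlam]
  refine (ProbabilityTheory.analyticOnNhd_mgf).comp (analyticOnNhd_id.neg) fun t ht => ?_
  refine Iio_subset_integrableExpSet hρ hγ hlam ?_
  simpa using ht

lemma Bfun_hasDerivAt (hρ : ρ ∈ Ioo (0 : ℝ) 1) (hγ : 0 < γ) (hlam : 0 < lam) {t : ℝ}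
    (ht : 0 < t) : HasDerivAt (Bfun ρ γ lam) (deriv (Bfun ρ γ lam) t) t :=
  (Bfun_analyticOnNhd hρ hγ hlam t ht).differentiableAt.hasDerivAt

lemma Bfun_deriv_continuousOn (hρ : ρ ∈ Ioo (0 : ℝ) 1) (hγ : 0 < γ) (hlam : 0 < lam) :
    ContinuousOn (deriv (Bfun ρ γ lam)) (Ioi 0) :=
  (Bfun_analyticOnNhd hρ hγ hlam).deriv.continuousOn

lemma Bfun_deriv_eq (hρ : ρ ∈ Ioo (0 : ℝ) 1) (hγ : 0 < γ) (hlam : 0 < lam) {t : ℝ}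
    (ht : 0 < t) : IntegrableOn (fun r => r * Real.exp (-r * t) * dens ρ γ lam r) (Ioi 0) ∧
    deriv (Bfun ρ γ lam) t = -∫ r in Ioi (0 : ℝ), r * Real.exp (-r * t) * dens ρ γ lam r := by
  have hmem : -t ∈ interior (ProbabilityTheory.integrableExpSet id (specMeasure ρ γ lam)) :=
    Iio_subset_integrableExpSet hρ hγ hlam (by simpa using ht)
  constructor
  · have := ProbabilityTheory.integrable_pow_mul_exp_of_mem_interior_integrableExpSet hmem 1
    rw [integrable_specMeasure hρ hγ hlam] at this
    refine this.congr_fun (fun r _ => ?_) measurableSet_Ioi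
    simp [mul_comm]
  · have h := (ProbabilityTheory.hasDerivAt_mgf hmem).scomp t (hasDerivAt_neg t)
    have e : ProbabilityTheory.mgf id (specMeasure ρ γ lam) ∘ Neg.neg = Bfun ρ γ lam :=
      (Bfun_eq_mgf hρ hγ hlam).symm
    rw [e] at h
    rw [h.deriv, integral_specMeasure hρ hγ hlam, neg_one_smul]
    congr 1
    refine integral_congr_ae (Eventually.of_forall fun r => ?_)
    simp [mul_comm]

/-- Complete monotonicity bounds the derivative: `|B'(t)| ≤ (2/t) (1 - B(t))`. -/
lemma abs_Bfun_deriv_le (hρ : ρ ∈ Ioo (0 : ℝ) 1) (hγ : 0 < γ) (hlam : 0 < lam) {t : ℝ}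
    (ht : 0 < t) : |deriv (Bfun ρ γ lam) t| ≤ 2 / t * (1 - Bfun ρ γ lam t) := by
  obtain ⟨hi, he⟩ := Bfun_deriv_eq hρ hγ hlam ht
  have h0 : 0 ≤ ∫ r in Ioi (0 : ℝ), r * Real.exp (-r * t) * dens ρ γ lam r :=
    setIntegral_nonneg measurableSet_Ioi fun r hr =>
      mul_nonneg (mul_nonneg (le_of_lt hr) (Real.exp_pos _).le) (dens_pos hρ hγ hlam hr).le
  rw [he, abs_neg, abs_of_nonneg h0, div_mul_eq_mul_div, le_div_iff₀ ht]
  -- Pointwise (rt/2) exp(-rt) ≤ exp(-rt/2) - exp(-rt), which is x + 1 ≤ exp x at x = rt/2. It then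
  -- remains to use B(t/2) ≤ 1.
  have h2 : t / 2 * ∫ r in Ioi (0 : ℝ), r * Real.exp (-r * t) * dens ρ γ lam r ≤
      Bfun ρ γ lam (t / 2) - Bfun ρ γ lam t := by
    have i1 := integrableOn_exp_mul_dens hρ hγ hlam (t := t / 2) (by positivity)
    have i2 := integrableOn_exp_mul_dens hρ hγ hlam ht.le
    rw [Bfun_eq, Bfun_eq, ← integral_sub i1 i2, ← integral_const_mul]
    refine setIntegral_mono_on (hi.const_mul _) (i1.sub i2) measurableSet_Ioi fun r hr => ?_
    have hd := (dens_pos hρ hγ hlam hr).le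
    rw [← sub_mul, ← mul_assoc]
    refine mul_le_mul_of_nonneg_right ?_ hd
    have e1 : Real.exp (-r * (t / 2)) = Real.exp (-r * t) * Real.exp (r * t / 2) := by
      rw [← Real.exp_add]; congr 1; ring
    rw [e1]
    have := Real.add_one_le_exp (r * t / 2)
    nlinarith [Real.exp_pos (-r * t)]
  have h3 := Bfun_le_one hρ hγ hlam (t := t / 2) (by positivity)
  linarith

end Monotone

/-! ### Uniqueness for the Laplace transform 1/s. -/

section LaplaceUniqueness

/-- The weight exp(-t) makes the measure finite. For u ≥ 1 the moment generating function has its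
default value 0: integrability there would make L integrable, and ∫L would exceed 1/s for every s >
0. Hence the function is determined on the whole line. -/
lemma mgf_weighted {L : ℝ → ℝ} (hm : Measurable L) (h0 : ∀ t, 0 ≤ L t)
    (hL : ∀ s : ℝ, 0 < s → IntegrableOn (fun t => Real.exp (-s * t) * L t) (Ioi 0) ∧
      ∫ t in Ioi (0 : ℝ), Real.exp (-s * t) * L t = s⁻¹) :
    Iio 1 ⊆ ProbabilityTheory.integrableExpSet id ((volume.restrict (Ioi (0 : ℝ))).withDensity
      fun t => ENNReal.ofReal (Real.exp (-t) * L t)) ∧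
    ProbabilityTheory.mgf id ((volume.restrict (Ioi (0 : ℝ))).withDensity
      fun t => ENNReal.ofReal (Real.exp (-t) * L t)) = fun u => if u < 1 then (1 - u)⁻¹ else 0 := by
  have hmeas : Measurable fun t => ENNReal.ofReal (Real.exp (-t) * L t) := by fun_prop
  have hfin : ∀ᵐ t ∂(volume.restrict (Ioi (0 : ℝ))),
      ENNReal.ofReal (Real.exp (-t) * L t) < ⊤ := Eventually.of_forall fun _ => ENNReal.ofReal_lt_top
  have e : ∀ u t, Real.exp (u * id t) * (ENNReal.ofReal (Real.exp (-t) * L t)).toReal =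
      Real.exp (-(1 - u) * t) * L t := by
    intro u t
    rw [ENNReal.toReal_ofReal (mul_nonneg (Real.exp_pos _).le (h0 t)), ← mul_assoc, ← Real.exp_add]
    congr 2; simp only [id]; ring
  have hint : ∀ u, Integrable (fun t => Real.exp (u * id t))
      ((volume.restrict (Ioi (0 : ℝ))).withDensity
      fun t => ENNReal.ofReal (Real.exp (-t) * L t)) ↔
      IntegrableOn (fun t => Real.exp (-(1 - u) * t) * L t) (Ioi 0) := by
    intro u
    rw [integrable_withDensity_iff hmeas hfin]
    simp only [e, IntegrableOn]
  constructor
  · intro u hu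
    exact (hint u).2 (hL (1 - u) (sub_pos.2 hu)).1
  · ext u
    split_ifs with hu
    · rw [ProbabilityTheory.mgf, integral_withDensity_eq_integral_toReal_smul hmeas hfin,
        ← (hL (1 - u) (sub_pos.2 hu)).2]
      refine integral_congr_ae (Eventually.of_forall fun t => ?_)
      simp only [smul_eq_mul]
      rw [mul_comm, e]
    · refine integral_undef fun hcon => ?_
      rw [hint] at hcon
      have hLi : IntegrableOn L (Ioi 0) := by
        refine hcon.mono' hm.aestronglyMeasurable ?_
        filter_upwards [ae_restrict_mem measurableSet_Ioi] with t ht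
        have ht' : 0 < t := ht
        rw [Real.norm_of_nonneg (h0 t)]
        refine le_mul_of_one_le_left (h0 t) (Real.one_le_exp ?_)
        nlinarith
      have hM : ∀ s : ℝ, 0 < s → s⁻¹ ≤ ∫ t in Ioi (0 : ℝ), L t := by
        intro s hs
        rw [← (hL s hs).2]
        refine setIntegral_mono_on (hL s hs).1 hLi measurableSet_Ioi fun t ht => ?_
        have ht' : 0 < t := ht
        refine mul_le_of_le_one_left (h0 t) (Real.exp_le_one_iff.2 ?_)
        nlinarith
      have hM0 : 0 ≤ ∫ t in Ioi (0 : ℝ), L t := integral_nonneg h0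
      have := hM ((∫ t in Ioi (0 : ℝ), L t) + 1)⁻¹ (by positivity)
      rw [inv_inv] at this
      linarith

/-- A nonnegative function whose Laplace transform is `1 / s` equals `1`. -/
theorem ae_eq_one_of_laplace {L : ℝ → ℝ} (hm : Measurable L) (h0 : ∀ t, 0 ≤ L t)
    (hL : ∀ s : ℝ, 0 < s → IntegrableOn (fun t => Real.exp (-s * t) * L t) (Ioi 0) ∧
      ∫ t in Ioi (0 : ℝ), Real.exp (-s * t) * L t = s⁻¹) :
    ∀ᵐ t ∂(volume.restrict (Ioi (0 : ℝ))), L t = 1 := by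
  obtain ⟨hs1, hm1⟩ := mgf_weighted hm h0 hL
  obtain ⟨hs2, hm2⟩ := mgf_weighted (L := fun _ => 1) measurable_const (fun _ => zero_le_one)
    fun s hs => by simpa using integral_exp_neg_Ioi hs
  have hmL : Measurable fun t => ENNReal.ofReal (Real.exp (-t) * L t) := by fun_prop
  have hmO : Measurable fun t : ℝ => ENNReal.ofReal (Real.exp (-t) * 1) := by fun_prop
  set ν₁ := (volume.restrict (Ioi (0 : ℝ))).withDensity
    fun t => ENNReal.ofReal (Real.exp (-t) * L t) with hν₁
  set ν₂ := (volume.restrict (Ioi (0 : ℝ))).withDensity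
    fun t => ENNReal.ofReal (Real.exp (-t) * 1) with hν₂
  have fin : ∀ ν : Measure ℝ, Iio 1 ⊆ ProbabilityTheory.integrableExpSet id ν →
      IsFiniteMeasure ν := fun ν h => by
    have : (0 : ℝ) ∈ ProbabilityTheory.integrableExpSet id ν := h (by simp)
    simp only [ProbabilityTheory.integrableExpSet, mem_ofPred_eq, zero_mul, Real.exp_zero] at this
    exact (integrable_const_iff.1 this).resolve_left one_ne_zero
  have f1 := fin ν₁ hs1
  have f2 := fin ν₂ hs2
  have hne : ∀ ν : Measure ℝ, (ProbabilityTheory.mgf id ν =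
      fun u => if u < 1 then (1 - u)⁻¹ else 0) → ν ≠ 0 := fun ν h h0 => by
    have := congrFun h 0
    simp [h0] at this
  -- Equal real moment generating functions have equal analytic continuations to a vertical strip.
  -- The strip contains the imaginary axis, since 0 is an interior point, so the characteristic
  -- functions agree.
  have heq := ProbabilityTheory.eqOn_complexMGF_of_mgf' (hm1.trans hm2.symm)
    (iff_of_false (hne _ hm1) (hne _ hm2))
  have hν : ν₁ = ν₂ := by
    refine Measure.ext_of_charFun ?_
    ext t
    rw [← ProbabilityTheory.complexMGF_id_mul_I, ← ProbabilityTheory.complexMGF_id_mul_I]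
    refine heq ?_
    have : (0 : ℝ) ∈ interior (ProbabilityTheory.integrableExpSet id ν₁) :=
      interior_maximal hs1 isOpen_Iio (by simp)
    simpa using this
  have hlt : ∫⁻ t in Ioi (0 : ℝ), ENNReal.ofReal (Real.exp (-t) * L t) ≠ ⊤ := by
    have := measure_ne_top ν₁ univ
    rwa [hν₁, withDensity_apply _ MeasurableSet.univ, Measure.restrict_univ] at this
  have := (withDensity_eq_iff hmL.aemeasurable hmO.aemeasurable hlt).1 hν
  filter_upwards [this] with t ht
  have he := Real.exp_pos (-t)
  rw [ENNReal.ofReal_eq_ofReal_iff (mul_nonneg he.le (h0 t)) (by positivity)] at ht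
  exact mul_left_cancel₀ he.ne' ht

end LaplaceUniqueness

/-! ### Continuity of integrals with a variable endpoint. -/

section Kernel

/-- Integrals `∫₀ᵗ F σ t dσ` with an integrable majorant depend continuously on `t`. -/
theorem continuousOn_integral_kernel {E : Type*} [NormedAddCommGroup E] [NormedSpace ℝ E]
    {F : ℝ → ℝ → E} {κ : ℝ → ℝ} {T : ℝ} (hκ : IntegrableOn κ (Ioc 0 T))
    (hm : ∀ t ∈ Icc 0 T, AEStronglyMeasurable (fun σ => F σ t) (volume.restrict (Ioc 0 t)))
    (hb : ∀ t ∈ Icc 0 T, ∀ σ ∈ Ioc 0 t, ‖F σ t‖ ≤ κ σ)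
    (hc : ∀ σ ∈ Ioc 0 T, ContinuousOn (F σ) (Icc σ T)) :
    ContinuousOn (fun t => ∫ σ in (0 : ℝ)..t, F σ t) (Icc 0 T) := by
  -- An indicator moves the variable endpoint into the integrand over the fixed interval (0,T]. The
  -- integrand is then continuous at t₀ for every σ ≠ t₀, and dominated convergence applies.
  have key : ContinuousOn (fun t => ∫ σ in Ioc 0 T, (Iic t).indicator (fun σ => F σ t) σ)
      (Icc 0 T) := by
    intro t₀ ht₀
    refine continuousWithinAt_of_dominated (bound := fun σ => |κ σ|) ?_ ?_ hκ.norm ?_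
    · filter_upwards [self_mem_nhdsWithin] with t ht
      rw [aestronglyMeasurable_indicator_iff measurableSet_Iic,
        Measure.restrict_restrict measurableSet_Iic]
      have : Iic t ∩ Ioc 0 T = Ioc 0 t := by
        ext σ; simp only [mem_inter_iff, mem_Iic, mem_Ioc]
        exact ⟨fun h => ⟨h.2.1, h.1⟩, fun h => ⟨h.2, h.1, h.2.trans ht.2⟩⟩
      rw [this]; exact hm t ht
    · filter_upwards [self_mem_nhdsWithin] with t ht
      filter_upwards [ae_restrict_mem measurableSet_Ioc] with σ hσ
      by_cases h : σ ≤ t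
      · rw [indicator_of_mem (mem_Iic.2 h)]
        exact (hb t ht σ ⟨hσ.1, h⟩).trans (le_abs_self _)
      · rw [indicator_of_notMem (by simpa using h), norm_zero]; exact abs_nonneg _
    · have hne : ∀ᵐ σ ∂(volume.restrict (Ioc 0 T)), σ ≠ t₀ :=
        ae_restrict_of_ae (by simp [ae_iff])
      filter_upwards [ae_restrict_mem measurableSet_Ioc, hne] with σ hσ hσt
      rcases lt_or_gt_of_ne hσt with h | h
      · have h1 : ContinuousWithinAt (F σ) (Icc 0 T) t₀ :=
          (hc σ hσ t₀ ⟨h.le, ht₀.2⟩).mono_of_mem_nhdsWithin (by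
            filter_upwards [self_mem_nhdsWithin, nhdsWithin_le_nhds (lt_mem_nhds h)] with x hx hx'
            exact ⟨le_of_lt hx', hx.2⟩)
        refine h1.congr_of_eventuallyEq ?_ (by rw [indicator_of_mem (mem_Iic.2 h.le)])
        filter_upwards [nhdsWithin_le_nhds (lt_mem_nhds h)] with x hx
        rw [indicator_of_mem (mem_Iic.2 (le_of_lt hx))]
      · refine continuousWithinAt_const (b := (0 : E)).congr_of_eventuallyEq ?_
          (by rw [indicator_of_notMem (by simpa using h)])
        filter_upwards [nhdsWithin_le_nhds (gt_mem_nhds h)] with x hx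
        rw [indicator_of_notMem (by simpa using hx)]
  refine key.congr fun t ht => ?_
  simp only
  rw [intervalIntegral.integral_of_le ht.1, setIntegral_indicator measurableSet_Iic]
  congr 2
  ext σ; simp only [mem_inter_iff, mem_Iic, mem_Ioc]
  exact ⟨fun h => ⟨⟨h.1, h.2.trans ht.2⟩, h.2⟩, fun h => ⟨h.1.1, h.2⟩⟩

end Kernel

/-! ### Convolution on the half-line. -/

section Conv

variable {𝕜 : Type*} [RCLike 𝕜]

/-- Convolution on the half-line, `(α * β)(t) = ∫₀ᵗ α(τ) β(t - τ) dτ`. -/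
def conv (α β : ℝ → 𝕜) (t : ℝ) : 𝕜 := ∫ τ in (0 : ℝ)..t, α τ * β (t - τ)

lemma conv_comm (α β : ℝ → 𝕜) (t : ℝ) : conv α β t = conv β α t := by
  unfold conv
  have := intervalIntegral.integral_comp_sub_left (fun τ => α τ * β (t - τ)) (a := 0) (b := t) t
  rw [sub_self, sub_zero] at this
  rw [← this]
  refine intervalIntegral.integral_congr fun τ _ => ?_
  simp only [sub_sub_cancel]; ring

lemma conv_one (α : ℝ → 𝕜) (t : ℝ) : conv α (fun _ => 1) t = ∫ τ in (0 : ℝ)..t, α τ := by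
  simp [conv]

lemma conv_congr_left {α α' : ℝ → 𝕜} (β : ℝ → 𝕜) {t : ℝ} (ht : 0 ≤ t)
    (h : ∀ᵐ τ ∂(volume.restrict (Ioc 0 t)), α τ = α' τ) : conv α β t = conv α' β t := by
  unfold conv
  rw [intervalIntegral.integral_of_le ht, intervalIntegral.integral_of_le ht]
  exact integral_congr_ae (h.mono fun τ hτ => by simp only [hτ])

variable {T : ℝ}

lemma aestronglyMeasurable_comp_sub {E : Type*} [TopologicalSpace E] {β : ℝ → E} {t : ℝ}
    (hβ : AEStronglyMeasurable β (volume.restrict (Ioc 0 t))) :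
    AEStronglyMeasurable (fun τ => β (t - τ)) (volume.restrict (Ioc 0 t)) := by
  have h1 : MeasurePreserving (fun τ : ℝ => t - τ) (volume.restrict (Ico 0 t))
      (volume.restrict (Ioc 0 t)) := by
    have := (Measure.measurePreserving_sub_left (volume : Measure ℝ) t).restrict_preimage
      (s := Ioc 0 t) measurableSet_Ioc
    have e : (fun τ : ℝ => t - τ) ⁻¹' Ioc 0 t = Ico 0 t := by
      ext τ; simp only [mem_preimage, mem_Ioc, mem_Ico]; constructor <;> rintro ⟨h, h'⟩ <;>
        constructor <;> linarith
    rwa [e] at this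
  have h2 := hβ.comp_measurePreserving h1
  rwa [Measure.restrict_congr_set Ico_ae_eq_Ioc] at h2

lemma continuousOn_conv {α β : ℝ → 𝕜} (hα : IntegrableOn α (Ioc 0 T))
    (hβ : ContinuousOn β (Icc 0 T)) : ContinuousOn (conv α β) (Icc 0 T) := by
  obtain ⟨M, hM⟩ := isCompact_Icc.exists_bound_of_continuousOn hβ
  refine continuousOn_integral_kernel (F := fun σ t => α σ * β (t - σ))
    (κ := fun σ => ‖α σ‖ * M) (hα.norm.mul_const _) (fun t ht => ?_) (fun t ht σ hσ => ?_)
    fun σ hσ => ?_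
  · refine (hα.1.mono_set (Ioc_subset_Ioc_right ht.2)).mul (aestronglyMeasurable_comp_sub ?_)
    exact (hβ.mono fun x hx => ⟨hx.1.le, hx.2.trans ht.2⟩).aestronglyMeasurable measurableSet_Ioc
  · rw [norm_mul]
    exact mul_le_mul_of_nonneg_left (hM _ ⟨by linarith [hσ.2], by linarith [hσ.1, ht.2]⟩)
      (norm_nonneg _)
  · refine continuousOn_const.mul (hβ.comp (by fun_prop) fun t ht => ?_)
    exact ⟨by linarith [ht.1], by linarith [hσ.1, ht.2]⟩

lemma convolution_indicator_eq {α β : ℝ → 𝕜} {x : ℝ} (hx : x ∈ Icc 0 T) :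
    convolution ((Ioo 0 T).indicator α) ((Ioo 0 T).indicator β) (ContinuousLinearMap.mul ℝ 𝕜)
      volume x = conv α β x := by
  rw [convolution, conv, intervalIntegral.integral_of_le hx.1, integral_Ioc_eq_integral_Ioo,
    ← integral_indicator measurableSet_Ioo]
  refine integral_congr_ae (Eventually.of_forall fun τ => ?_)
  simp only [ContinuousLinearMap.mul_apply']
  by_cases h : τ ∈ Ioo 0 x
  · have h1 : τ ∈ Ioo 0 T := ⟨h.1, h.2.trans_le hx.2⟩
    have h2 : x - τ ∈ Ioo 0 T := ⟨by linarith [h.2], by linarith [h.1, hx.2]⟩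
    rw [indicator_of_mem h, indicator_of_mem h1, indicator_of_mem h2]
  · rw [indicator_of_notMem h]
    by_cases h1 : τ ∈ Ioo 0 T
    · have h2 : x - τ ∉ Ioo 0 T := fun h2 => h ⟨h1.1, by linarith [h2.1]⟩
      rw [indicator_of_notMem h2, mul_zero]
    · rw [indicator_of_notMem h1, zero_mul]

lemma integrable_indicator_Ioo {α : ℝ → 𝕜} (hα : IntegrableOn α (Ioc 0 T)) :
    Integrable ((Ioo 0 T).indicator α) :=
  (hα.mono_set Ioo_subset_Ioc_self).integrable_indicator measurableSet_Ioo

lemma integrableOn_conv {α β : ℝ → 𝕜} (hα : IntegrableOn α (Ioc 0 T))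
    (hβ : IntegrableOn β (Ioc 0 T)) : IntegrableOn (conv α β) (Ioc 0 T) := by
  have := ((integrable_indicator_Ioo hα).integrable_convolution (ContinuousLinearMap.mul ℝ 𝕜)
    (integrable_indicator_Ioo hβ)).integrableOn (s := Ioc 0 T)
  exact this.congr_fun (fun x hx => convolution_indicator_eq ⟨hx.1.le, hx.2⟩) measurableSet_Ioc

/-- Truncation of the three factors to (0,T) reduces this to associativity of convolution on ℝ.
Boundedness of g yields existence of the triple convolution at the point T itself, not merely almost
everywhere. -/
theorem conv_assoc {α β g : ℝ → 𝕜} (hT : 0 ≤ T) (hα : IntegrableOn α (Ioc 0 T))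
    (hβ : IntegrableOn β (Ioc 0 T)) (hg : ContinuousOn g (Icc 0 T)) :
    conv (conv α β) g T = conv α (conv β g) T := by
  have hTT : T ∈ Icc 0 T := ⟨hT, le_rfl⟩
  have hgi : IntegrableOn g (Ioc 0 T) := hg.integrableOn_Icc.mono_set Ioc_subset_Icc_self
  have iα := integrable_indicator_Ioo hα
  have iβ := integrable_indicator_Ioo hβ
  have ig := integrable_indicator_Ioo hgi
  obtain ⟨M, hM⟩ := isCompact_Icc.exists_bound_of_continuousOn hg
  have hM0 : 0 ≤ M := (norm_nonneg _).trans (hM T hTT)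
  have hgb : ∀ x, ‖(Ioo 0 T).indicator g x‖ ≤ M := fun x => by
    by_cases h : x ∈ Ioo 0 T
    · rw [indicator_of_mem h]; exact hM x ⟨h.1.le, h.2.le⟩
    · rw [indicator_of_notMem h]; simpa using hM0
  have h := convolution_assoc (ContinuousLinearMap.mul ℝ 𝕜) (ContinuousLinearMap.mul ℝ 𝕜)
    (ContinuousLinearMap.mul ℝ 𝕜) (ContinuousLinearMap.mul ℝ 𝕜) (μ := volume) (ν := volume)
    (f := (Ioo 0 T).indicator α) (g := (Ioo 0 T).indicator β) (k := (Ioo 0 T).indicator g)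
    (fun x y z => mul_assoc x y z) (x₀ := T) iα.1 iβ.1 ig.1 (iα.ae_convolution_exists _ iβ)
    (iβ.norm.ae_convolution_exists _ ig.norm) ?_
  · rw [← convolution_indicator_eq hTT, ← convolution_indicator_eq hTT]
    convert h using 1
    · refine integral_congr_ae (Eventually.of_forall fun τ => ?_)
      simp only [ContinuousLinearMap.mul_apply']
      by_cases h1 : T - τ ∈ Ioo 0 T
      · have h2 : τ ∈ Ioo 0 T := ⟨by linarith [h1.2], by linarith [h1.1]⟩
        rw [indicator_of_mem h2, convolution_indicator_eq ⟨h2.1.le, h2.2.le⟩]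
      · rw [indicator_of_notMem h1, mul_zero, mul_zero]
    · refine integral_congr_ae (Eventually.of_forall fun τ => ?_)
      simp only [ContinuousLinearMap.mul_apply']
      by_cases h1 : τ ∈ Ioo 0 T
      · have h2 : T - τ ∈ Ioo 0 T := ⟨by linarith [h1.2], by linarith [h1.1]⟩
        rw [indicator_of_mem h2, convolution_indicator_eq ⟨h2.1.le, h2.2.le⟩]
      · rw [indicator_of_notMem h1, zero_mul, zero_mul]
  · refine BddAbove.convolutionExistsAt (s := univ) _ ?_ MeasurableSet.univ (subset_univ _)
      iα.norm.integrableOn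
      (iβ.norm.integrable_convolution (ContinuousLinearMap.mul ℝ ℝ) ig.norm).1
    refine ⟨(∫ y, ‖(Ioo 0 T).indicator β y‖) * M, ?_⟩
    rintro _ ⟨x, -, rfl⟩
    simp only
    rw [convolution, ← integral_mul_const]
    refine norm_integral_le_of_norm_le (iβ.norm.mul_const M) (Eventually.of_forall fun y => ?_)
    simp only [ContinuousLinearMap.mul_apply', norm_mul, norm_norm]
    exact mul_le_mul_of_nonneg_left (hgb _) (norm_nonneg _)

end Conv

/-! ### The resolvent equation and the bounds that follow from it. -/

section Volterra

variable {ρ γ lam : ℝ}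

/-- The kernel `λ + λ γ t ^ (-ρ) / Γ(1 - ρ)` of the integrated equation. -/
def kap (ρ γ lam t : ℝ) : ℝ := lam + lam * γ * ((Real.Gamma (1 - ρ))⁻¹ * t ^ (-ρ))

lemma kap_nonneg (hρ : ρ ∈ Ioo (0 : ℝ) 1) (hγ : 0 < γ) (hlam : 0 < lam) {t : ℝ} (ht : 0 ≤ t) :
    0 ≤ kap ρ γ lam t := by
  have : 0 < Real.Gamma (1 - ρ) := Real.Gamma_pos_of_pos (by linarith [hρ.2])
  unfold kap; positivity

lemma integrableOn_rpow_neg (hρ : ρ ∈ Ioo (0 : ℝ) 1) {t : ℝ} (ht : 0 ≤ t) :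
    IntegrableOn (fun τ : ℝ => τ ^ (-ρ)) (Ioc 0 t) :=
  (intervalIntegrable_iff_integrableOn_Ioc_of_le ht).1
    (intervalIntegral.intervalIntegrable_rpow' (by linarith [hρ.2]))

lemma integrableOn_kap (hρ : ρ ∈ Ioo (0 : ℝ) 1) {t : ℝ} (ht : 0 ≤ t) :
    IntegrableOn (kap ρ γ lam) (Ioc 0 t) :=
  Integrable.add (by simp) (((integrableOn_rpow_neg hρ ht).const_mul _).const_mul _)

/-- `∫₀ᵗ kap`, up to the factor `λ`. -/
def kapInt (ρ γ t : ℝ) : ℝ := t + γ * (t ^ (1 - ρ) / ((1 - ρ) * Real.Gamma (1 - ρ)))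

lemma integral_kap (hρ : ρ ∈ Ioo (0 : ℝ) 1) (t : ℝ) :
    ∫ τ in (0 : ℝ)..t, kap ρ γ lam τ = lam * kapInt ρ γ t := by
  have hi : IntervalIntegrable (fun τ : ℝ => τ ^ (-ρ)) volume 0 t :=
    intervalIntegral.intervalIntegrable_rpow' (by linarith [hρ.2])
  unfold kap kapInt
  rw [intervalIntegral.integral_add (by simp) ((hi.const_mul _).const_mul _),
    intervalIntegral.integral_const_mul, intervalIntegral.integral_const_mul,
    integral_rpow (Or.inl (by linarith [hρ.2])), Real.zero_rpow (by linarith [hρ.2])]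
  simp only [intervalIntegral.integral_const, sub_zero, smul_eq_mul]
  rw [show -ρ + 1 = 1 - ρ by ring, mul_comm (1 - ρ), div_mul_eq_div_div]
  ring

lemma kapInt_nonneg (hρ : ρ ∈ Ioo (0 : ℝ) 1) (hγ : 0 < γ) {t : ℝ} (ht : 0 ≤ t) :
    0 ≤ kapInt ρ γ t := by
  have : 0 < Real.Gamma (1 - ρ) := Real.Gamma_pos_of_pos (by linarith [hρ.2])
  have : 0 < 1 - ρ := by linarith [hρ.2]
  unfold kapInt; positivity

lemma laplace_kap (hρ : ρ ∈ Ioo (0 : ℝ) 1) {s : ℝ} (hs : 0 < s) :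
    IntegrableOn (fun t => Real.exp (-s * t) * kap ρ γ lam t) (Ioi 0) ∧
      ∫ t in Ioi (0 : ℝ), Real.exp (-s * t) * kap ρ γ lam t =
        lam * s⁻¹ + lam * γ * (s ^ ρ * s⁻¹) := by
  have hG : 0 < Real.Gamma (1 - ρ) := Real.Gamma_pos_of_pos (by linarith [hρ.2])
  have h1 := integral_exp_neg_Ioi hs
  have h2 := Real.integral_rpow_mul_exp_neg_mul_Ioi (a := 1 - ρ) (by linarith [hρ.2]) hs
  have e1 : (1 - ρ - 1) = -ρ := by ring
  have e2 : ∀ t : ℝ, -(s * t) = -s * t := fun t => by ring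
  simp only [e1, e2] at h2
  -- The integral of a non-integrable function is 0 by convention, so a nonzero value proves
  -- integrability.
  have i2 : IntegrableOn (fun t : ℝ => t ^ (-ρ) * Real.exp (-s * t)) (Ioi 0) :=
    .of_integral_ne_zero (by rw [h2]; positivity)
  have e : ∀ t, Real.exp (-s * t) * kap ρ γ lam t = lam * Real.exp (-s * t) +
      lam * γ * ((Real.Gamma (1 - ρ))⁻¹ * (t ^ (-ρ) * Real.exp (-s * t))) := fun t => by
    unfold kap; ring
  simp only [e]
  have j1 := h1.1.const_mul lam
  have j2 := (i2.const_mul (Real.Gamma (1 - ρ))⁻¹).const_mul (lam * γ)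
  refine ⟨j1.add j2, ?_⟩
  rw [integral_add j1 j2, integral_const_mul, integral_const_mul, integral_const_mul, h1.2, h2,
    one_div, Real.inv_rpow hs.le, ← Real.rpow_neg hs.le, neg_sub, Real.rpow_sub_one hs.ne']
  field_simp

lemma Bfun_integrableOn (hρ : ρ ∈ Ioo (0 : ℝ) 1) (hγ : 0 < γ) (hlam : 0 < lam) (t : ℝ) :
    IntegrableOn (Bfun ρ γ lam) (Ioc 0 t) :=
  ((Bfun_continuousOn hρ hγ hlam).mono fun _ hx => hx.1).integrableOn_Icc.mono_set
    Ioc_subset_Icc_self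

lemma continuousOn_conv_kap_Bfun (hρ : ρ ∈ Ioo (0 : ℝ) 1) (hγ : 0 < γ) (hlam : 0 < lam) :
    ContinuousOn (conv (kap ρ γ lam) (Bfun ρ γ lam)) (Ioi 0) := by
  intro t ht
  have ht' : 0 < t := ht
  have := continuousOn_conv (integrableOn_kap (γ := γ) (lam := lam) hρ (t := t + 1) (by linarith))
    ((Bfun_continuousOn hρ hγ hlam).mono fun x (hx : x ∈ Icc 0 (t + 1)) => hx.1)
  exact (this.continuousAt (Icc_mem_nhds ht' (by linarith))).continuousWithinAt

/-- The integrated resolvent equation `B + (λ + λ γ k) * B = 1`. -/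
theorem resolvent_equation (hρ : ρ ∈ Ioo (0 : ℝ) 1) (hγ : 0 < γ) (hlam : 0 < lam) {t : ℝ}
    (ht : 0 ≤ t) : Bfun ρ γ lam t + conv (kap ρ γ lam) (Bfun ρ γ lam) t = 1 := by
  rcases ht.eq_or_lt with rfl | ht
  · simp [conv, Bfun_zero hρ hγ hlam]
  -- L is nonnegative with transform F(s)(1 + λ/s + λγ s^(ρ-1)) = 1/s, hence equals 1 almost
  -- everywhere on the half-line; continuity gives every t > 0.
  set L : ℝ → ℝ := fun t => Bfun ρ γ lam t + conv (kap ρ γ lam) (Bfun ρ γ lam) t with hL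
  have hc : ContinuousOn L (Ioi 0) :=
    ((Bfun_continuousOn hρ hγ hlam).mono Ioi_subset_Ici_self).add
      (continuousOn_conv_kap_Bfun hρ hγ hlam)
  have hpos : ∀ t ∈ Ioi (0 : ℝ), 0 ≤ L t := fun t ht => by
    refine add_nonneg (Bfun_nonneg hρ hγ hlam t) ?_
    refine intervalIntegral.integral_nonneg (le_of_lt ht) fun τ hτ => ?_
    exact mul_nonneg (kap_nonneg hρ hγ hlam hτ.1) (Bfun_nonneg hρ hγ hlam _)
  have hmeas : Measurable ((Ioi 0).indicator L) := by
    classical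
    rw [← piecewise_eq_indicator]
    exact hc.measurable_piecewise continuousOn_const measurableSet_Ioi
  have key : ∀ᵐ t ∂(volume.restrict (Ioi (0 : ℝ))), (Ioi 0).indicator L t = 1 := by
    refine ae_eq_one_of_laplace hmeas (fun t => indicator_nonneg hpos t) fun s hs => ?_
    have hB := laplace_Bfun hρ hγ hlam hs
    have hk := laplace_kap (γ := γ) (lam := lam) hρ hs
    have hconv := integral_posConvolution hk.1 hB.1 (ContinuousLinearMap.mul ℝ ℝ)
    have hci := integrable_posConvolution hk.1 hB.1 (ContinuousLinearMap.mul ℝ ℝ)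
    have e : ∀ x : ℝ, (∫ t in (0 : ℝ)..x, ContinuousLinearMap.mul ℝ ℝ
        (Real.exp (-s * t) * kap ρ γ lam t) (Real.exp (-s * (x - t)) * Bfun ρ γ lam (x - t))) =
        Real.exp (-s * x) * conv (kap ρ γ lam) (Bfun ρ γ lam) x := fun x => by
      rw [conv, ← intervalIntegral.integral_const_mul]
      refine intervalIntegral.integral_congr fun t _ => ?_
      have : Real.exp (-s * x) = Real.exp (-s * t) * Real.exp (-s * (x - t)) := by
        rw [← Real.exp_add]; congr 1; ring
      simp only [ContinuousLinearMap.mul_apply', this]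
      ring
    simp only [e] at hconv
    have hci' : IntegrableOn (fun x => Real.exp (-s * x) *
        conv (kap ρ γ lam) (Bfun ρ γ lam) x) (Ioi 0) := by
      refine hci.integrableOn.congr_fun (fun x hx => ?_) measurableSet_Ioi
      rw [← e, posConvolution, indicator_of_mem hx]
    have e2 : EqOn (fun t => Real.exp (-s * t) * Bfun ρ γ lam t + Real.exp (-s * t) *
        conv (kap ρ γ lam) (Bfun ρ γ lam) t)
        (fun t => Real.exp (-s * t) * (Ioi 0).indicator L t) (Ioi 0) := fun t ht => by
      simp only [indicator_of_mem ht, hL]; ring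
    refine ⟨IntegrableOn.congr_fun (hB.1.add hci') e2 measurableSet_Ioi, ?_⟩
    rw [← setIntegral_congr_fun measurableSet_Ioi e2, integral_add hB.1 hci', hconv, hB.2, hk.2]
    simp only [ContinuousLinearMap.mul_apply', resolv]
    have : 0 < s + lam + lam * γ * s ^ ρ := by positivity
    field_simp
    ring
  have key2 : L =ᵐ[volume.restrict (Ioi 0)] fun _ => 1 := by
    filter_upwards [key, ae_restrict_mem measurableSet_Ioi] with t h1 h2
    rwa [indicator_of_mem h2] at h1
  exact Measure.eqOn_open_of_ae_eq key2 isOpen_Ioi hc continuousOn_const ht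

lemma intervalIntegrable_kap_mul_Bfun (hρ : ρ ∈ Ioo (0 : ℝ) 1) (hγ : 0 < γ) (hlam : 0 < lam)
    {t : ℝ} (ht : 0 ≤ t) :
    IntervalIntegrable (fun τ => kap ρ γ lam τ * Bfun ρ γ lam (t - τ)) volume 0 t := by
  have h : ContinuousOn (fun τ => Bfun ρ γ lam (t - τ)) (uIcc 0 t) := by
    rw [uIcc_of_le ht]
    exact (Bfun_continuousOn hρ hγ hlam).comp (by fun_prop) fun x hx => by
      simpa using hx.2
  exact ((intervalIntegrable_iff_integrableOn_Ioc_of_le ht).2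
    (integrableOn_kap hρ ht)).mul_continuousOn h

lemma intervalIntegrable_kap (hρ : ρ ∈ Ioo (0 : ℝ) 1) {t : ℝ} (ht : 0 ≤ t) :
    IntervalIntegrable (kap ρ γ lam) volume 0 t :=
  (intervalIntegrable_iff_integrableOn_Ioc_of_le ht).2 (integrableOn_kap hρ ht)

/-- `λ B(t) ≤ (1 - ρ) Γ(1 - ρ) γ⁻¹ t ^ (ρ - 1)`, uniformly in `λ`. -/
lemma lam_mul_Bfun_le (hρ : ρ ∈ Ioo (0 : ℝ) 1) (hγ : 0 < γ) (hlam : 0 < lam) {t : ℝ}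
    (ht : 0 < t) : lam * Bfun ρ γ lam t ≤
      (1 - ρ) * Real.Gamma (1 - ρ) / γ * t ^ (ρ - 1) := by
  have hG : 0 < Real.Gamma (1 - ρ) := Real.Gamma_pos_of_pos (by linarith [hρ.2])
  have h1ρ : 0 < 1 - ρ := by linarith [hρ.2]
  have hB := Bfun_nonneg hρ hγ hlam t
  -- Since B is non-increasing, B(t)∫κ ≤ (κ * B)(t) = 1 - B(t) ≤ 1. Only the t^(1-ρ) part of ∫κ is
  -- kept below.
  have h1 : Bfun ρ γ lam t * (lam * kapInt ρ γ t) ≤ conv (kap ρ γ lam) (Bfun ρ γ lam) t := by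
    rw [← integral_kap hρ, ← intervalIntegral.integral_const_mul]
    refine intervalIntegral.integral_mono_on ht.le ((intervalIntegrable_kap hρ ht.le).const_mul _)
      (intervalIntegrable_kap_mul_Bfun hρ hγ hlam ht.le) fun τ hτ => ?_
    rw [mul_comm]
    refine mul_le_mul_of_nonneg_left ?_ (kap_nonneg hρ hγ hlam hτ.1)
    exact Bfun_antitoneOn hρ hγ hlam (by simpa using hτ.2) ht.le (by linarith [hτ.1])
  have h2 := resolvent_equation hρ hγ hlam ht.le
  have h3 : γ * (t ^ (1 - ρ) / ((1 - ρ) * Real.Gamma (1 - ρ))) ≤ kapInt ρ γ t := by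
    unfold kapInt; linarith
  have h4 : lam * Bfun ρ γ lam t * (γ * (t ^ (1 - ρ) / ((1 - ρ) * Real.Gamma (1 - ρ)))) ≤ 1 := by
    have := mul_le_mul_of_nonneg_left h3 (mul_nonneg hlam.le hB)
    linarith
  have hp : 0 < t ^ (1 - ρ) := Real.rpow_pos_of_pos ht _
  rw [← le_div_iff₀ (by positivity)] at h4
  refine h4.trans_eq ?_
  rw [show ρ - 1 = -(1 - ρ) by ring, Real.rpow_neg ht.le]
  field_simp

/-- The left side is κ * B, and B ≤ 1. -/
lemma one_sub_Bfun_le (hρ : ρ ∈ Ioo (0 : ℝ) 1) (hγ : 0 < γ) (hlam : 0 < lam) {t : ℝ}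
    (ht : 0 ≤ t) : 1 - Bfun ρ γ lam t ≤ lam * kapInt ρ γ t := by
  have h2 := resolvent_equation hρ hγ hlam ht
  have h1 : conv (kap ρ γ lam) (Bfun ρ γ lam) t ≤ lam * kapInt ρ γ t := by
    rw [← integral_kap hρ]
    refine intervalIntegral.integral_mono_on ht (intervalIntegrable_kap_mul_Bfun hρ hγ hlam ht)
      (intervalIntegrable_kap hρ ht) fun τ hτ => ?_
    exact mul_le_of_le_one_right (kap_nonneg hρ hγ hlam hτ.1)
      (Bfun_le_one hρ hγ hlam (by simpa using hτ.2))
  linarith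

lemma conv_Bfun_one_nonneg (hρ : ρ ∈ Ioo (0 : ℝ) 1) (hγ : 0 < γ) (hlam : 0 < lam) {t : ℝ}
    (ht : 0 ≤ t) : 0 ≤ ∫ τ in (0 : ℝ)..t, Bfun ρ γ lam τ :=
  intervalIntegral.integral_nonneg ht fun τ _ => Bfun_nonneg hρ hγ hlam τ

/-- `1 - A(T)` is bounded below uniformly in `λ ≥ λ₁`. -/
lemma one_sub_Afun_ge (hρ : ρ ∈ Ioo (0 : ℝ) 1) (hγ : 0 < γ) {lam₁ T : ℝ} (h₁ : 0 < lam₁)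
    (hlam : lam₁ ≤ lam) (hT : 0 < T) :
    T / (lam₁⁻¹ + kapInt ρ γ T) ≤ 1 - Afun ρ γ lam T := by
  have hl : 0 < lam := h₁.trans_le hlam
  have hk := kapInt_nonneg hρ hγ hT.le
  have hBi : ∀ t : ℝ, 0 ≤ t → IntervalIntegrable (Bfun ρ γ lam) volume 0 t := fun t ht =>
    (intervalIntegrable_iff_integrableOn_Ioc_of_le ht).2 (Bfun_integrableOn hρ hγ hl t)
  set I := ∫ τ in (0 : ℝ)..T, Bfun ρ γ lam τ with hI
  have hI0 : 0 ≤ I := conv_Bfun_one_nonneg hρ hγ hl hT.le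
  have hcI := integrableOn_conv (integrableOn_kap (γ := γ) (lam := lam) hρ hT.le)
    (Bfun_integrableOn hρ hγ hl T)
  -- The resolvent equation integrated over (0,T). Since ∫₀ˢ B ≤ I for s ≤ T, it gives T ≤ I(1 + λ
  -- `kapInt ρ γ T`). As λI = 1 - A(T), the bound follows from 1 ≤ λ/λ₁.
  have e1 : T = I + ∫ t in (0 : ℝ)..T, conv (kap ρ γ lam) (Bfun ρ γ lam) t := by
    rw [hI, ← intervalIntegral.integral_add (hBi T hT.le)
      ((intervalIntegrable_iff_integrableOn_Ioc_of_le hT.le).2 hcI)]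
    rw [intervalIntegral.integral_congr (g := fun _ => 1) fun t ht => ?_]
    · simp
    · rw [uIcc_of_le hT.le] at ht
      exact resolvent_equation hρ hγ hl ht.1
  have e2 : ∫ t in (0 : ℝ)..T, conv (kap ρ γ lam) (Bfun ρ γ lam) t ≤ I * (lam * kapInt ρ γ T) := by
    rw [← conv_one, conv_assoc hT.le (integrableOn_kap hρ hT.le) (Bfun_integrableOn hρ hγ hl T)
      continuousOn_const, ← integral_kap hρ, ← intervalIntegral.integral_const_mul]
    have hcont : ContinuousOn (conv (Bfun ρ γ lam) fun _ => 1) (Icc 0 T) :=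
      continuousOn_conv (Bfun_integrableOn hρ hγ hl T) continuousOn_const
    refine intervalIntegral.integral_mono_on hT.le ?_
      ((intervalIntegrable_kap hρ hT.le).const_mul _) fun τ hτ => ?_
    · refine (intervalIntegrable_kap hρ hT.le).mul_continuousOn ?_
      rw [uIcc_of_le hT.le]
      exact hcont.comp (by fun_prop) fun x hx => ⟨by linarith [hx.2], by linarith [hx.1]⟩
    · rw [mul_comm I]
      refine mul_le_mul_of_nonneg_left ?_ (kap_nonneg hρ hγ hl hτ.1)
      rw [conv_one, hI]
      refine intervalIntegral.integral_mono_interval le_rfl (by linarith [hτ.2])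
        (by linarith [hτ.1]) (Eventually.of_forall fun x => Bfun_nonneg hρ hγ hl x) (hBi T hT.le)
  rw [Afun_eq_one_sub hρ hγ hl hT.le, ← hI, sub_sub_cancel, div_le_iff₀ (by positivity)]
  have h3 : 1 ≤ lam * lam₁⁻¹ := by
    rw [← div_eq_mul_inv, le_div_iff₀ h₁]; linarith
  have h4 : I ≤ I * (lam * lam₁⁻¹) := le_mul_of_one_le_right hI0 h3
  calc T ≤ I + I * (lam * kapInt ρ γ T) := by linarith
    _ ≤ I * (lam * lam₁⁻¹) + I * (lam * kapInt ρ γ T) := by linarith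
    _ = lam * I * (lam₁⁻¹ + kapInt ρ γ T) := by ring

lemma Afun_mem_Icc (hρ : ρ ∈ Ioo (0 : ℝ) 1) (hγ : 0 < γ) (hlam : 0 < lam) {t : ℝ}
    (ht : 0 ≤ t) : Afun ρ γ lam t ∈ Icc (0 : ℝ) 1 := by
  constructor
  · rw [Afun_eq]
    refine setIntegral_nonneg measurableSet_Ioi fun r hr => ?_
    have := dens_pos hρ hγ hlam hr
    have hr' : (0 : ℝ) < r := hr
    positivity
  · rw [Afun_eq_one_sub hρ hγ hlam ht]
    have := mul_nonneg hlam.le (conv_Bfun_one_nonneg hρ hγ hlam ht)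
    linarith

/-- A constant with `kapInt t ≤ kapConst * t ^ (1 - ρ)` for `0 < t ≤ T`. -/
def kapConst (ρ γ T : ℝ) : ℝ := T ^ ρ + γ / ((1 - ρ) * Real.Gamma (1 - ρ))

lemma kapConst_pos (hρ : ρ ∈ Ioo (0 : ℝ) 1) (hγ : 0 < γ) {T : ℝ} (hT : 0 < T) :
    0 < kapConst ρ γ T := by
  have hG : 0 < Real.Gamma (1 - ρ) := Real.Gamma_pos_of_pos (by linarith [hρ.2])
  have h1ρ : 0 < 1 - ρ := by linarith [hρ.2]
  unfold kapConst; positivity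

lemma kapInt_le (hρ : ρ ∈ Ioo (0 : ℝ) 1) {t T : ℝ} (ht : 0 < t) (htT : t ≤ T) :
    kapInt ρ γ t ≤ kapConst ρ γ T * t ^ (1 - ρ) := by
  have h1 : t = t ^ ρ * t ^ (1 - ρ) := by
    rw [← Real.rpow_add ht]; simp
  have h2 : t ^ ρ ≤ T ^ ρ := Real.rpow_le_rpow ht.le htT hρ.1.le
  have h3 : 0 < t ^ (1 - ρ) := Real.rpow_pos_of_pos ht _
  unfold kapInt kapConst
  have : t ≤ T ^ ρ * t ^ (1 - ρ) := h1.le.trans (mul_le_mul_of_nonneg_right h2 h3.le)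
  rw [add_mul]
  refine add_le_add this (le_of_eq ?_)
  ring

/-- `|B'(t)| ≤ C λ ^ ε t ^ (ε (1 - ρ) - 1)`. -/
lemma abs_Bfun_deriv_le_rpow (hρ : ρ ∈ Ioo (0 : ℝ) 1) (hγ : 0 < γ) (hlam : 0 < lam) {t T ε : ℝ}
    (ht : 0 < t) (htT : t ≤ T) (hε : ε ∈ Ioc (0 : ℝ) 1) :
    |deriv (Bfun ρ γ lam) t| ≤
      lam ^ ε * (2 * kapConst ρ γ T ^ ε * t ^ (ε * (1 - ρ) - 1)) := by
  have hT : 0 < T := ht.trans_le htT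
  have hC := kapConst_pos hρ hγ hT
  have hx0 : 0 ≤ 1 - Bfun ρ γ lam t := by linarith [Bfun_le_one hρ hγ hlam ht.le]
  have hx1 : 1 - Bfun ρ γ lam t ≤ 1 := by linarith [Bfun_nonneg hρ hγ hlam t]
  -- Interpolation between 1 - B ≤ 1 and 1 - B ≤ λ∫κ: passing to the power ε replaces λ by λ^ε and
  -- leaves the exponent of t above -1.
  have h1 : 1 - Bfun ρ γ lam t ≤ (1 - Bfun ρ γ lam t) ^ ε :=
    Real.self_le_rpow_of_le_one hx0 hx1 hε.2
  have h2 : (1 - Bfun ρ γ lam t) ^ ε ≤ (lam * (kapConst ρ γ T * t ^ (1 - ρ))) ^ ε :=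
    Real.rpow_le_rpow hx0 ((one_sub_Bfun_le hρ hγ hlam ht.le).trans
      (mul_le_mul_of_nonneg_left (kapInt_le hρ ht htT) hlam.le)) hε.1.le
  have h3 : 0 < t ^ (1 - ρ) := Real.rpow_pos_of_pos ht _
  rw [Real.mul_rpow hlam.le (by positivity), Real.mul_rpow hC.le h3.le, ← Real.rpow_mul ht.le] at h2
  calc _ ≤ 2 / t * (1 - Bfun ρ γ lam t) := abs_Bfun_deriv_le hρ hγ hlam ht
    _ ≤ 2 / t * (lam ^ ε * (kapConst ρ γ T ^ ε * t ^ ((1 - ρ) * ε))) :=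
      mul_le_mul_of_nonneg_left (h1.trans h2) (by positivity)
    _ = _ := by
      rw [Real.rpow_sub_one ht.ne', mul_comm (1 - ρ) ε]; ring

end Volterra

/-! ### Fundamental theorem of calculus on a closed interval. -/

section FTC

/-- The fundamental theorem of calculus on `[0, T]`, with one-sided derivatives at the ends. -/
theorem hasDerivWithinAt_integral_Icc {E : Type*} [NormedAddCommGroup E] [NormedSpace ℝ E]
    [CompleteSpace E] {h : ℝ → E} {T : ℝ} (hT : 0 ≤ T) (hh : ContinuousOn h (Icc 0 T)) {t : ℝ}
    (ht : t ∈ Icc 0 T) :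
    HasDerivWithinAt (fun t => ∫ s in (0 : ℝ)..t, h s) (h t) (Icc 0 T) t := by
  -- Constant extension past the endpoints makes the two-sided theorem applicable.
  have hc : Continuous (IccExtend hT ((Icc 0 T).domRestrict h)) :=
    (continuousOn_iff_continuous_domRestrict.1 hh).Icc_extend'
  have he : ∀ s ∈ Icc 0 T, IccExtend hT ((Icc 0 T).domRestrict h) s = h s := fun s hs => by
    rw [IccExtend_of_mem hT _ hs]; rfl
  have h1 := (hc.integral_hasStrictDerivAt 0 t).hasDerivAt.hasDerivWithinAt (s := Icc 0 T)
  rw [he t ht] at h1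
  have e : ∀ s ∈ Icc 0 T, ∫ x in (0 : ℝ)..s, h x =
      ∫ x in (0 : ℝ)..s, IccExtend hT ((Icc 0 T).domRestrict h) x := fun s hs => by
    refine intervalIntegral.integral_congr fun x hx => ?_
    rw [uIcc_of_le hs.1] at hx
    exact (he x ⟨hx.1, hx.2.trans hs.2⟩).symm
  exact h1.congr e (e t ht)

lemma eq_zero_of_integral_eq_zero {E : Type*} [NormedAddCommGroup E] [NormedSpace ℝ E]
    [CompleteSpace E] {h : ℝ → E} {T : ℝ} (hT : 0 < T) (hh : ContinuousOn h (Icc 0 T))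
    (h0 : ∀ t ∈ Icc 0 T, ∫ s in (0 : ℝ)..t, h s = 0) {t : ℝ} (ht : t ∈ Icc 0 T) : h t = 0 := by
  have h1 := hasDerivWithinAt_integral_Icc hT.le hh ht
  have h2 : HasDerivWithinAt (fun t => ∫ s in (0 : ℝ)..t, h s) 0 (Icc 0 T) t :=
    (hasDerivWithinAt_const t _ (0 : E)).congr h0 (h0 t ht)
  exact (uniqueDiffOn_Icc hT t ht).eq_deriv _ h1 h2

end FTC

/-! ### Linearity of the convolution. -/

section ConvLinear

variable {𝕜 : Type*} [RCLike 𝕜] {T : ℝ}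

lemma intervalIntegrable_conv {α β : ℝ → 𝕜} (hT : 0 ≤ T) (hα : IntegrableOn α (Ioc 0 T))
    (hβ : ContinuousOn β (Icc 0 T)) :
    IntervalIntegrable (fun τ => α τ * β (T - τ)) volume 0 T := by
  refine ((intervalIntegrable_iff_integrableOn_Ioc_of_le hT).2 hα).mul_continuousOn ?_
  rw [uIcc_of_le hT]
  exact hβ.comp (by fun_prop) fun x hx => ⟨by linarith [hx.2], by linarith [hx.1]⟩

lemma conv_add_left {α α' β : ℝ → 𝕜} (hT : 0 ≤ T) (hα : IntegrableOn α (Ioc 0 T))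
    (hα' : IntegrableOn α' (Ioc 0 T)) (hβ : ContinuousOn β (Icc 0 T)) :
    conv (fun t => α t + α' t) β T = conv α β T + conv α' β T := by
  unfold conv
  rw [← intervalIntegral.integral_add (intervalIntegrable_conv hT hα hβ)
    (intervalIntegrable_conv hT hα' hβ)]
  simp only [add_mul]

lemma conv_add_right {α β β' : ℝ → 𝕜} (hT : 0 ≤ T) (hα : IntegrableOn α (Ioc 0 T))
    (hβ : ContinuousOn β (Icc 0 T)) (hβ' : ContinuousOn β' (Icc 0 T)) :
    conv α (fun t => β t + β' t) T = conv α β T + conv α β' T := by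
  unfold conv
  rw [← intervalIntegral.integral_add (intervalIntegrable_conv hT hα hβ)
    (intervalIntegrable_conv hT hα hβ')]
  simp only [mul_add]

lemma conv_congr_right {α β β' : ℝ → 𝕜} (hT : 0 ≤ T) (h : ∀ t ∈ Icc 0 T, β t = β' t) :
    conv α β T = conv α β' T := by
  refine intervalIntegral.integral_congr fun τ hτ => ?_
  rw [uIcc_of_le hT] at hτ
  rw [h (T - τ) ⟨by linarith [hτ.2], by linarith [hτ.1]⟩]

lemma conv_const_mul_left (c : 𝕜) (α β : ℝ → 𝕜) (t : ℝ) :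
    conv (fun τ => c * α τ) β t = c * conv α β t := by
  unfold conv
  rw [← intervalIntegral.integral_const_mul]
  simp only [mul_assoc]

lemma conv_ofReal (α β : ℝ → ℝ) (t : ℝ) :
    conv (fun τ => (α τ : 𝕜)) (fun τ => (β τ : 𝕜)) t = ((conv α β t : ℝ) : 𝕜) := by
  unfold conv
  rw [← RCLike.intervalIntegral_ofReal]
  simp

end ConvLinear

/-! ### The scalar equation: uniqueness and existence by the resolvent. -/

section Scalar

variable {𝕜 : Type*} [RCLike 𝕜] {ρ γ lam : ℝ} {T : ℝ}

lemma integrableOn_ofReal_kap (hρ : ρ ∈ Ioo (0 : ℝ) 1) (hT : 0 ≤ T) :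
    IntegrableOn (fun t => (kap ρ γ lam t : 𝕜)) (Ioc 0 T) :=
  (integrableOn_kap hρ hT).ofReal

lemma continuousOn_ofReal_Bfun (hρ : ρ ∈ Ioo (0 : ℝ) 1) (hγ : 0 < γ) (hlam : 0 < lam) :
    ContinuousOn (fun t => (Bfun ρ γ lam t : 𝕜)) (Icc 0 T) :=
  RCLike.continuous_ofReal.comp_continuousOn
    ((Bfun_continuousOn hρ hγ hlam).mono fun _ hx => hx.1)

lemma integrableOn_ofReal_Bfun (hρ : ρ ∈ Ioo (0 : ℝ) 1) (hγ : 0 < γ) (hlam : 0 < lam) :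
    IntegrableOn (fun t => (Bfun ρ γ lam t : 𝕜)) (Ioc 0 T) :=
  (Bfun_integrableOn hρ hγ hlam T).ofReal

lemma resolvent_equation' (hρ : ρ ∈ Ioo (0 : ℝ) 1) (hγ : 0 < γ) (hlam : 0 < lam) {t : ℝ}
    (ht : 0 ≤ t) : (Bfun ρ γ lam t : 𝕜) +
      conv (fun τ => (kap ρ γ lam τ : 𝕜)) (fun τ => (Bfun ρ γ lam τ : 𝕜)) t = 1 := by
  rw [conv_ofReal]
  exact_mod_cast congrArg (fun x : ℝ => (x : 𝕜)) (resolvent_equation hρ hγ hlam ht)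

lemma ofReal_Afun (hρ : ρ ∈ Ioo (0 : ℝ) 1) (hγ : 0 < γ) (hlam : 0 < lam) {t : ℝ} (ht : 0 ≤ t) :
    (Afun ρ γ lam t : 𝕜) = 1 - lam * ∫ τ in (0 : ℝ)..t, (Bfun ρ γ lam τ : 𝕜) := by
  rw [Afun_eq_one_sub hρ hγ hlam ht, RCLike.intervalIntegral_ofReal]
  push_cast; rfl

/-- Every solution of the scalar equation is given by the resolvent formula. -/
theorem scalar_solution_formula (hρ : ρ ∈ Ioo (0 : ℝ) 1) (hγ : 0 < γ) (hlam : 0 < lam)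
    (hT : 0 ≤ T) {g f : ℝ → 𝕜} (c : 𝕜) (hg : IntegrableOn g (Ioc 0 T))
    (heq : ∀ᵐ t ∂(volume.restrict (Ioc 0 T)),
      g t + conv (fun τ => (kap ρ γ lam τ : 𝕜)) g t = f t - lam * c)
    (hf : IntegrableOn f (Ioc 0 T)) :
    c + ∫ τ in (0 : ℝ)..T, g τ =
      c * Afun ρ γ lam T + conv (fun τ => (Bfun ρ γ lam τ : 𝕜)) f T := by
  set B : ℝ → 𝕜 := fun τ => (Bfun ρ γ lam τ : 𝕜) with hB
  set κ : ℝ → 𝕜 := fun τ => (kap ρ γ lam τ : 𝕜) with hκ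
  have hBc : ContinuousOn B (Icc 0 T) := continuousOn_ofReal_Bfun hρ hγ hlam
  have hκi : IntegrableOn κ (Ioc 0 T) := integrableOn_ofReal_kap hρ hT
  have hci : IntegrableOn (fun _ : ℝ => (1 : 𝕜)) (Ioc 0 T) := by simp
  -- Writing 1 = B + κ * B and reassociating brings κ onto g, so that g * 1 = B * (g + κ * g), and
  -- the equation can be inserted.
  have h1 : conv g (fun _ => 1) T = conv g B T + conv (conv κ g) B T := by
    have e : conv κ g = conv g κ := funext fun t => conv_comm κ g t
    rw [e, conv_assoc hT hg hκi hBc, ← conv_add_right hT hg hBc (continuousOn_conv hκi hBc)]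
    exact conv_congr_right hT fun t ht => (resolvent_equation' hρ hγ hlam ht.1).symm
  have h2 : conv g B T + conv (conv κ g) B T = conv f B T + conv (fun _ => -(lam * c) * 1) B T := by
    rw [← conv_add_left hT hg (integrableOn_conv hκi hg) hBc,
      ← conv_add_left hT hf (hci.const_mul _) hBc]
    exact conv_congr_left B hT (heq.mono fun t ht => by rw [ht]; ring)
  rw [conv_const_mul_left, conv_comm (fun _ => (1 : 𝕜)) B, conv_one, conv_comm f B] at h2
  rw [conv_one] at h1
  rw [h1, h2, ofReal_Afun hρ hγ hlam hT]
  ring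

/-- The case ε = 1 of the derivative bound, with majorant a multiple of t^(-ρ). -/
lemma integrableOn_Bfun_deriv (hρ : ρ ∈ Ioo (0 : ℝ) 1) (hγ : 0 < γ) (hlam : 0 < lam) (T : ℝ) :
    IntegrableOn (deriv (Bfun ρ γ lam)) (Ioc 0 T) := by
  have h1ρ : 0 < 1 - ρ := by linarith [hρ.2]
  rcases le_or_gt T 0 with hT | hT
  · simp [Ioc_eq_empty_of_le hT]
  have hi : IntegrableOn (fun t : ℝ => t ^ (1 * (1 - ρ) - 1)) (Ioc 0 T) :=
    (intervalIntegrable_iff_integrableOn_Ioc_of_le hT.le).1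
      (intervalIntegral.intervalIntegrable_rpow' (by linarith))
  refine ((hi.const_mul (2 * kapConst ρ γ T ^ (1 : ℝ))).const_mul (lam ^ (1 : ℝ))).mono'
    (((Bfun_deriv_continuousOn hρ hγ hlam).mono Ioc_subset_Ioi_self).aestronglyMeasurable
      measurableSet_Ioc) ?_
  filter_upwards [ae_restrict_mem measurableSet_Ioc] with t ht
  exact abs_Bfun_deriv_le_rpow hρ hγ hlam ht.1 ht.2 ⟨one_pos, le_rfl⟩

lemma integral_Bfun_deriv (hρ : ρ ∈ Ioo (0 : ℝ) 1) (hγ : 0 < γ) (hlam : 0 < lam) {t : ℝ}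
    (ht : 0 ≤ t) : ∫ τ in (0 : ℝ)..t, deriv (Bfun ρ γ lam) τ = Bfun ρ γ lam t - 1 := by
  rw [← Bfun_zero hρ hγ hlam]
  exact intervalIntegral.integral_eq_sub_of_hasDerivAt_of_le ht
    ((Bfun_continuousOn hρ hγ hlam).mono fun _ hx => hx.1)
    (fun x hx => Bfun_hasDerivAt hρ hγ hlam hx.1)
    ((intervalIntegrable_iff_integrableOn_Ioc_of_le ht).2 (integrableOn_Bfun_deriv hρ hγ hlam t))

/-- The derivative of the solution with data `c` and `f`. -/
def scalarDeriv (ρ γ lam : ℝ) (c : 𝕜) (f : ℝ → 𝕜) (t : ℝ) : 𝕜 :=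
  f t + conv (fun τ => ((deriv (Bfun ρ γ lam) τ : ℝ) : 𝕜)) f t - lam * c * Bfun ρ γ lam t

lemma continuousOn_scalarDeriv (hρ : ρ ∈ Ioo (0 : ℝ) 1) (hγ : 0 < γ) (hlam : 0 < lam) {c : 𝕜}
    {f : ℝ → 𝕜} (hf : ContinuousOn f (Icc 0 T)) :
    ContinuousOn (scalarDeriv ρ γ lam c f) (Icc 0 T) :=
  (hf.add (continuousOn_conv (integrableOn_Bfun_deriv hρ hγ hlam T).ofReal hf)).sub
    (continuousOn_const.mul (continuousOn_ofReal_Bfun hρ hγ hlam))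

/-- Because ∫₀ᵗ B' = B(t) - 1, the primitive of f + B' * f is B * f. -/
lemma integral_scalarDeriv (hρ : ρ ∈ Ioo (0 : ℝ) 1) (hγ : 0 < γ) (hlam : 0 < lam) {c : 𝕜}
    {f : ℝ → 𝕜} (hT : 0 ≤ T) (hf : ContinuousOn f (Icc 0 T)) :
    ∫ t in (0 : ℝ)..T, scalarDeriv ρ γ lam c f t =
      conv (fun τ => (Bfun ρ γ lam τ : 𝕜)) f T - lam * c * ∫ t in (0 : ℝ)..T,
        (Bfun ρ γ lam t : 𝕜) := by
  set D : ℝ → 𝕜 := fun τ => ((deriv (Bfun ρ γ lam) τ : ℝ) : 𝕜) with hD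
  have hDi : IntegrableOn D (Ioc 0 T) := (integrableOn_Bfun_deriv hρ hγ hlam T).ofReal
  have hfi : IntegrableOn f (Ioc 0 T) := hf.integrableOn_Icc.mono_set Ioc_subset_Icc_self
  have ii : ∀ {g : ℝ → 𝕜}, IntegrableOn g (Ioc 0 T) → IntervalIntegrable g volume 0 T :=
    fun h => (intervalIntegrable_iff_integrableOn_Ioc_of_le hT).2 h
  have hBi := ii (integrableOn_ofReal_Bfun (𝕜 := 𝕜) (T := T) hρ hγ hlam)
  unfold scalarDeriv
  rw [intervalIntegral.integral_sub ((ii hfi).add (ii (integrableOn_conv hDi hfi)))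
    (hBi.const_mul _), intervalIntegral.integral_add (ii hfi) (ii (integrableOn_conv hDi hfi)),
    intervalIntegral.integral_const_mul]
  congr 1
  have e : conv D f = conv f D := funext fun t => conv_comm D f t
  rw [← conv_one, ← conv_one, e, conv_assoc hT hfi hDi continuousOn_const,
    ← conv_add_right hT hfi continuousOn_const (continuousOn_conv hDi continuousOn_const),
    conv_comm _ f]
  refine conv_congr_right hT fun t ht => ?_
  rw [conv_one, hD, RCLike.intervalIntegral_ofReal, integral_Bfun_deriv hρ hγ hlam ht.1]
  push_cast; ring

/-- The scalar equation holds for the resolvent formula. -/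
theorem scalarDeriv_equation (hρ : ρ ∈ Ioo (0 : ℝ) 1) (hγ : 0 < γ) (hlam : 0 < lam) {c : 𝕜}
    {f : ℝ → 𝕜} (hT : 0 < T) (hf : ContinuousOn f (Icc 0 T)) {t : ℝ} (ht : t ∈ Icc 0 T) :
    scalarDeriv ρ γ lam c f t +
      conv (fun τ => (kap ρ γ lam τ : 𝕜)) (scalarDeriv ρ γ lam c f) t = f t - lam * c := by
  set B : ℝ → 𝕜 := fun τ => (Bfun ρ γ lam τ : 𝕜) with hB
  set κ : ℝ → 𝕜 := fun τ => (kap ρ γ lam τ : 𝕜) with hκ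
  set h := scalarDeriv ρ γ lam c f with hh
  have hhc : ContinuousOn h (Icc 0 T) := continuousOn_scalarDeriv hρ hγ hlam hf
  have hκi : ∀ t, 0 ≤ t → IntegrableOn κ (Ioc 0 t) := fun t ht => integrableOn_ofReal_kap hρ ht
  have hqc : ContinuousOn (fun t => h t + conv κ h t - (f t - lam * c)) (Icc 0 T) :=
    (hhc.add (continuousOn_conv (hκi T hT.le) hhc)).sub (hf.sub continuousOn_const)
  -- By continuity the integrated equation suffices. The primitive of h is B * f - λc(B * 1), and
  -- convolving B + κ * B = 1 with f and with 1 closes it.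
  refine sub_eq_zero.1 (eq_zero_of_integral_eq_zero hT hqc (fun s hs => ?_) ht)
  have hsub : Icc 0 s ⊆ Icc 0 T := Icc_subset_Icc_right hs.2
  have hfs := hf.mono hsub
  have hhs := hhc.mono hsub
  have hBs : ContinuousOn B (Icc 0 s) := continuousOn_ofReal_Bfun hρ hγ hlam
  have io : ∀ {g : ℝ → 𝕜}, ContinuousOn g (Icc 0 s) → IntegrableOn g (Ioc 0 s) :=
    fun h => h.integrableOn_Icc.mono_set Ioc_subset_Icc_self
  have ii : ∀ {g : ℝ → 𝕜}, IntegrableOn g (Ioc 0 s) → IntervalIntegrable g volume 0 s :=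
    fun h => (intervalIntegrable_iff_integrableOn_Ioc_of_le hs.1).2 h
  have hck := integrableOn_conv (hκi s hs.1) (io hhs)
  have h1 : (∫ t in (0 : ℝ)..s, (h t + conv κ h t - (f t - lam * c))) =
      conv h (fun _ => 1) s + conv (conv κ h) (fun _ => 1) s - (conv f (fun _ => 1) s
        - lam * c * s) := by
    rw [intervalIntegral.integral_sub ((ii (io hhs)).add (ii hck))
      ((ii (io hfs)).sub (by simp)), intervalIntegral.integral_add (ii (io hhs)) (ii hck),
      intervalIntegral.integral_sub (ii (io hfs)) (by simp), conv_one, conv_one, conv_one]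
    simp only [intervalIntegral.integral_const, sub_zero, RCLike.real_smul_eq_coe_mul]
    ring
  have h2 : ∀ r ∈ Icc 0 s, conv h (fun _ => 1) r = conv B f r + -(lam * c) * conv B (fun _ => 1) r := by
    intro r hr
    rw [conv_one, conv_one, hh, integral_scalarDeriv hρ hγ hlam hr.1
      (hfs.mono (Icc_subset_Icc_right hr.2))]
    ring
  have hBf : ContinuousOn (conv B f) (Icc 0 s) := continuousOn_conv (io hBs) hfs
  have hB1 : ContinuousOn (conv B fun _ => 1) (Icc 0 s) :=
    continuousOn_conv (io hBs) continuousOn_const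
  have hκB : IntegrableOn (conv κ B) (Ioc 0 s) := integrableOn_conv (hκi s hs.1) (io hBs)
  have h3 : ∀ g : ℝ → 𝕜, ContinuousOn g (Icc 0 s) →
      conv B g s + conv κ (conv B g) s = conv g (fun _ => 1) s := by
    intro g hg
    rw [← conv_assoc hs.1 (hκi s hs.1) (io hBs) hg, ← conv_add_left hs.1 (io hBs) hκB hg,
      conv_comm g]
    refine conv_congr_left _ hs.1 ?_
    filter_upwards [ae_restrict_mem measurableSet_Ioc] with τ hτ
    exact resolvent_equation' hρ hγ hlam hτ.1.le
  have h4 : conv (conv κ h) (fun _ => 1) s =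
      conv κ (conv B f) s + -(lam * c) * conv κ (conv B fun _ => 1) s := by
    have hcB : ContinuousOn (fun t => -(lam * c) * conv B (fun _ => 1) t) (Icc 0 s) :=
      continuousOn_const.mul hB1
    rw [conv_assoc hs.1 (hκi s hs.1) (io hhs) continuousOn_const, conv_congr_right hs.1 h2,
      conv_add_right hs.1 (hκi s hs.1) hBf hcB, conv_comm κ (fun t => -(lam * c) * conv B (fun _ => 1) t),
      conv_const_mul_left, conv_comm _ κ]
  have h5 := h3 f hfs
  have h6 := h3 (fun _ => 1) continuousOn_const
  have h7 : conv (fun _ => (1 : 𝕜)) (fun _ => 1) s = s := by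
    rw [conv_one]; simp [RCLike.real_smul_eq_coe_mul]
  rw [h7] at h6
  rw [h1, h2 s ⟨hs.1, le_rfl⟩, h4, ← h5]
  linear_combination (-(lam : 𝕜) * c) * h6

end Scalar

/-! ### Diagonal operators and convolutions with diagonal kernels. -/

section Diagonal

variable {𝕜 : Type*} [RCLike 𝕜] {H : Type*} [NormedAddCommGroup H] [InnerProductSpace 𝕜 H]
  (v : HilbertBasis ℕ 𝕜 H)

lemma hasSum_norm_inner_sq (x : H) : HasSum (fun k => ‖inner 𝕜 (v k) x‖ ^ 2) (‖x‖ ^ 2) := by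
  have h := RCLike.hasSum_re 𝕜 (v.hasSum_inner_mul_inner x x)
  rw [inner_self_eq_norm_sq] at h
  refine h.congr_fun fun k => ?_
  rw [← inner_conj_symm x (v k), RCLike.conj_mul]
  norm_cast

lemma ext_inner_basis {x y : H} (h : ∀ k, inner 𝕜 (v k) x = inner 𝕜 (v k) y) : x = y := by
  have h1 := hasSum_norm_inner_sq v (x - y)
  simp only [inner_sub_right, h, sub_self, norm_zero, ne_eq, OfNat.ofNat_ne_zero,
    not_false_eq_true, zero_pow] at h1
  have := h1.unique hasSum_zero
  exact sub_eq_zero.1 (norm_eq_zero.1 (pow_eq_zero_iff two_ne_zero |>.1 this))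

lemma norm_le_of_inner_le {x y : H} {c : ℝ} (hc : 0 ≤ c)
    (h : ∀ k, ‖inner 𝕜 (v k) x‖ ≤ c * ‖inner 𝕜 (v k) y‖) : ‖x‖ ≤ c * ‖y‖ := by
  have h1 : ‖x‖ ^ 2 ≤ c ^ 2 * ‖y‖ ^ 2 :=
    hasSum_le (fun k => by rw [← mul_pow]; exact pow_le_pow_left₀ (norm_nonneg _) (h k) 2)
      (hasSum_norm_inner_sq v x) ((hasSum_norm_inner_sq v y).mul_left _)
  rw [← mul_pow] at h1
  exact le_of_sq_le_sq h1 (by positivity)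

lemma exists_inner_eq [CompleteSpace H] {a : ℕ → 𝕜} (ha : Summable fun k => ‖a k‖ ^ 2) :
    ∃ y : H, ∀ k, inner 𝕜 (v k) y = a k := by
  have hm : Memℓp a 2 := memℓp_gen (by simpa using ha)
  refine ⟨v.repr.symm ⟨a, hm⟩, fun k => ?_⟩
  rw [← v.repr_apply_apply, LinearIsometryEquiv.apply_symm_apply]

/-- The operator acting on the basis `v` by the multipliers `m`. -/
def diagMul (m : ℕ → ℝ) (x : H) : H := ∑' k, ((m k : 𝕜) * inner 𝕜 (v k) x) • v k

variable [CompleteSpace H] {v}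

/-- Bounded multipliers preserve square summability, so the `tsum` in `diagMul` is a genuine sum and
not the default value 0. -/
lemma inner_diagMul {m : ℕ → ℝ} {c : ℝ} (hm : ∀ k, |m k| ≤ c) (x : H) (k : ℕ) :
    inner 𝕜 (v k) (diagMul v m x) = m k * inner 𝕜 (v k) x := by
  have hs : Summable fun k => ‖(m k : 𝕜) * inner 𝕜 (v k) x‖ ^ 2 := by
    refine Summable.of_nonneg_of_le (fun k => by positivity) (fun k => ?_)
      ((hasSum_norm_inner_sq v x).summable.mul_left (c ^ 2))
    rw [norm_mul, mul_pow, RCLike.norm_ofReal]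
    exact mul_le_mul_of_nonneg_right (pow_le_pow_left₀ (abs_nonneg _) (hm k) 2) (by positivity)
  obtain ⟨y, hy⟩ := exists_inner_eq v hs
  have : diagMul v m x = y := by
    rw [diagMul, ← (v.hasSum_repr y).tsum_eq]
    simp only [v.repr_apply_apply, hy]
  rw [this, hy]

lemma norm_diagMul_le {m : ℕ → ℝ} {c : ℝ} (hm : ∀ k, |m k| ≤ c) (x : H) :
    ‖diagMul v m x‖ ≤ c * ‖x‖ :=
  norm_le_of_inner_le v ((abs_nonneg _).trans (hm 0)) fun k => by
    rw [inner_diagMul hm, norm_mul, RCLike.norm_ofReal]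
    exact mul_le_mul_of_nonneg_right (hm k) (norm_nonneg _)

/-- Strongly continuous families of diagonal operators are jointly continuous. -/
lemma continuousOn_diagMul {m : ℝ → ℕ → ℝ} {κ : ℝ → ℝ} {S : Set ℝ} {x : ℝ → H}
    (hmc : ∀ k, ContinuousOn (fun σ => m σ k) S) (hκ : ContinuousOn κ S)
    (hm : ∀ σ ∈ S, ∀ k, |m σ k| ≤ κ σ) (hx : ContinuousOn x S) :
    ContinuousOn (fun σ => diagMul v (m σ) (x σ)) S := by
  intro σ₀ hσ₀
  have hκ0 : 0 ≤ κ σ₀ := (abs_nonneg _).trans (hm σ₀ hσ₀ 0)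
  have hev : ∀ᶠ σ in 𝓝[S] σ₀, κ σ ≤ κ σ₀ + 1 :=
    (hκ σ₀ hσ₀).eventually (eventually_le_nhds (by linarith))
  -- For a fixed vector the limit is taken inside Parseval's sum by dominated convergence. The
  -- variation of the vector is handled afterwards by the local operator bound κ(σ₀) + 1.
  have h1 : Tendsto (fun σ => ‖diagMul v (m σ) (x σ₀) - diagMul v (m σ₀) (x σ₀)‖ ^ 2)
      (𝓝[S] σ₀) (𝓝 0) := by
    have hsum : Tendsto (fun σ => ∑' k, |m σ k - m σ₀ k| ^ 2 * ‖inner 𝕜 (v k) (x σ₀)‖ ^ 2)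
        (𝓝[S] σ₀) (𝓝 (∑' k : ℕ, (0 : ℝ))) := by
      refine tendsto_tsum_of_dominated_convergence
        (bound := fun k => (κ σ₀ + 1 + κ σ₀) ^ 2 * ‖inner 𝕜 (v k) (x σ₀)‖ ^ 2)
        ((hasSum_norm_inner_sq v (x σ₀)).summable.mul_left _) (fun k => ?_) ?_
      · have := (((hmc k σ₀ hσ₀).sub_const (m σ₀ k)).abs.pow 2).mul_const
          (‖inner 𝕜 (v k) (x σ₀)‖ ^ 2)
        simpa [ContinuousWithinAt] using this
      · filter_upwards [hev, self_mem_nhdsWithin] with σ h1 h2 k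
        rw [Real.norm_of_nonneg (by positivity)]
        refine mul_le_mul_of_nonneg_right (pow_le_pow_left₀ (abs_nonneg _) ?_ 2) (by positivity)
        exact (abs_sub _ _).trans (add_le_add ((hm σ h2 k).trans h1) (hm σ₀ hσ₀ k))
    rw [tsum_zero] at hsum
    refine hsum.congr' ?_
    filter_upwards [self_mem_nhdsWithin] with σ hσ
    rw [← (hasSum_norm_inner_sq v _).tsum_eq]
    refine tsum_congr fun k => ?_
    rw [inner_sub_right, inner_diagMul (hm σ hσ), inner_diagMul (hm σ₀ hσ₀), ← sub_mul,
      norm_mul, mul_pow, ← RCLike.ofReal_sub, RCLike.norm_ofReal]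
  have h1' : Tendsto (fun σ => ‖diagMul v (m σ) (x σ₀) - diagMul v (m σ₀) (x σ₀)‖)
      (𝓝[S] σ₀) (𝓝 0) := by
    have := (Real.continuous_sqrt.tendsto 0).comp h1
    simpa [Function.comp_def] using this
  have h2 : Tendsto (fun σ => (κ σ₀ + 1) * ‖x σ - x σ₀‖) (𝓝[S] σ₀) (𝓝 0) := by
    have := ((hx σ₀ hσ₀).sub_const (x σ₀)).norm.const_mul (κ σ₀ + 1)
    simpa [ContinuousWithinAt] using this
  rw [ContinuousWithinAt, tendsto_iff_norm_sub_tendsto_zero]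
  have h3 := h2.add h1'
  rw [add_zero] at h3
  refine squeeze_zero' (Eventually.of_forall fun _ => norm_nonneg _) ?_ h3
  filter_upwards [hev, self_mem_nhdsWithin] with σ h4 hσ
  have e : diagMul v (m σ) (x σ) - diagMul v (m σ) (x σ₀) = diagMul v (m σ) (x σ - x σ₀) :=
    ext_inner_basis v fun k => by
      rw [inner_sub_right, inner_diagMul (hm σ hσ), inner_diagMul (hm σ hσ),
        inner_diagMul (hm σ hσ), inner_sub_right, mul_sub]
  calc ‖diagMul v (m σ) (x σ) - diagMul v (m σ₀) (x σ₀)‖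
      ≤ ‖diagMul v (m σ) (x σ) - diagMul v (m σ) (x σ₀)‖ +
        ‖diagMul v (m σ) (x σ₀) - diagMul v (m σ₀) (x σ₀)‖ := norm_sub_le_norm_sub_add_norm_sub ..
    _ ≤ _ := by
      rw [e]
      gcongr
      exact (norm_diagMul_le (hm σ hσ) _).trans (mul_le_mul_of_nonneg_right h4 (norm_nonneg _))

variable {T : ℝ}

/-- The families of multipliers for which `diagConv` is well behaved on `[0, T]`. -/
structure IsDiagKernel (m : ℝ → ℕ → ℝ) (κ : ℝ → ℝ) (T : ℝ) : Prop where
  continuousOn : ∀ k, ContinuousOn (fun σ => m σ k) (Ioc 0 T)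
  bound_continuousOn : ContinuousOn κ (Ioc 0 T)
  bound_integrableOn : IntegrableOn κ (Ioc 0 T)
  bound : ∀ σ ∈ Ioc 0 T, ∀ k, |m σ k| ≤ κ σ

variable {m : ℝ → ℕ → ℝ} {κ : ℝ → ℝ} {g : ℝ → H}

namespace IsDiagKernel

lemma continuousOn_integrand (hm : IsDiagKernel m κ T) (hg : ContinuousOn g (Icc 0 T)) {t : ℝ}
    (ht : t ∈ Icc 0 T) :
    ContinuousOn (fun σ => diagMul v (m σ) (g (t - σ))) (Ioc 0 t) := by
  have hsub : Ioc 0 t ⊆ Ioc 0 T := Ioc_subset_Ioc_right ht.2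
  refine continuousOn_diagMul (fun k => (hm.continuousOn k).mono hsub)
    (hm.bound_continuousOn.mono hsub) (fun σ hσ => hm.bound σ (hsub hσ)) ?_
  exact hg.comp (by fun_prop) fun σ hσ => ⟨by linarith [hσ.2], by linarith [hσ.1, ht.2]⟩

lemma norm_integrand_le (hm : IsDiagKernel m κ T) {M : ℝ} (hM : ∀ s ∈ Icc 0 T, ‖g s‖ ≤ M)
    {t : ℝ} (ht : t ∈ Icc 0 T) {σ : ℝ} (hσ : σ ∈ Ioc 0 t) :
    ‖diagMul v (m σ) (g (t - σ))‖ ≤ κ σ * M := by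
  have hσT : σ ∈ Ioc 0 T := ⟨hσ.1, hσ.2.trans ht.2⟩
  refine (norm_diagMul_le (hm.bound σ hσT) _).trans (mul_le_mul_of_nonneg_left
    (hM _ ⟨by linarith [hσ.2], by linarith [hσ.1, ht.2]⟩)
    ((abs_nonneg _).trans (hm.bound σ hσT 0)))

lemma integrableOn_integrand (hm : IsDiagKernel m κ T) (hg : ContinuousOn g (Icc 0 T)) {t : ℝ}
    (ht : t ∈ Icc 0 T) :
    IntegrableOn (fun σ => diagMul v (m σ) (g (t - σ))) (Ioc 0 t) := by
  obtain ⟨M, hM⟩ := isCompact_Icc.exists_bound_of_continuousOn hg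
  refine ((hm.bound_integrableOn.mono_set (Ioc_subset_Ioc_right ht.2)).mul_const M).mono'
    ((hm.continuousOn_integrand hg ht).aestronglyMeasurable measurableSet_Ioc) ?_
  filter_upwards [ae_restrict_mem measurableSet_Ioc] with σ hσ
  exact hm.norm_integrand_le hM ht hσ

end IsDiagKernel

variable [NormedSpace ℝ H]

variable (v) in
/-- The convolution of a family of diagonal operators with a vector-valued function. -/
def diagConv (m : ℝ → ℕ → ℝ) (g : ℝ → H) (t : ℝ) : H :=
  ∫ σ in (0 : ℝ)..t, diagMul v (m σ) (g (t - σ))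

namespace IsDiagKernel

lemma continuousOn_diagConv (hm : IsDiagKernel m κ T) (hg : ContinuousOn g (Icc 0 T)) :
    ContinuousOn (diagConv v m g) (Icc 0 T) := by
  obtain ⟨M, hM⟩ := isCompact_Icc.exists_bound_of_continuousOn hg
  refine continuousOn_integral_kernel (F := fun σ t => diagMul v (m σ) (g (t - σ)))
    (κ := fun σ => κ σ * M) (hm.bound_integrableOn.mul_const M)
    (fun t ht => (hm.integrableOn_integrand hg ht).1)
    (fun t ht σ hσ => hm.norm_integrand_le hM ht hσ) fun σ hσ => ?_
  refine continuousOn_diagMul (m := fun _ => m σ) (κ := fun _ => κ σ)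
    (fun _ => continuousOn_const) continuousOn_const (fun _ _ => hm.bound σ hσ) ?_
  exact hg.comp (by fun_prop) fun t ht => ⟨by linarith [ht.1], by linarith [hσ.1, ht.2]⟩

lemma inner_diagConv (hm : IsDiagKernel m κ T) (hg : ContinuousOn g (Icc 0 T)) {t : ℝ}
    (ht : t ∈ Icc 0 T) (k : ℕ) :
    inner 𝕜 (v k) (diagConv v m g t) =
      conv (fun σ => (m σ k : 𝕜)) (fun τ => inner 𝕜 (v k) (g τ)) t := by
  have h := (innerSL 𝕜 (v k)).integral_comp_comm (hm.integrableOn_integrand (v := v) hg ht)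
  simp only [innerSL_apply_apply] at h
  rw [diagConv, conv, intervalIntegral.integral_of_le ht.1, intervalIntegral.integral_of_le ht.1,
    ← h]
  refine setIntegral_congr_fun measurableSet_Ioc fun σ hσ => ?_
  exact inner_diagMul (hm.bound σ ⟨hσ.1, hσ.2.trans ht.2⟩) _ k

lemma norm_diagConv_le (hm : IsDiagKernel m κ T) {M : ℝ} (hM : ∀ s ∈ Icc 0 T, ‖g s‖ ≤ M)
    {t : ℝ} (ht : t ∈ Icc 0 T) : ‖diagConv v m g t‖ ≤ (∫ σ in Ioc 0 T, κ σ) * M := by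
  have hM0 : 0 ≤ M := (norm_nonneg _).trans (hM t ht)
  have hsub : Ioc 0 t ⊆ Ioc 0 T := Ioc_subset_Ioc_right ht.2
  rw [diagConv, intervalIntegral.integral_of_le ht.1]
  calc _ ≤ ∫ σ in Ioc 0 t, κ σ * M :=
        norm_integral_le_of_norm_le ((hm.bound_integrableOn.mono_set hsub).mul_const M)
          ((ae_restrict_mem measurableSet_Ioc).mono fun σ hσ => hm.norm_integrand_le hM ht hσ)
    _ ≤ ∫ σ in Ioc 0 T, κ σ * M := by
        refine setIntegral_mono_set (hm.bound_integrableOn.mul_const M) ?_ hsub.eventuallyLE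
        filter_upwards [ae_restrict_mem measurableSet_Ioc] with σ hσ
        exact mul_nonneg ((abs_nonneg _).trans (hm.bound σ hσ 0)) hM0
    _ = _ := integral_mul_const _ _

end IsDiagKernel

end Diagonal

/-! ### The operator and its powers in terms of Fourier coefficients. -/

section Operators

variable {𝕜 : Type*} [RCLike 𝕜] {H : Type*} [NormedAddCommGroup H] [InnerProductSpace 𝕜 H]
  {v : HilbertBasis ℕ 𝕜 H} {lam : ℕ → ℝ}

lemma powNorm_eq_norm {τ : ℝ} (hpos : ∀ k, 0 < lam k) {x y : H}
    (h : ∀ k, inner 𝕜 (v k) y = (lam k ^ τ : ℝ) * inner 𝕜 (v k) x) : powNorm v lam τ x = ‖y‖ := by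
  rw [powNorm, ← Real.sqrt_sq (norm_nonneg y), ← (hasSum_norm_inner_sq v y).tsum_eq]
  congr 1
  refine tsum_congr fun k => ?_
  rw [h, norm_mul, mul_pow, RCLike.norm_ofReal, sq_abs, ← Real.rpow_mul_natCast (hpos k).le]
  norm_num [mul_comm]

variable [CompleteSpace H] {A : H →ₗ.[𝕜] H}

lemma IsSpectral.inner_opVal (hA : IsSpectral A v lam) {x : H} (hx : x ∈ A.domain) (k : ℕ) :
    inner 𝕜 (v k) (opVal A x) = lam k * inner 𝕜 (v k) x := by
  obtain ⟨hk, he⟩ := hA.eigen k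
  have hsa : LinearPMap.adjoint A = A := LinearPMap.isSelfAdjoint_def.1 hA.selfAdjoint
  have hfa : A.IsFormalAdjoint A := by
    have := LinearPMap.adjoint_isFormalAdjoint hA.selfAdjoint.dense_domain
    rwa [hsa] at this
  have h := hfa ⟨v k, hk⟩ ⟨x, hx⟩
  rw [he] at h
  rw [opVal, dif_pos hx, ← h, inner_smul_left, RCLike.conj_ofReal]

/-- By Parseval, ⟨y, z⟩ = ⟨x, Az⟩ for all z in the domain, so x lies in the domain of the adjoint,
which is A. Membership in D(A) thus becomes a check on coefficients. -/
lemma IsSpectral.mem_domain_and_opVal_eq (hA : IsSpectral A v lam) {x y : H}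
    (h : ∀ k, inner 𝕜 (v k) y = lam k * inner 𝕜 (v k) x) : x ∈ A.domain ∧ opVal A x = y := by
  have hsa : LinearPMap.adjoint A = A := LinearPMap.isSelfAdjoint_def.1 hA.selfAdjoint
  have hx : x ∈ A.domain := by
    have : x ∈ (LinearPMap.adjoint A).domain := by
      refine LinearPMap.mem_adjoint_domain_of_exists _ ⟨y, fun z => ?_⟩
      rw [← (v.hasSum_inner_mul_inner y (z : H)).tsum_eq, ← (v.hasSum_inner_mul_inner x _).tsum_eq]
      refine tsum_congr fun k => ?_
      have h1 := hA.inner_opVal z.2 k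
      rw [opVal, dif_pos z.2] at h1
      rw [h1, ← inner_conj_symm y, h k, map_mul, RCLike.conj_ofReal, inner_conj_symm]
      ring
    rwa [hsa] at this
  exact ⟨hx, ext_inner_basis v fun k => by rw [hA.inner_opVal hx, h]⟩

lemma IsSpectral.powNorm_one (hA : IsSpectral A v lam) {x : H} (hx : x ∈ A.domain) :
    powNorm v lam 1 x = ‖opVal A x‖ := by
  rw [powNorm, ← Real.sqrt_sq (norm_nonneg (opVal A x)),
    ← (hasSum_norm_inner_sq v (opVal A x)).tsum_eq]
  congr 1
  refine tsum_congr fun k => ?_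
  rw [hA.inner_opVal hx, norm_mul, mul_pow, RCLike.norm_ofReal, sq_abs, mul_one]
  norm_num

/-- The `D(A^τ)`-valued function `f` as `A^(-τ)` of a continuous `H`-valued function. -/
lemma ContinuousInPow.exists_continuousOn (hA : IsSpectral A v lam) {τ T : ℝ} (hτ : 0 ≤ τ)
    {f : ℝ → H} (hf : ContinuousInPow v lam τ T f) :
    ∃ g : ℝ → H, ContinuousOn g (Icc 0 T) ∧ (∀ t ∈ Icc 0 T, ‖g t‖ = powNorm v lam τ (f t)) ∧
      (∀ t ∈ Icc 0 T, ∀ k, inner 𝕜 (v k) (g t) = (lam k ^ τ : ℝ) * inner 𝕜 (v k) (f t)) ∧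
      ContinuousOn f (Icc 0 T) ∧ ∀ t ∈ Icc 0 T, ‖f t‖ ≤ lam 0 ^ (-τ) * ‖g t‖ := by
  have hex : ∀ t, ∃ y : H, t ∈ Icc 0 T →
      ∀ k, inner 𝕜 (v k) y = (lam k ^ τ : ℝ) * inner 𝕜 (v k) (f t) := by
    intro t
    by_cases ht : t ∈ Icc 0 T
    · have hs : Summable fun k => ‖((lam k ^ τ : ℝ) : 𝕜) * inner 𝕜 (v k) (f t)‖ ^ 2 := by
        refine (hf.1 t ht).congr fun k => ?_
        rw [norm_mul, mul_pow, RCLike.norm_ofReal, sq_abs, ← Real.rpow_mul_natCast (hA.pos k).le]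
        norm_num [mul_comm]
      obtain ⟨y, hy⟩ := exists_inner_eq v hs
      exact ⟨y, fun _ => hy⟩
    · exact ⟨0, fun h => absurd h ht⟩
  choose g hg using hex
  have hle : ∀ x y : H, (∀ k, inner 𝕜 (v k) y = (lam k ^ τ : ℝ) * inner 𝕜 (v k) x) →
      ‖x‖ ≤ lam 0 ^ (-τ) * ‖y‖ := by
    intro x y h
    refine norm_le_of_inner_le v (Real.rpow_nonneg (hA.pos 0).le _) fun k => ?_
    rw [h, norm_mul, RCLike.norm_ofReal, abs_of_nonneg (Real.rpow_nonneg (hA.pos k).le _),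
      ← mul_assoc]
    refine le_mul_of_one_le_left (norm_nonneg _) ?_
    rw [Real.rpow_neg (hA.pos 0).le, ← div_eq_inv_mul, le_div_iff₀ (Real.rpow_pos_of_pos (hA.pos 0) _),
      one_mul]
    exact Real.rpow_le_rpow (hA.pos 0).le (hA.mono (Nat.zero_le k)) hτ
  have hdiff : ∀ s ∈ Icc 0 T, ∀ t ∈ Icc 0 T, ∀ k, inner 𝕜 (v k) (g s - g t) =
      (lam k ^ τ : ℝ) * inner 𝕜 (v k) (f s - f t) := fun s hs t ht k => by
    rw [inner_sub_right, inner_sub_right, hg s hs, hg t ht, mul_sub]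
  have hgc : ContinuousOn g (Icc 0 T) := by
    intro t ht
    rw [ContinuousWithinAt, tendsto_iff_norm_sub_tendsto_zero]
    refine (hf.2 t ht).congr' ?_
    filter_upwards [self_mem_nhdsWithin] with s hs
    exact powNorm_eq_norm hA.pos (hdiff s hs t ht)
  refine ⟨g, hgc, fun t ht => (powNorm_eq_norm hA.pos (hg t ht)).symm, hg, fun t ht => ?_,
    fun t ht => hle _ _ (hg t ht)⟩
  rw [ContinuousWithinAt, tendsto_iff_norm_sub_tendsto_zero]
  have h1 : Tendsto (fun s => lam 0 ^ (-τ) * ‖g s - g t‖) (𝓝[Icc 0 T] t) (𝓝 0) := by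
    have := ((hgc t ht).sub_const (g t)).norm.const_mul (lam 0 ^ (-τ))
    simpa [ContinuousWithinAt] using this
  refine squeeze_zero' (Eventually.of_forall fun _ => norm_nonneg _) ?_ h1
  filter_upwards [self_mem_nhdsWithin] with s hs
  exact hle _ _ (hdiff s hs t ht)

end Operators

/-! ### Fourier coefficients of the Caputo derivative. -/

section CaputoCoefficients

variable {𝕜 : Type*} [RCLike 𝕜] {H : Type*} [NormedAddCommGroup H] [InnerProductSpace 𝕜 H]
  [CompleteSpace H] [NormedSpace ℝ H] [IsScalarTower ℝ 𝕜 H] {ρ γ : ℝ}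

lemma inner_caputo {u : ℝ → H} {t : ℝ} (hu : CaputoExists ρ u t) (x : H) :
    IntervalIntegrable (fun ξ => (((t - ξ) ^ (-ρ) : ℝ) : 𝕜) * inner 𝕜 x (deriv u ξ)) volume 0 t ∧
    inner 𝕜 x (caputo ρ u t) = (((Real.Gamma (1 - ρ))⁻¹ : ℝ) : 𝕜) *
      ∫ ξ in (0 : ℝ)..t, (((t - ξ) ^ (-ρ) : ℝ) : 𝕜) * inner 𝕜 x (deriv u ξ) := by
  have e : ∀ ξ, (((t - ξ) ^ (-ρ) : ℝ) : 𝕜) * inner 𝕜 x (deriv u ξ) =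
      innerSL 𝕜 x ((t - ξ) ^ (-ρ) • deriv u ξ) := fun ξ => by
    rw [RCLike.real_smul_eq_coe_smul (K := 𝕜), map_smul, smul_eq_mul, innerSL_apply_apply]
  simp only [e]
  constructor
  · exact ⟨(innerSL 𝕜 x).integrable_comp hu.1, (innerSL 𝕜 x).integrable_comp hu.2⟩
  · rw [(innerSL 𝕜 x).intervalIntegral_comp_comm hu, caputo,
      RCLike.real_smul_eq_coe_smul (K := 𝕜), inner_smul_right, innerSL_apply_apply]

/-- For g = y' the right side is λ(y - y(0)) + λγ D^ρ y. This is the bridge between the Caputo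
equation and its Volterra form. -/
lemma conv_kap {lam : ℝ} {g : ℝ → 𝕜} {t : ℝ} (hg : IntervalIntegrable g volume 0 t)
    (hg' : IntervalIntegrable (fun ξ => (((t - ξ) ^ (-ρ) : ℝ) : 𝕜) * g ξ) volume 0 t) :
    conv (fun τ => (kap ρ γ lam τ : 𝕜)) g t = lam * (∫ ξ in (0 : ℝ)..t, g ξ) +
      lam * γ * ((((Real.Gamma (1 - ρ))⁻¹ : ℝ) : 𝕜) *
        ∫ ξ in (0 : ℝ)..t, (((t - ξ) ^ (-ρ) : ℝ) : 𝕜) * g ξ) := by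
  rw [conv_comm, conv, ← intervalIntegral.integral_const_mul, ← intervalIntegral.integral_const_mul,
    ← intervalIntegral.integral_const_mul, ← intervalIntegral.integral_add (hg.const_mul _)
      ((hg'.const_mul _).const_mul _)]
  refine intervalIntegral.integral_congr fun ξ _ => ?_
  simp only [kap]
  push_cast
  ring

end CaputoCoefficients

/-! ### Existence and bounds for the forward problem with initial value in D(A). -/

section Forward

variable {𝕜 : Type*} [RCLike 𝕜] {H : Type*} [NormedAddCommGroup H] [InnerProductSpace 𝕜 H]
  {v : HilbertBasis ℕ 𝕜 H} {lam : ℕ → ℝ} {ρ γ T ε : ℝ}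

lemma Vcoeff_eq_conv (f : ℝ → H) (k : ℕ) (t : ℝ) : Vcoeff v lam ρ γ f k t =
    conv (fun τ => (Bfun ρ γ (lam k) τ : 𝕜)) (fun τ => inner 𝕜 (v k) (f τ)) t := by
  rw [conv_comm, Vcoeff, conv]
  exact intervalIntegral.integral_congr fun τ _ => mul_comm _ _

variable [CompleteSpace H] [NormedSpace ℝ H] [IsScalarTower ℝ 𝕜 H] {A : H →ₗ.[𝕜] H}

/-- Majorant of `λ ^ (-ε) B'(λ, σ)`. -/
def derivMajorant (ρ γ T ε σ : ℝ) : ℝ := 2 * kapConst ρ γ T ^ ε * σ ^ (ε * (1 - ρ) - 1)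

/-- Majorant of `λ B(λ, σ)`. -/
def lamMajorant (ρ γ σ : ℝ) : ℝ := (1 - ρ) * Real.Gamma (1 - ρ) / γ * σ ^ (ρ - 1)

lemma integrableOn_rpow_Ioc {a : ℝ} (ha : -1 < a) (T : ℝ) :
    IntegrableOn (fun σ : ℝ => σ ^ a) (Ioc 0 T) := by
  rcases le_or_gt T 0 with hT | hT
  · simp [Ioc_eq_empty_of_le hT]
  · exact (intervalIntegrable_iff_integrableOn_Ioc_of_le hT.le).1
      (intervalIntegral.intervalIntegrable_rpow' ha)

lemma continuousOn_rpow_Ioc (a T : ℝ) : ContinuousOn (fun σ : ℝ => σ ^ a) (Ioc 0 T) :=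
  continuousOn_id.rpow_const fun _ hσ => Or.inl (ne_of_gt hσ.1)

/-- The multiplier λ^(-ε) is compensated by letting the kernel act on A^ε f; this is where the extra
smoothness of f is spent. The majorant is integrable since ε(1-ρ) > 0. -/
lemma isDiagKernel_deriv (hρ : ρ ∈ Ioo (0 : ℝ) 1) (hγ : 0 < γ) (hε : ε ∈ Ioc (0 : ℝ) 1)
    (hpos : ∀ k, 0 < lam k) :
    IsDiagKernel (fun σ k => lam k ^ (-ε) * deriv (Bfun ρ γ (lam k)) σ) (derivMajorant ρ γ T ε)
      T where
  continuousOn k := continuousOn_const.mul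
    ((Bfun_deriv_continuousOn hρ hγ (hpos k)).mono Ioc_subset_Ioi_self)
  bound_continuousOn := continuousOn_const.mul (continuousOn_rpow_Ioc _ _)
  bound_integrableOn := (integrableOn_rpow_Ioc (by
    have := mul_pos hε.1 (sub_pos.2 hρ.2); linarith) T).const_mul _
  bound σ hσ k := by
    have hl := Real.rpow_pos_of_pos (hpos k) ε
    rw [abs_mul, Real.rpow_neg (hpos k).le, abs_of_pos (inv_pos.2 hl), ← div_eq_inv_mul,
      div_le_iff₀ hl, mul_comm _ (lam k ^ ε)]
    exact abs_Bfun_deriv_le_rpow hρ hγ (hpos k) hσ.1 hσ.2 hε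

lemma isDiagKernel_lam_mul (hρ : ρ ∈ Ioo (0 : ℝ) 1) (hγ : 0 < γ) (hpos : ∀ k, 0 < lam k) :
    IsDiagKernel (fun σ k => lam k * Bfun ρ γ (lam k) σ) (lamMajorant ρ γ) T where
  continuousOn k := continuousOn_const.mul
    ((Bfun_continuousOn hρ hγ (hpos k)).mono fun _ hσ => hσ.1.le)
  bound_continuousOn := continuousOn_const.mul (continuousOn_rpow_Ioc _ _)
  bound_integrableOn := (integrableOn_rpow_Ioc (by linarith [hρ.1]) T).const_mul _
  bound σ hσ k := by
    rw [abs_of_nonneg (mul_nonneg (hpos k).le (Bfun_nonneg hρ hγ (hpos k) σ))]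
    exact lam_mul_Bfun_le hρ hγ (hpos k) hσ.1

lemma abs_Bfun_le_one (hρ : ρ ∈ Ioo (0 : ℝ) 1) (hγ : 0 < γ) (hpos : ∀ k, 0 < lam k) :
    ∀ t ∈ Icc (0 : ℝ) T, ∀ k, |Bfun ρ γ (lam k) t| ≤ 1 := fun t ht k => by
  rw [abs_of_nonneg (Bfun_nonneg hρ hγ (hpos k) t)]
  exact Bfun_le_one hρ hγ (hpos k) ht.1

lemma abs_Afun_le_one (hρ : ρ ∈ Ioo (0 : ℝ) 1) (hγ : 0 < γ) (hpos : ∀ k, 0 < lam k) :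
    ∀ t ∈ Icc (0 : ℝ) T, ∀ k, |Afun ρ γ (lam k) t| ≤ 1 := fun t ht k => by
  have := Afun_mem_Icc hρ hγ (hpos k) ht.1
  rw [abs_of_nonneg this.1]
  exact this.2

lemma Afun_continuousOn {l : ℝ} (hρ : ρ ∈ Ioo (0 : ℝ) 1) (hγ : 0 < γ) (hl : 0 < l) (hT : 0 ≤ T) :
    ContinuousOn (Afun ρ γ l) (Icc 0 T) := by
  have h : ContinuousOn (fun t => 1 - l * ∫ τ in (0 : ℝ)..t, Bfun ρ γ l τ) (Icc 0 T) :=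
    continuousOn_const.sub (continuousOn_const.mul fun t ht =>
      (hasDerivWithinAt_integral_Icc hT ((Bfun_continuousOn hρ hγ hl).mono fun _ hx => hx.1)
        ht).continuousWithinAt)
  exact h.congr fun t ht => Afun_eq_one_sub hρ hγ hl ht.1

/-- The bound for `‖u'‖` contributed by the right-hand side. -/
def derivConst (ρ γ T ε lam₁ : ℝ) : ℝ := lam₁ ^ (-ε) + ∫ σ in Ioc 0 T, derivMajorant ρ γ T ε σ

/-- The bound for `‖A u‖` contributed by the right-hand side. -/
def opConst (ρ γ T ε lam₁ : ℝ) : ℝ := (∫ σ in Ioc 0 T, lamMajorant ρ γ σ) * lam₁ ^ (-ε)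

/-- The condition c ∈ D(A) allows bounds for u', Au and A D^ρ u that are uniform down to t = 0. The
non-local problem needs this three times: for V with c = 0, for W with f = 0, and for u. -/
theorem exists_forward (hρ : ρ ∈ Ioo (0 : ℝ) 1) (hγ : 0 < γ) (hT : 0 < T)
    (hε : ε ∈ Ioo (0 : ℝ) 1) (hA : IsSpectral A v lam) {f : ℝ → H}
    (hf : ContinuousInPow v lam ε T f) {c : H} (hc : c ∈ A.domain) :
    ∃ u : ℝ → H, IsForwardSolution A ρ γ T f c u ∧
      (∀ t ∈ Icc 0 T, ∀ k, inner 𝕜 (v k) (u t) =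
        inner 𝕜 (v k) c * Afun ρ γ (lam k) t + Vcoeff v lam ρ γ f k t) ∧
      ∀ M, (∀ s ∈ Icc 0 T, powNorm v lam ε (f s) ≤ M) → ∀ t ∈ Ioc 0 T,
        ‖derivWithin u (Icc 0 T) t‖ ≤ ‖opVal A c‖ + derivConst ρ γ T ε (lam 0) * M ∧
        ‖opVal A (u t)‖ ≤ ‖opVal A c‖ + opConst ρ γ T ε (lam 0) * M ∧
        ‖opVal A (caputo ρ u t)‖ ≤ γ⁻¹ * (lam 0 ^ (-ε) * M +
          (‖opVal A c‖ + derivConst ρ γ T ε (lam 0) * M) +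
          (‖opVal A c‖ + opConst ρ γ T ε (lam 0) * M)) := by
  obtain ⟨g, hgc, hgn, hgi, hfc, hfg⟩ := hf.exists_continuousOn hA hε.1.le
  have hpos := hA.pos
  have hK1 : IsDiagKernel _ _ T := isDiagKernel_deriv hρ hγ ⟨hε.1, hε.2.le⟩ hpos
  have hK2 : IsDiagKernel _ _ T := isDiagKernel_lam_mul hρ hγ hpos
  have hfk : ∀ k, ContinuousOn (fun τ => inner 𝕜 (v k) (f τ)) (Icc 0 T) := fun k =>
    (innerSL 𝕜 (v k)).continuous.comp_continuousOn hfc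
  -- The candidate for u', namely f + B' * f - B(t)Ac, with B' * f written as (A^(-ε)B') * (A^ε f).
  set h : ℝ → H := fun t => f t +
    diagConv v (fun σ k => lam k ^ (-ε) * deriv (Bfun ρ γ (lam k)) σ) g t -
    diagMul v (fun k => Bfun ρ γ (lam k) t) (opVal A c) with hh
  have hhc : ContinuousOn h (Icc 0 T) := by
    refine (hfc.add (hK1.continuousOn_diagConv hgc)).sub ?_
    exact continuousOn_diagMul (m := fun t k => Bfun ρ γ (lam k) t) (κ := fun _ => 1)
      (fun k => (Bfun_continuousOn hρ hγ (hpos k)).mono fun _ hx => hx.1) continuousOn_const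
      (abs_Bfun_le_one hρ hγ hpos) continuousOn_const
  have hhk : ∀ t ∈ Icc 0 T, ∀ k, inner 𝕜 (v k) (h t) =
      scalarDeriv ρ γ (lam k) (inner 𝕜 (v k) c) (fun τ => inner 𝕜 (v k) (f τ)) t := by
    intro t ht k
    have hl := (Real.rpow_pos_of_pos (hpos k) ε).ne'
    rw [hh, inner_sub_right, inner_add_right, hK1.inner_diagConv hgc ht,
      inner_diagMul (fun k => abs_Bfun_le_one hρ hγ hpos t ht k), hA.inner_opVal hc, scalarDeriv]
    congr 1
    · congr 1
      refine intervalIntegral.integral_congr fun τ hτ => ?_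
      rw [uIcc_of_le ht.1] at hτ
      simp only
      rw [hgi (t - τ) ⟨by linarith [hτ.2], by linarith [hτ.1, ht.2]⟩, Real.rpow_neg (hpos k).le]
      push_cast
      have hl' : ((lam k ^ ε : ℝ) : 𝕜) ≠ 0 := by exact_mod_cast hl
      field_simp
    · ring
  set u : ℝ → H := fun t => c + ∫ s in (0 : ℝ)..t, h s with hu
  have hder : ∀ t ∈ Icc 0 T, HasDerivWithinAt u (h t) (Icc 0 T) t := fun t ht =>
    (hasDerivWithinAt_integral_Icc hT.le hhc ht).const_add c
  have hdw : ∀ t ∈ Icc 0 T, derivWithin u (Icc 0 T) t = h t := fun t ht =>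
    (hder t ht).derivWithin (uniqueDiffOn_Icc hT t ht)
  -- The Caputo integral uses the two-sided `deriv`, which is identified only inside (0,T). The
  -- endpoints are null sets.
  have hd : ∀ t ∈ Ioo 0 T, deriv u t = h t := fun t ht =>
    ((hder t ⟨ht.1.le, ht.2.le⟩).hasDerivAt (Icc_mem_nhds ht.1 ht.2)).deriv
  have hhi : ∀ t ∈ Icc 0 T, IntervalIntegrable h volume 0 t := fun t ht =>
    (hhc.mono (by rw [uIcc_of_le ht.1]; exact Icc_subset_Icc_right ht.2)).intervalIntegrable
  have hik : ∀ t ∈ Icc 0 T, ∀ k, inner 𝕜 (v k) (u t) = inner 𝕜 (v k) c +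
      ∫ s in (0 : ℝ)..t, inner 𝕜 (v k) (h s) := fun t ht k => by
    have := (innerSL 𝕜 (v k)).intervalIntegral_comp_comm (hhi t ht)
    simp only [innerSL_apply_apply] at this
    rw [hu, inner_add_right, this]
  have huk : ∀ t ∈ Icc 0 T, ∀ k, inner 𝕜 (v k) (u t) =
      inner 𝕜 (v k) c * Afun ρ γ (lam k) t + Vcoeff v lam ρ γ f k t := by
    intro t ht k
    rw [hik t ht, intervalIntegral.integral_congr (g := scalarDeriv ρ γ (lam k)
      (inner 𝕜 (v k) c) fun τ => inner 𝕜 (v k) (f τ)) fun s hs => hhk s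
        (by rw [uIcc_of_le ht.1] at hs; exact ⟨hs.1, hs.2.trans ht.2⟩) k,
      integral_scalarDeriv hρ hγ (hpos k) ht.1 ((hfk k).mono (Icc_subset_Icc_right ht.2)),
      Vcoeff_eq_conv, ofReal_Afun hρ hγ (hpos k) ht.1]
    ring
  -- The candidate for Au: A(λ,t) multiplies Ac, and λB is convolved with f.
  set a : ℝ → H := fun t => diagMul v (fun k => Afun ρ γ (lam k) t) (opVal A c) +
    diagConv v (fun σ k => lam k * Bfun ρ γ (lam k) σ) f t with ha
  have hac : ContinuousOn a (Icc 0 T) :=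
    (continuousOn_diagMul (m := fun t k => Afun ρ γ (lam k) t) (κ := fun _ => 1)
      (fun k => Afun_continuousOn hρ hγ (hpos k) hT.le) continuousOn_const
      (abs_Afun_le_one hρ hγ hpos) continuousOn_const).add (hK2.continuousOn_diagConv hfc)
  have hau : ∀ t ∈ Icc 0 T, u t ∈ A.domain ∧ opVal A (u t) = a t := fun t ht => by
    refine hA.mem_domain_and_opVal_eq fun k => ?_
    rw [ha, inner_add_right, inner_diagMul (fun k => abs_Afun_le_one hρ hγ hpos t ht k),
      hK2.inner_diagConv hfc ht, hA.inner_opVal hc, huk t ht, Vcoeff_eq_conv]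
    simp only [RCLike.ofReal_mul]
    rw [conv_const_mul_left]
    ring
  have hcap : ∀ t ∈ Ioc 0 T, CaputoExists ρ u t := fun t ht => by
    have h1 : IntervalIntegrable (fun ξ : ℝ => (t - ξ) ^ (-ρ)) volume 0 t := by
      have := (intervalIntegral.intervalIntegrable_rpow' (a := 0) (b := t) (r := -ρ)
        (by linarith [hρ.2])).comp_sub_left t
      simpa using this.symm
    have h2 : IntervalIntegrable (fun ξ : ℝ => (t - ξ) ^ (-ρ) • h ξ) volume 0 t :=
      h1.smul_continuousOn (hhc.mono (by
        rw [uIcc_of_le ht.1.le]; exact Icc_subset_Icc_right ht.2))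
    refine h2.congr_ae ?_
    rw [uIoc_of_le ht.1.le, ← Measure.restrict_congr_set Ioo_ae_eq_Ioc]
    filter_upwards [ae_restrict_mem measurableSet_Ioo] with ξ hξ
    rw [hd ξ ⟨hξ.1, hξ.2.trans_le ht.2⟩]
  -- The candidate for A D^ρ u is read off from the equation, so its continuity and bound are
  -- immediate. What remains is to match its coefficients by the scalar equation.
  set q : ℝ → H := fun t => γ⁻¹ • (f t - h t - a t) with hq
  have hqc : ContinuousOn q (Icc 0 T) := ((hfc.sub hhc).sub hac).const_smul _
  have hqk : ∀ t ∈ Ioc 0 T, caputo ρ u t ∈ A.domain ∧ opVal A (caputo ρ u t) = q t := by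
    intro t ht
    have htc : t ∈ Icc 0 T := ⟨ht.1.le, ht.2⟩
    refine hA.mem_domain_and_opVal_eq fun k => ?_
    obtain ⟨i1, e1⟩ := inner_caputo (𝕜 := 𝕜) (hcap t ht) (v k)
    have hae : ∀ᵐ ξ ∂(volume.restrict (Ioc 0 t)), deriv u ξ = h ξ := by
      rw [← Measure.restrict_congr_set Ioo_ae_eq_Ioc]
      filter_upwards [ae_restrict_mem measurableSet_Ioo] with ξ hξ
      exact hd ξ ⟨hξ.1, hξ.2.trans_le ht.2⟩
    have hae' : ∀ᵐ ξ, ξ ∈ Ioc 0 t → (((t - ξ) ^ (-ρ) : ℝ) : 𝕜) * inner 𝕜 (v k) (deriv u ξ) =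
        (((t - ξ) ^ (-ρ) : ℝ) : 𝕜) * scalarDeriv ρ γ (lam k) (inner 𝕜 (v k) c)
          (fun τ => inner 𝕜 (v k) (f τ)) ξ := by
      rw [ae_restrict_iff' measurableSet_Ioc] at hae
      filter_upwards [hae] with ξ h1 h2
      rw [h1 h2, hhk ξ ⟨h2.1.le, h2.2.trans ht.2⟩]
    have i2 := i1.congr_ae (g := fun ξ => (((t - ξ) ^ (-ρ) : ℝ) : 𝕜) * scalarDeriv ρ γ (lam k)
      (inner 𝕜 (v k) c) (fun τ => inner 𝕜 (v k) (f τ)) ξ) (by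
        rw [uIoc_of_le ht.1.le]; exact (ae_restrict_iff' measurableSet_Ioc).2 hae')
    have e2 := intervalIntegral.integral_congr_ae (μ := volume) (a := 0) (b := t)
      (by rw [uIoc_of_le ht.1.le]; exact hae')
    have hsc := continuousOn_scalarDeriv (c := inner 𝕜 (v k) c) hρ hγ (hpos k) (hfk k)
    have hck := conv_kap (ρ := ρ) (γ := γ) (lam := lam k)
      ((hsc.mono (by rw [uIcc_of_le ht.1.le]; exact Icc_subset_Icc_right ht.2)).intervalIntegrable
        (μ := volume) (a := 0) (b := t)) i2
    have heq := scalarDeriv_equation (c := inner 𝕜 (v k) c) hρ hγ (hpos k) hT (hfk k) htc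
    have hint := hik t htc k
    rw [intervalIntegral.integral_congr (g := scalarDeriv ρ γ (lam k)
      (inner 𝕜 (v k) c) fun τ => inner 𝕜 (v k) (f τ)) fun s hs => hhk s
        (by rw [uIcc_of_le ht.1.le] at hs; exact ⟨hs.1, hs.2.trans ht.2⟩) k] at hint
    have hax := hA.inner_opVal (hau t htc).1 k
    rw [(hau t htc).2] at hax
    rw [e1, e2, hq]
    simp only
    rw [RCLike.real_smul_eq_coe_smul (K := 𝕜), inner_smul_right, inner_sub_right, inner_sub_right,
      hax, hhk t htc, hint]
    rw [hck] at heq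
    have hγ' : (γ : 𝕜) ≠ 0 := by exact_mod_cast hγ.ne'
    rw [RCLike.ofReal_inv, inv_mul_eq_iff_eq_mul₀ hγ']
    linear_combination -heq
  have hsub : Ioc 0 T ⊆ Icc 0 T := Ioc_subset_Icc_self
  refine ⟨u, ⟨⟨fun t ht => (hder t ht).continuousWithinAt,
    fun t ht => (hder t (hsub ht)).differentiableWithinAt,
    (hhc.mono hsub).congr fun t ht => hdw t (hsub ht), fun t ht => (hau t (hsub ht)).1,
    (hac.mono hsub).congr fun t ht => (hau t (hsub ht)).2, hcap, fun t ht => (hqk t ht).1,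
    (hqc.mono hsub).congr fun t ht => (hqk t ht).2, fun t ht => ?_⟩, by simp [hu]⟩, huk, ?_⟩
  · have hsum : opVal A (u t + γ • caputo ρ u t) = a t + γ • q t := by
      refine (hA.mem_domain_and_opVal_eq fun k => ?_).2
      rw [← (hau t (hsub ht)).2, ← (hqk t ht).2, inner_add_right, inner_add_right,
        RCLike.real_smul_eq_coe_smul (K := 𝕜), RCLike.real_smul_eq_coe_smul (K := 𝕜),
        inner_smul_right, inner_smul_right, hA.inner_opVal (hau t (hsub ht)).1,
        hA.inner_opVal (hqk t ht).1]
      ring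
    rw [hdw t (hsub ht), hsum, hq, smul_inv_smul₀ hγ.ne']
    abel
  · intro M hM t ht
    have htc := hsub ht
    have hgM : ∀ s ∈ Icc 0 T, ‖g s‖ ≤ M := fun s hs => (hgn s hs).trans_le (hM s hs)
    have hl0 : 0 ≤ lam 0 ^ (-ε) := Real.rpow_nonneg (hpos 0).le _
    have hfM : ∀ s ∈ Icc 0 T, ‖f s‖ ≤ lam 0 ^ (-ε) * M := fun s hs =>
      (hfg s hs).trans (mul_le_mul_of_nonneg_left (hgM s hs) hl0)
    have b1 : ‖h t‖ ≤ ‖opVal A c‖ + derivConst ρ γ T ε (lam 0) * M := by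
      have n1 := hK1.norm_diagConv_le (v := v) hgM htc
      have n2 := norm_diagMul_le (v := v) (fun k => abs_Bfun_le_one hρ hγ hpos t htc k) (opVal A c)
      calc ‖h t‖ ≤ _ := (norm_sub_le _ _).trans (add_le_add_left (norm_add_le _ _) _)
        _ ≤ lam 0 ^ (-ε) * M + (∫ σ in Ioc 0 T, derivMajorant ρ γ T ε σ) * M +
          1 * ‖opVal A c‖ := add_le_add (add_le_add (hfM t htc) n1) n2
        _ = _ := by rw [derivConst]; ring
    have b2 : ‖a t‖ ≤ ‖opVal A c‖ + opConst ρ γ T ε (lam 0) * M := by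
      have n1 := hK2.norm_diagConv_le (v := v) hfM htc
      have n2 := norm_diagMul_le (v := v) (fun k => abs_Afun_le_one hρ hγ hpos t htc k) (opVal A c)
      calc ‖a t‖ ≤ _ := norm_add_le _ _
        _ ≤ 1 * ‖opVal A c‖ + (∫ σ in Ioc 0 T, lamMajorant ρ γ σ) * (lam 0 ^ (-ε) * M) :=
          add_le_add n2 n1
        _ = _ := by rw [opConst]; ring
    rw [hdw t htc, (hau t htc).2, (hqk t ht).2]
    refine ⟨b1, b2, ?_⟩
    rw [hq]
    simp only
    rw [norm_smul, Real.norm_of_nonneg (inv_pos.2 hγ).le]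
    refine mul_le_mul_of_nonneg_left ?_ (inv_pos.2 hγ).le
    exact (norm_sub_le _ _).trans (add_le_add ((norm_sub_le _ _).trans
      (add_le_add (hfM t htc) b1)) b2)

end Forward

/-! ### Every solution obeys the resolvent formula. -/

section Representation

variable {𝕜 : Type*} [RCLike 𝕜] {H : Type*} [NormedAddCommGroup H] [InnerProductSpace 𝕜 H]
  [NormedSpace ℝ H] {A : H →ₗ.[𝕜] H} {v : HilbertBasis ℕ 𝕜 H} {lam : ℕ → ℝ} {ρ γ T : ℝ}

lemma SolvesEquation.hasDerivAt {f w : ℝ → H} (hw : SolvesEquation A ρ γ T f w) {t : ℝ}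
    (ht : t ∈ Ioo 0 T) : HasDerivAt w (deriv w t) t ∧ derivWithin w (Icc 0 T) t = deriv w t := by
  have hn := Icc_mem_nhds ht.1 ht.2
  exact ⟨((hw.differentiable t ⟨ht.1, ht.2.le⟩).differentiableAt hn).hasDerivAt,
    derivWithin_of_mem_nhds hn⟩

/-- A solution carries no explicit control of u' near 0. Integrability comes from the Caputo
integral at t = T, whose weight (T - ξ)^(-ρ) is undone by the bounded factor (T - ξ)^ρ. -/
lemma SolvesEquation.integrableOn_deriv (hρ : ρ ∈ Ioo (0 : ℝ) 1) (hT : 0 < T) {f w : ℝ → H}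
    (hw : SolvesEquation A ρ γ T f w) : IntegrableOn (deriv w) (Ioc 0 T) := by
  have h1 := (intervalIntegrable_iff_integrableOn_Ioc_of_le hT.le).1
    (hw.caputo_exists T ⟨hT, le_rfl⟩)
  have h2 : ContinuousOn (fun ξ : ℝ => (T - ξ) ^ ρ) (Icc 0 T) :=
    (Continuous.continuousOn (by fun_prop)).rpow_const fun _ _ => Or.inr hρ.1.le
  have h3 := h1.continuousOn_smul_of_subset h2 isCompact_Icc measurableSet_Ioc Ioc_subset_Icc_self
  refine Integrable.congr h3 ?_
  rw [← Measure.restrict_congr_set Ioo_ae_eq_Ioc]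
  filter_upwards [ae_restrict_mem measurableSet_Ioo] with ξ hξ
  have : 0 < T - ξ := sub_pos.2 hξ.2
  rw [smul_smul, ← Real.rpow_add this, add_neg_cancel, Real.rpow_zero, one_smul]

variable [CompleteSpace H] [IsScalarTower ℝ 𝕜 H]

/-- The Fourier coefficients of every solution are given by the resolvent formula. -/
theorem SolvesEquation.inner_eq (hρ : ρ ∈ Ioo (0 : ℝ) 1) (hγ : 0 < γ) (hT : 0 < T)
    (hA : IsSpectral A v lam) {f w : ℝ → H} (hf : ContinuousOn f (Icc 0 T))
    (hw : SolvesEquation A ρ γ T f w) {t : ℝ} (ht : t ∈ Icc 0 T) (k : ℕ) :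
    inner 𝕜 (v k) (w t) =
      inner 𝕜 (v k) (w 0) * Afun ρ γ (lam k) t + Vcoeff v lam ρ γ f k t := by
  have hfk : ContinuousOn (fun τ => inner 𝕜 (v k) (f τ)) (Icc 0 T) :=
    (innerSL 𝕜 (v k)).continuous.comp_continuousOn hf
  have hgi : IntegrableOn (fun ξ => inner 𝕜 (v k) (deriv w ξ)) (Ioc 0 T) :=
    (innerSL 𝕜 (v k)).integrable_comp (hw.integrableOn_deriv hρ hT)
  have hftc : ∀ s ∈ Icc 0 T, inner 𝕜 (v k) (w s) = inner 𝕜 (v k) (w 0) +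
      ∫ ξ in (0 : ℝ)..s, inner 𝕜 (v k) (deriv w ξ) := by
    intro s hs
    have hsub := Ioc_subset_Ioc_right (b := (0 : ℝ)) hs.2
    have i1 : IntervalIntegrable (deriv w) volume 0 s :=
      (intervalIntegrable_iff_integrableOn_Ioc_of_le hs.1).2
        ((hw.integrableOn_deriv hρ hT).mono_set hsub)
    have e1 := intervalIntegral.integral_eq_sub_of_hasDerivAt_of_le hs.1
      (hw.continuousOn.mono (Icc_subset_Icc_right hs.2))
      (fun x hx => (hw.hasDerivAt ⟨hx.1, hx.2.trans_le hs.2⟩).1) i1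
    have e2 := (innerSL 𝕜 (v k)).intervalIntegral_comp_comm i1
    simp only [innerSL_apply_apply] at e2
    rw [e2, e1, inner_sub_right]
    ring
  have hsub := Ioc_subset_Ioc_right (b := (0 : ℝ)) ht.2
  rw [hftc t ht, Vcoeff_eq_conv]
  refine scalar_solution_formula hρ hγ (hA.pos k) ht.1 _ (hgi.mono_set hsub) ?_
    ((hfk.integrableOn_Icc.mono_set Ioc_subset_Icc_self).mono_set hsub)
  rw [← Measure.restrict_congr_set Ioo_ae_eq_Ioc]
  filter_upwards [ae_restrict_mem measurableSet_Ioo] with s hs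
  have hs' : s ∈ Ioo 0 T := ⟨hs.1, hs.2.trans_le ht.2⟩
  have hsc : s ∈ Ioc 0 T := ⟨hs'.1, hs'.2.le⟩
  obtain ⟨i2, e2⟩ := inner_caputo (𝕜 := 𝕜) (hw.caputo_exists s hsc) (v k)
  have i3 : IntervalIntegrable (fun ξ => inner 𝕜 (v k) (deriv w ξ)) volume 0 s :=
    (intervalIntegrable_iff_integrableOn_Ioc_of_le hs.1.le).2
      (hgi.mono_set (Ioc_subset_Ioc_right hsc.2))
  rw [conv_kap i3 i2, ← e2]
  have heq := hw.equation s hsc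
  rw [(hw.hasDerivAt hs').2] at heq
  have hmem : w s + γ • caputo ρ w s ∈ A.domain := by
    rw [RCLike.real_smul_eq_coe_smul (K := 𝕜)]
    exact A.domain.add_mem (hw.mem_domain s hsc)
      (A.domain.smul_mem _ (hw.caputo_mem_domain s hsc))
  have heq' := congrArg (fun x => inner 𝕜 (v k) x) heq
  simp only [inner_add_right] at heq'
  rw [hA.inner_opVal hmem, inner_add_right, RCLike.real_smul_eq_coe_smul (K := 𝕜),
    inner_smul_right, hftc s ⟨hs.1.le, hsc.2⟩] at heq'
  linear_combination heq'

end Representation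

/-! ### The non-local condition. -/

section Nonlocal

variable {𝕜 : Type*} [RCLike 𝕜] {H : Type*} [NormedAddCommGroup H] [InnerProductSpace 𝕜 H]
  {v : HilbertBasis ℕ 𝕜 H} {lam : ℕ → ℝ} {ρ γ T ε : ℝ}

lemma continuousInPow_zero : ContinuousInPow v lam ε T (0 : ℝ → H) := by
  refine ⟨fun t _ => ?_, fun t _ => ?_⟩
  · simp [powDomain, summable_zero]
  · simpa [powNorm] using tendsto_const_nhds

lemma Vcoeff_zero (k : ℕ) (t : ℝ) : Vcoeff v lam ρ γ (0 : ℝ → H) k t = 0 := by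
  simp [Vcoeff]

variable {A : H →ₗ.[𝕜] H}

lemma opVal_zero : opVal A (0 : H) = 0 := by
  rw [opVal, dif_pos A.domain.zero_mem]
  exact A.map_zero

variable [CompleteSpace H]

/-- The lower bound for `1 - A_ρ(λ, T)`. -/
def gapConst (ρ γ T lam₁ : ℝ) : ℝ := T / (lam₁⁻¹ + kapInt ρ γ T)

lemma gapConst_pos (hρ : ρ ∈ Ioo (0 : ℝ) 1) (hγ : 0 < γ) (hT : 0 < T) {lam₁ : ℝ}
    (h₁ : 0 < lam₁) : 0 < gapConst ρ γ T lam₁ := by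
  have := kapInt_nonneg hρ hγ hT.le
  unfold gapConst; positivity

lemma abs_inv_Afun_sub_one_le (hρ : ρ ∈ Ioo (0 : ℝ) 1) (hγ : 0 < γ) (hT : 0 < T)
    (hA : IsSpectral A v lam) (k : ℕ) :
    Afun ρ γ (lam k) T - 1 ≠ 0 ∧
      |(Afun ρ γ (lam k) T - 1)⁻¹| ≤ (gapConst ρ γ T (lam 0))⁻¹ := by
  have h1 : gapConst ρ γ T (lam 0) ≤ 1 - Afun ρ γ (lam k) T :=
    one_sub_Afun_ge hρ hγ (hA.pos 0) (hA.mono (Nat.zero_le k)) hT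
  have h2 := gapConst_pos hρ hγ hT (hA.pos 0)
  refine ⟨by linarith, ?_⟩
  rw [abs_inv, abs_of_neg (by linarith : Afun ρ γ (lam k) T - 1 < 0)]
  exact inv_anti₀ h2 (by linarith)

/-- For ψ = φ - V(T) these are the coefficients forced by u(T) = u(0) + φ. The multipliers are
bounded by the gap at T and commute with A, so D(A) is preserved. -/
lemma exists_initial_value (hρ : ρ ∈ Ioo (0 : ℝ) 1) (hγ : 0 < γ) (hT : 0 < T)
    (hA : IsSpectral A v lam) {ψ : H} (hψ : ψ ∈ A.domain) :
    ∃ c ∈ A.domain, (∀ k, inner 𝕜 (v k) c =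
      (((Afun ρ γ (lam k) T - 1)⁻¹ : ℝ) : 𝕜) * inner 𝕜 (v k) ψ) ∧
      ‖opVal A c‖ ≤ (gapConst ρ γ T (lam 0))⁻¹ * ‖opVal A ψ‖ := by
  have hb := fun k => (abs_inv_Afun_sub_one_le hρ hγ hT hA k).2
  have hc := inner_diagMul (v := v) hb ψ
  have hAc := inner_diagMul (v := v) hb (opVal A ψ)
  obtain ⟨h1, h2⟩ := hA.mem_domain_and_opVal_eq
    (x := diagMul v (fun k => (Afun ρ γ (lam k) T - 1)⁻¹) ψ)
    (y := diagMul v (fun k => (Afun ρ γ (lam k) T - 1)⁻¹) (opVal A ψ)) fun k => by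
      rw [hc, hAc, hA.inner_opVal hψ]; ring
  exact ⟨_, h1, hc, h2 ▸ norm_diagMul_le hb _⟩

/-- Constant in front of the norms of the data `φ`. -/
def dataConst (ρ γ T lam₁ : ℝ) : ℝ :=
  4 * (gapConst ρ γ T lam₁)⁻¹ ^ 2 + 8 * (γ⁻¹ * (gapConst ρ γ T lam₁)⁻¹) ^ 2

/-- Constant in front of the norm of the right-hand side `f`. -/
def sourceConst (ρ γ T ε lam₁ : ℝ) : ℝ :=
  2 * ((gapConst ρ γ T lam₁)⁻¹ * opConst ρ γ T ε lam₁ + derivConst ρ γ T ε lam₁) ^ 2 +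
  2 * ((gapConst ρ γ T lam₁)⁻¹ * opConst ρ γ T ε lam₁ + opConst ρ γ T ε lam₁) ^ 2 +
  2 * (γ⁻¹ * (lam₁ ^ (-ε) + 2 * (gapConst ρ γ T lam₁)⁻¹ * opConst ρ γ T ε lam₁ +
    derivConst ρ γ T ε lam₁ + opConst ρ γ T ε lam₁)) ^ 2

lemma sq_le_of_le_add {x a b p m : ℝ} (hx : 0 ≤ x) (h : x ≤ a * p + b * m) :
    x ^ 2 ≤ 2 * a ^ 2 * p ^ 2 + 2 * b ^ 2 * m ^ 2 := by
  nlinarith [pow_le_pow_left₀ hx h 2, sq_nonneg (a * p - b * m)]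

variable [NormedSpace ℝ H] [IsScalarTower ℝ 𝕜 H]

/-- Solving from 0 gives V, hence c from φ - V(T), hence W and u started at c. All identities are
then compared coefficientwise. The bound has no singular factor in t and includes t = T. -/
theorem nonlocal_problem (hρ : ρ ∈ Ioo (0 : ℝ) 1) (hγ : 0 < γ) (hT : 0 < T)
    (hε : ε ∈ Ioo (0 : ℝ) 1) (hA : IsSpectral A v lam) {f : ℝ → H} {φ : H}
    (hf : ContinuousInPow v lam ε T f) (hφ : φ ∈ A.domain) :
    ∃ u : ℝ → H, IsNonlocalSolution A ρ γ T f φ u ∧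
      (∀ w : ℝ → H, IsNonlocalSolution A ρ γ T f φ w → EqOn w u (Icc 0 T)) ∧
      (∃ V W : ℝ → H, IsForwardSolution A ρ γ T f 0 V ∧
        IsNonlocalSolution A ρ γ T 0 (φ - V T) W ∧ EqOn u (V + W) (Icc 0 T)) ∧
      (∀ t ∈ Icc 0 T, HasSum (fun k => solCoeff v lam ρ γ T f φ k t • v k) (u t)) ∧
      ∀ t ∈ Ioc 0 T, ‖derivWithin u (Icc 0 T) t‖ ^ 2 + ‖opVal A (u t)‖ ^ 2
          + ‖opVal A (caputo ρ u t)‖ ^ 2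
        ≤ dataConst ρ γ T (lam 0) * powNorm v lam 1 φ ^ 2 + sourceConst ρ γ T ε (lam 0) *
          sSup ((fun s => powNorm v lam ε (f s) ^ 2) '' Icc 0 T) := by
  obtain ⟨g, hgc, hgn, -, hfc, -⟩ := hf.exists_continuousOn hA hε.1.le
  have hTc : T ∈ Icc 0 T := ⟨hT.le, le_rfl⟩
  have hTo : T ∈ Ioc 0 T := ⟨hT, le_rfl⟩
  obtain ⟨V, hV, hVk, hVb⟩ := exists_forward hρ hγ hT hε hA hf A.domain.zero_mem
  have hVT := hV.1.mem_domain T hTo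
  obtain ⟨c, hc, hck, hcn⟩ := exists_initial_value hρ hγ hT hA (A.domain.sub_mem hφ hVT)
  obtain ⟨W, hW, hWk, -⟩ := exists_forward hρ hγ hT hε hA
    (continuousInPow_zero (v := v) (lam := lam) (ε := ε) (T := T)) hc
  obtain ⟨u, hu, huk, hub⟩ := exists_forward hρ hγ hT hε hA hf hc
  simp only [inner_zero_right, zero_mul, zero_add] at hVk
  simp only [Vcoeff_zero, add_zero] at hWk
  have hne : ∀ k, (Afun ρ γ (lam k) T : 𝕜) - 1 ≠ 0 := fun k => by
    exact_mod_cast (abs_inv_Afun_sub_one_le hρ hγ hT hA k).1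
  have hcmul : ∀ k, inner 𝕜 (v k) c * ((Afun ρ γ (lam k) T : 𝕜) - 1) =
      inner 𝕜 (v k) φ - Vcoeff v lam ρ γ f k T := fun k => by
    rw [hck, inner_sub_right, hVk T hTc]
    push_cast
    field_simp [hne k]
  refine ⟨u, ⟨hu.1, ext_inner_basis v fun k => ?_⟩, fun w hw t ht => ext_inner_basis v fun k => ?_,
    ⟨V, W, hV, ⟨hW.1, ext_inner_basis v fun k => ?_⟩, fun t ht => ext_inner_basis v fun k => ?_⟩,
    fun t ht => ?_, fun t ht => ?_⟩
  · rw [huk T hTc, hu.2, inner_add_right]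
    linear_combination hcmul k
  -- The condition on w determines its initial coefficients after division by A(λ_k,T) - 1 ≠ 0, so
  -- they are those of c.
  · have h1 := hw.1.inner_eq hρ hγ hT hA hfc hTc k
    rw [hw.2, inner_add_right] at h1
    rw [hw.1.inner_eq hρ hγ hT hA hfc ht, huk t ht]
    congr 2
    refine mul_right_cancel₀ (hne k) ?_
    linear_combination -h1 - hcmul k
  · rw [hWk T hTc, hW.2, inner_add_right, inner_sub_right, hVk T hTc]
    linear_combination hcmul k
  · rw [Pi.add_apply, inner_add_right, huk t ht, hVk t ht, hWk t ht]
    ring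
  · have h1 := v.hasSum_repr (u t)
    refine h1.congr_fun fun k => ?_
    rw [v.repr_apply_apply, huk t ht, solCoeff, ← hcmul k]
    congr 2
    push_cast
    field_simp [hne k]
  · set S := sSup ((fun s => powNorm v lam ε (f s) ^ 2) '' Icc 0 T) with hS
    have hbdd : BddAbove ((fun s => powNorm v lam ε (f s) ^ 2) '' Icc 0 T) :=
      isCompact_Icc.bddAbove_image ((hgc.norm.pow 2).congr fun s hs => by
        rw [← hgn s hs, Pi.pow_apply])
    have hle : ∀ s ∈ Icc 0 T, powNorm v lam ε (f s) ^ 2 ≤ S := fun s hs =>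
      le_csSup hbdd (mem_image_of_mem _ hs)
    have hS0 : 0 ≤ S := (sq_nonneg _).trans (hle T hTc)
    have hM : ∀ s ∈ Icc 0 T, powNorm v lam ε (f s) ≤ √S := fun s hs => Real.le_sqrt_of_sq_le (hle s hs)
    obtain ⟨b1, b2, b3⟩ := hub _ hM t ht
    have hVn : ‖opVal A (V T)‖ ≤ opConst ρ γ T ε (lam 0) * √S := by
      have := (hVb _ hM T hTo).2.1
      rwa [opVal_zero, norm_zero, zero_add] at this
    have hG := inv_pos.2 (gapConst_pos hρ hγ hT (hA.pos 0))
    have hcn' : ‖opVal A c‖ ≤ (gapConst ρ γ T (lam 0))⁻¹ * powNorm v lam 1 φ +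
        (gapConst ρ γ T (lam 0))⁻¹ * opConst ρ γ T ε (lam 0) * √S := by
      have e : opVal A (φ - V T) = opVal A φ - opVal A (V T) :=
        (hA.mem_domain_and_opVal_eq fun k => by
          rw [inner_sub_right, inner_sub_right, hA.inner_opVal hφ, hA.inner_opVal hVT, mul_sub]).2
      rw [e] at hcn
      rw [hA.powNorm_one hφ, mul_assoc, ← mul_add]
      exact hcn.trans (mul_le_mul_of_nonneg_left
        ((norm_sub_le _ _).trans (add_le_add_right hVn _)) hG.le)
    set G := (gapConst ρ γ T (lam 0))⁻¹
    set P := powNorm v lam 1 φ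
    have s1 := sq_le_of_le_add (a := G)
      (b := G * opConst ρ γ T ε (lam 0) + derivConst ρ γ T ε (lam 0)) (p := P) (m := √S)
      (norm_nonneg _) (b1.trans (by linarith))
    have s2 := sq_le_of_le_add (a := G)
      (b := G * opConst ρ γ T ε (lam 0) + opConst ρ γ T ε (lam 0)) (p := P) (m := √S)
      (norm_nonneg _) (b2.trans (by linarith))
    -- The factor 2 arises because ‖Ac‖ enters through both u' and Au.
    have s3 := sq_le_of_le_add (a := γ⁻¹ * (2 * G))
      (b := γ⁻¹ * (lam 0 ^ (-ε) + 2 * G * opConst ρ γ T ε (lam 0) +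
        derivConst ρ γ T ε (lam 0) + opConst ρ γ T ε (lam 0))) (p := P) (m := √S)
      (norm_nonneg _) (b3.trans (by
        rw [mul_assoc γ⁻¹, mul_assoc γ⁻¹, ← mul_add]
        exact mul_le_mul_of_nonneg_left (by linarith) (inv_pos.2 hγ).le))
    rw [Real.sq_sqrt hS0] at s1 s2 s3
    refine (add_le_add (add_le_add s1 s2) s3).trans_eq ?_
    rw [dataConst, sourceConst]
    ring

end Nonlocal

end RayleighStokes

end

/-! ### The main theorem, with constants fixed before the space and the operator. -/

theorem theorem4p3 {𝕜 : Type*} [RCLike 𝕜] (ρ γ T lam₁ : ℝ) (hρ : ρ ∈ Set.Ioo (0 : ℝ) 1)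
    (hγ : 0 < γ) (hT : 0 < T) (hlam₁ : 0 < lam₁) :
    ∃ C : ℝ, 0 < C ∧ ∀ ε ∈ Set.Ioo (0 : ℝ) 1, ∃ Cε : ℝ, 0 < Cε ∧
      ∀ (H : Type*) [NormedAddCommGroup H] [InnerProductSpace 𝕜 H] [CompleteSpace H]
        [NormedSpace ℝ H] [IsScalarTower ℝ 𝕜 H]
        (A : H →ₗ.[𝕜] H) (v : HilbertBasis ℕ 𝕜 H) (lam : ℕ → ℝ),
        RayleighStokes.IsSpectral A v lam → lam 0 = lam₁ →
        ∀ (f : ℝ → H) (φ : H), RayleighStokes.ContinuousInPow v lam ε T f → φ ∈ A.domain →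
        ∃ u : ℝ → H,
          RayleighStokes.IsNonlocalSolution A ρ γ T f φ u ∧
          (∀ w : ℝ → H, RayleighStokes.IsNonlocalSolution A ρ γ T f φ w →
            Set.EqOn w u (Set.Icc 0 T)) ∧
          (∃ V W : ℝ → H, RayleighStokes.IsForwardSolution A ρ γ T f 0 V ∧
            RayleighStokes.IsNonlocalSolution A ρ γ T 0 (φ - V T) W ∧
            Set.EqOn u (V + W) (Set.Icc 0 T)) ∧
          (∀ t ∈ Set.Icc 0 T,
            HasSum (fun k => RayleighStokes.solCoeff v lam ρ γ T f φ k t • v k) (u t)) ∧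
          ∀ t ∈ Set.Ioo 0 T,
            ‖derivWithin u (Set.Icc 0 T) t‖ ^ 2 + ‖RayleighStokes.opVal A (u t)‖ ^ 2
                + ‖RayleighStokes.opVal A (RayleighStokes.caputo ρ u t)‖ ^ 2
              ≤ C * t ^ (2 * (ρ - 1)) * ‖φ‖ ^ 2
                + C * RayleighStokes.powNorm v lam 1 φ ^ 2
                + Cε * sSup ((fun s => RayleighStokes.powNorm v lam ε (f s) ^ 2) ''
                    Set.Icc 0 T) := by
  have hG := RayleighStokes.gapConst_pos hρ hγ hT hlam₁
  refine ⟨RayleighStokes.dataConst ρ γ T lam₁, ?_, fun ε hε => ?_⟩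
  · unfold RayleighStokes.dataConst; positivity
  -- The source constant is a sum of squares, so adding 1 makes it visibly positive.
  refine ⟨RayleighStokes.sourceConst ρ γ T ε lam₁ + 1, ?_, ?_⟩
  · unfold RayleighStokes.sourceConst; positivity
  intro H _ _ _ _ _ A v lam hA h0 f φ hf hφ
  obtain ⟨u, h1, h2, h3, h4, h5⟩ := RayleighStokes.nonlocal_problem hρ hγ hT hε hA hf hφ
  refine ⟨u, h1, h2, h3, h4, fun t ht => (h5 t ⟨ht.1, ht.2.le⟩).trans ?_⟩
  rw [h0]
  have hC : 0 ≤ RayleighStokes.dataConst ρ γ T lam₁ := by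
    unfold RayleighStokes.dataConst; positivity
  have hS : 0 ≤ sSup ((fun s => RayleighStokes.powNorm v lam ε (f s) ^ 2) '' Icc 0 T) := by
    refine Real.sSup_nonneg ?_
    rintro _ ⟨s, -, rfl⟩
    positivity
  have ht' : 0 ≤ t ^ (2 * (ρ - 1)) := Real.rpow_nonneg ht.1.le _
  -- The singular term is pure slack: the bound already holds without it.
  have : 0 ≤ RayleighStokes.dataConst ρ γ T lam₁ * t ^ (2 * (ρ - 1)) * ‖φ‖ ^ 2 := by positivity
  linarith
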